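/- **Theorem (Equilibrium in the zero noise limit).** *Setting.* Let $\mu\le 0$, $\rho,\bar\rho,\alpha,\eta_{\max}>0$ and $\delta=\rho-\mu$. All controls are deterministic. The firm chooses $\eta\in\mathcal A_F$, i.e. $\eta:[0,\infty)\to[0,\eta_{\max}]$ Borel measurable; the investor chooses $\nu\in\mathcal A_I$, i.e. $\nu$ càdlàg, nondecreasing, $\nu_0\ge 0$ (with $\nu_{0-}=0$) and $\int_{[0,\infty)}e^{-\rho t}\,d\nu_t<\infty$. For $r\ge 0$ and $x>0$ put $$R^\eta_t=r+\int_0^t\eta_s\,ds,\qquad X^{\nu,\eta}_t=x+\int_0^t\mu X^{\nu,\eta}_s\,ds+\nu_t-\int_0^t\eta_s\,ds,$$ $$\mathcal J^F_{r,x}(\eta,\nu)=\int_0^\infty e^{-\bar\rho t}\,\pi(X^{\nu,\eta}_t)\,dt\in[0,\infty],$$ $$\mathcal J^I_{r,x}(\eta,\nu)=\int_0^\infty e^{-\rho t}\,\Pi(R^\eta_t,X^{\nu,\eta}_t)\,dt-\alpha\int_{[0,\infty)}e^{-\rho t}\,d\nu_t\in(-\infty,\infty],$$ where $\mathcal J^I_{r,x}(\eta,\nu)=-\infty$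 if $X^{\nu,\eta}$ becomes negative. *Assumptions.* $\Pi:[0,\infty)^2\to[0,\infty)$ and $\pi:[0,\infty)\to[0,\infty)$ are continuous, and: 1. $\Pi$ is nondecreasing in both variables; for $r>0$, $\Pi(r,\cdot)$ is strictly concave; $\Pi_x,\Pi_{xx}$ exist and are continuous on $(0,\infty)^2$; for $r>0$, $\lim_{x\to0}\Pi_x(r,x)=+\infty$ and $\lim_{x\to\infty}\Pi_x(r,x)=0$. With $G(r,\cdot)$ the inverse of $\Pi_x(r,\cdot)$, the map $a(r)=G(r,\alpha\delta)$ is strictly increasing and $C^1$ on $(0,\infty)$, and $\int_0^\infty e^{-\rho t}a(\eta_{\max}t)\,dt<\infty$. We set $a(0)=\lim_{r\downarrow0}a(r)$. 2. $\pi$ is $C^1$ and strictly increasing on $(0,\infty)$, $\dot\pi$ is nondecreasing there, $\pi(x)=\pi(x^+)$ for $x<0$, and $\int_0^\infty e^{-\bar\rho t}\pi(a(\eta_{\max}t))\,dt<\infty$. 3. If $\mu<0$, then $r\mapsto\dot\pi(a(r))\,\dot a(r)$ is nondecreasing on $(0,\infty)$. *Strategies and equilibrium.* The investor's policy is in feedback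 form: a non-anticipative map $N:\mathcal A_F\to\mathcal A_I$. A pair $(\eta^*,N)$ with $\eta^*\in\mathcal A_F$ is a Nash equilibrium started at $(r,x)$ if $X^{N(\eta^*),\eta^*}\ge0$ and $$\mathcal J^F_{r,x}(\eta^*,N(\eta^*))\ge\mathcal J^F_{r,x}(\eta,N(\eta)),\qquad \mathcal J^I_{r,x}(\eta^*,N(\eta^*))\ge\mathcal J^I_{r,x}(\eta^*,\nu)$$ for all $\eta\in\mathcal A_F$ and $\nu\in\mathcal A_I$. The reflecting policy $\nu^a$ is defined as follows. For $\eta\in\mathcal A_F$ let $\tau=\tau(\eta)=\inf\{t\ge0:X^{0,\eta}_t\le a(R^\eta_t)\}\in[0,\infty]$; put $\nu^a_t=0$ for $t<\tau$ and $$\nu^a_t=(a(r)-x)^++a(R^\eta_t)+R^\eta_t-a(R^\eta_\tau)-R^\eta_\tau-\int_\tau^t\mu\,a(R^\eta_s)\,ds\qquad(t\ge\tau).$$ *Conclusion.* For every $r\ge0$, $x>0$ and $\eta\in\mathcal A_F$ one has $X^{\nu^a,\eta}_t\ge a(R^\eta_t)$ for all $t\ge0$. For $c\in[0,\eta_{\max}]$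 let $J_c(r,x)=\mathcal J^F_{r,x}(c,\nu^a)$ be the firm's payoff for the constant control $\eta\equiv c$ against the reflecting policy. (i) If $\mu=0$, there is a strictly increasing $b:[0,\infty)\to\mathbb R$, continuous on $[0,\infty)$, $C^1$ on $(0,\infty)$, with $b(r)>a(r)$ for all $r\ge0$, which is uniquely determined by $$J_0(r,x)<J_{\eta_{\max}}(r,x)\iff x<b(r)\qquad(r\ge0,\ x>0),$$ and such that, for the game started at $(r,x)$, $r\ge 0$, $x>0$: if $x>b(r)$, then $(0,\nu^a)$ is a Nash equilibrium in which $\nu^a\equiv0$ along $\eta^*=0$ (neither player acts), and $(0,0)$ is one as well; if $x\le b(r)$, then $(\eta_{\max},\nu^a)$ is a Nash equilibrium. (ii) If $\mu<0$, there is a strictly increasing $b:[0,\infty)\to\mathbb R$, continuous on $[0,\infty)$, $C^1$ on $(0,\infty)$, with $b(r)>a(r)$ for all $r\ge0$, which is uniquely determined by: for each $r\ge0$, $b(r)$ is the only zero in $(a(r),\infty)$ of $$h(r,x)=-|\mu|\,x\,\partial_xJ_{\eta_{\max}}(r,x)-\bar\rho\,J_{\eta_{\max}}(r,x)+\pi(x),$$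 and such that, for every $r\ge 0$ and $x>0$, the pair $(\eta_{\max}1_{\{t\ge\tau_b\}},\nu^a)$ with $\tau_b=\inf\{t\ge0:xe^{\mu t}\le b(r)\}$ is a Nash equilibrium for the game started at $(r,x)$. -/

import Mathlib

open Set Filter Topology MeasureTheory
open scoped ENNReal

noncomputable section

/-- Primitive data of the zero-noise firm / investor game.  Time is `[0, ∞)`; only values of the
profit functions at non-negative arguments are ever used. -/
structure AbatementGame where
  /-- growth rate of the production capacity -/
  mu : ℝ
  /-- discount rate of the investor -/
  rho : ℝ
  /-- discount rate of the firm -/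
  rhoBar : ℝ
  /-- cost for the investor of one unit of production capacity -/
  alpha : ℝ
  /-- maximal abatement rate of the firm -/
  etaMax : ℝ
  /-- profit function `π` of the firm, on `[0, ∞)` -/
  profitF : ℝ → ℝ
  /-- profit function `Π (r, x)` of the investor, on `[0, ∞)²` -/
  profitI : ℝ → ℝ → ℝ

namespace AbatementGame

variable (g : AbatementGame)

/-- `Π_x (r, x)`. -/
def profitIx (r x : ℝ) : ℝ := deriv (g.profitI r) x

/-- `G (r, z)`, the inverse of `Π_x (r, ·)` on `(0, ∞)`. -/
def G (r z : ℝ) : ℝ := Function.invFunOn (g.profitIx r) (Ioi 0) z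

/-- `δ = ρ - μ`. -/
def delta : ℝ := g.rho - g.mu

/-- The investment boundary `a (r) = G (r, α δ)` for `r > 0`.  At `r = 0` it is extended by
its right limit, which for an increasing function is the infimum over `r > 0`. -/
def a (r : ℝ) : ℝ :=
  if 0 < r then g.G r (g.alpha * g.delta)
  else sInf ((fun s => g.G s (g.alpha * g.delta)) '' Ioi 0)

/-- The standing assumptions of the zero-noise game. -/
structure ZeroNoiseAssumption : Prop where
  mu_nonpos : g.mu ≤ 0
  rho_pos : 0 < g.rho
  rhoBar_pos : 0 < g.rhoBar
  alpha_pos : 0 < g.alpha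
  etaMax_pos : 0 < g.etaMax
  -- the profit function of the investor
  profitI_nonneg : ∀ r x, 0 ≤ r → 0 ≤ x → 0 ≤ g.profitI r x
  profitI_cont : ContinuousOn (fun p : ℝ × ℝ => g.profitI p.1 p.2) (Ici 0 ×ˢ Ici 0)
  profitI_mono_r : ∀ x, 0 ≤ x → MonotoneOn (fun r => g.profitI r x) (Ici 0)
  profitI_mono_x : ∀ r, 0 ≤ r → MonotoneOn (g.profitI r) (Ici 0)
  profitI_concave : ∀ r, 0 < r → StrictConcaveOn ℝ (Ici 0) (g.profitI r)
  profitI_diff : ∀ r x, 0 < r → 0 < x → DifferentiableAt ℝ (g.profitI r) x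
  profitIx_cont : ContinuousOn (fun p : ℝ × ℝ => g.profitIx p.1 p.2) (Ioi 0 ×ˢ Ioi 0)
  profitIx_diff : ∀ r x, 0 < r → 0 < x → DifferentiableAt ℝ (g.profitIx r) x
  profitIxx_cont :
    ContinuousOn (fun p : ℝ × ℝ => deriv (g.profitIx p.1) p.2) (Ioi 0 ×ˢ Ioi 0)
  inada_zero : ∀ r, 0 < r → Tendsto (g.profitIx r) (𝓝[>] 0) atTop
  inada_top : ∀ r, 0 < r → Tendsto (g.profitIx r) atTop (𝓝 0)
  a_strictMono : StrictMonoOn g.a (Ioi 0)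
  a_contDiff : ContDiffOn ℝ 1 g.a (Ioi 0)
  a_integrable :
    IntegrableOn (fun t => Real.exp (-g.rho * t) * g.a (g.etaMax * t)) (Ioi 0)
  -- the profit function of the firm
  profitF_nonneg : ∀ x, 0 ≤ x → 0 ≤ g.profitF x
  profitF_cont : ContinuousOn g.profitF (Ici 0)
  profitF_contDiff : ContDiffOn ℝ 1 g.profitF (Ioi 0)
  profitF_strictMono : StrictMonoOn g.profitF (Ioi 0)
  profitF_deriv_mono : MonotoneOn (deriv g.profitF) (Ioi 0)
  profitF_integrable :
    IntegrableOn (fun t => Real.exp (-g.rhoBar * t) * g.profitF (g.a (g.etaMax * t))) (Ioi 0)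
  -- needed only for a strictly negative growth rate
  deriv_comp_mono : g.mu < 0 →
    MonotoneOn (fun r => deriv g.profitF (g.a r) * deriv g.a r) (Ioi 0)

/-- The Lebesgue-Stieltjes measure `dν` of a nondecreasing right-continuous `ν`. -/
def dMeasure (nu : ℝ → ℝ) : Measure ℝ :=
  open Classical in if h : Monotone nu then h.stieltjesFunction.measure else 0

/-- The class `A_F` of (deterministic) controls of the firm. -/
def FirmControl (eta : ℝ → ℝ) : Prop :=
  Measurable eta ∧ ∀ t, 0 ≤ t → 0 ≤ eta t ∧ eta t ≤ g.etaMax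

/-- The class `A_I` of (deterministic) controls of the investor.  A control is extended by `0`
to negative times, so that `ν₀ ≥ 0` and `dν` has the atom `ν₀` at time `0`. -/
structure InvestorControl (nu : ℝ → ℝ) : Prop where
  mono : Monotone nu
  rightCont : ∀ t, ContinuousWithinAt nu (Ici t) t
  eq_zero : ∀ t, t < 0 → nu t = 0
  finite_cost :
    ∫⁻ t in Ici 0, ENNReal.ofReal (Real.exp (-g.rho * t)) ∂(dMeasure nu) < ⊤

/-- `R_t = r + ∫₀ᵗ η_s ds`. -/
def R (r : ℝ) (eta : ℝ → ℝ) (t : ℝ) : ℝ := r + ∫ s in (0 : ℝ)..t, eta s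

/-- The capacity `X_t`, in the explicit form
`X_t = e^{μ t} (x + ∫_{[0,t]} e^{-μ s} dν_s - ∫₀ᵗ e^{-μ s} η_s ds)` of the solution of
`X_t = x + ∫₀ᵗ μ X_s ds + ν_t - ∫₀ᵗ η_s ds`. -/
def X (x : ℝ) (eta nu : ℝ → ℝ) (t : ℝ) : ℝ :=
  Real.exp (g.mu * t) *
    (x + (∫ s in Icc 0 t, Real.exp (-g.mu * s) ∂(dMeasure nu))
      - ∫ s in (0 : ℝ)..t, Real.exp (-g.mu * s) * eta s)

/-- The payoff of the firm, with `π (x) = π (x⁺)` for `x < 0`. -/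
def JF (x : ℝ) (eta nu : ℝ → ℝ) : ℝ≥0∞ :=
  ∫⁻ t in Ioi 0,
    ENNReal.ofReal (Real.exp (-g.rhoBar * t) * g.profitF (max (g.X x eta nu t) 0))

open Classical in
/-- The payoff of the investor, with values in `[-∞, ∞]`.  Since `Π` lives on `[0, ∞)²`, the
payoff is `-∞` when the capacity becomes negative. -/
def JI (r x : ℝ) (eta nu : ℝ → ℝ) : EReal :=
  if ∀ t, 0 ≤ t → 0 ≤ g.X x eta nu t then
    ((∫⁻ t in Ioi 0, ENNReal.ofReal
        (Real.exp (-g.rho * t) * g.profitI (R r eta t) (g.X x eta nu t)) : ℝ≥0∞) : EReal)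
      - ((ENNReal.ofReal g.alpha *
        ∫⁻ t in Ici 0, ENNReal.ofReal (Real.exp (-g.rho * t)) ∂(dMeasure nu) : ℝ≥0∞) : EReal)
  else ⊥

/-- Nash equilibrium of the game started at `(R₀, X₀) = (r, x)`.  The policy of the investor is in
feedback form: a non-anticipative rule `N` that turns the abatement control in force into an
admissible investment control, so that when the firm deviates to `η`, the investor invests `N η`.
An arbitrary admissible deviation `ν` of the investor is tested against the control of the firm. -/
structure IsNash (r x : ℝ) (eta : ℝ → ℝ) (N : (ℝ → ℝ) → ℝ → ℝ) : Prop where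
  firm_control : g.FirmControl eta
  investor_control : ∀ eta', g.FirmControl eta' → g.InvestorControl (N eta')
  nonanticipative : ∀ eta₁ eta₂, g.FirmControl eta₁ → g.FirmControl eta₂ → ∀ t, 0 ≤ t →
    (∀ s, 0 ≤ s → s ≤ t → eta₁ s = eta₂ s) → N eta₁ t = N eta₂ t
  nonneg : ∀ t, 0 ≤ t → 0 ≤ g.X x eta (N eta) t
  firm_opt : ∀ eta', g.FirmControl eta' → g.JF x eta' (N eta') ≤ g.JF x eta (N eta)
  investor_opt : ∀ nu, g.InvestorControl nu → g.JI r x eta nu ≤ g.JI r x eta (N eta)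

/-- `τ (η) = inf {t ≥ 0 : X_t^{0,η} ≤ a (R_t^η)}`, equal to `+∞` if there is no such time. -/
def tau (r x : ℝ) (eta : ℝ → ℝ) : EReal :=
  sInf ((fun t : ℝ => (t : EReal)) ''
    {t : ℝ | 0 ≤ t ∧ g.X x eta (fun _ => 0) t ≤ g.a (R r eta t)})

open Classical in
/-- The reflecting policy `ν^a`: nothing before `τ (η)`, then what keeps `X` equal to `a (R)`;
`(a (r) - x)⁺` is the initial lump sum, which vanishes when `x ≥ a (r)`. -/
def nuA (r x : ℝ) (eta : ℝ → ℝ) (t : ℝ) : ℝ :=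
  if g.tau r x eta ≤ (t : EReal) then
    max (g.a r - x) 0 + g.a (R r eta t) + R r eta t
      - g.a (R r eta (g.tau r x eta).toReal) - R r eta (g.tau r x eta).toReal
      - ∫ s in (g.tau r x eta).toReal..t, g.mu * g.a (R r eta s)
  else 0

/-- `τ_b = inf {t ≥ 0 : x e^{μ t} ≤ b (r)}`. -/
def tauB (b : ℝ → ℝ) (r x : ℝ) : EReal :=
  sInf ((fun t : ℝ => (t : EReal)) '' {t : ℝ | 0 ≤ t ∧ x * Real.exp (g.mu * t) ≤ b r})

open Classical in
/-- The abatement control `η_max 1_{t ≥ τ_b}`. -/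
def etaB (b : ℝ → ℝ) (r x t : ℝ) : ℝ :=
  if g.tauB b r x ≤ (t : EReal) then g.etaMax else 0

/-- Payoff of the firm for constant abatement rate `c` against the reflecting policy. -/
def payoffConst (c r x : ℝ) : ℝ≥0∞ := g.JF x (fun _ => c) (g.nuA r x (fun _ => c))

/-- `h (r, x) = -|μ| x ∂ₓ w₁ (r, x) - ρ̄ w₁ (r, x) + π (x)`, with `w₁` the payoff of the firm
for permanent abatement at the maximal rate against the reflecting policy. -/
def h (r x : ℝ) : ℝ :=
  -|g.mu| * x * deriv (fun y => (g.payoffConst g.etaMax r y).toReal) x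
    - g.rhoBar * (g.payoffConst g.etaMax r x).toReal + g.profitF x

/-- The regularity and position required of the abatement boundary. -/
structure IsBoundary (b : ℝ → ℝ) : Prop where
  cont : ContinuousOn b (Ici 0)
  contDiff : ContDiffOn ℝ 1 b (Ioi 0)
  strictMono : StrictMonoOn b (Ici 0)
  above : ∀ r, 0 ≤ r → g.a r < b r

end AbatementGame

end

/-! ### The boundary `a`, the profit functions, and pointwise optimality of `a` for the investor -/

namespace AbatementGame

variable {g : AbatementGame}

namespace ZeroNoiseAssumption

/-! Both optimality claims come down to pointwise inequalities along paths.

Investor. Let Y = `freeX` be the capacity without investment. Tonelli turns the cost of investment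
into a running cost of capacity, ∫ e^{-ρt} dν = δ ∫ e^{-ρt} (X - Y) dt (`lintegral_cost`). Up to a
term that does not depend on ν, the investor maximises ∫ e^{-ρt} (Π(R,X) - αδX) dt over paths X ≥ Y.
By concavity the integrand is largest at X = a(R) and decreases above it, so the best path is max(Y,
a(R)) (`profitI_sub_le`). Since μ ≤ 0 and `a` is increasing, Y stays below a(R) once it is there,
and ν^a produces exactly this path (`X_nuA`). Hence ν^a is a best reply to every control of the firm
(`JI_le_JI_nuA`), and against ν^a only the problem of the firm is left (`isNash_nuA`).

Firm. Let W be the payoff of permanent maximal abatement. Along that flow `tm` Y + R/η_max is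
constant, which gives the technology level `hit` at which `a` is reached and a closed form of W
(`payoffConst_max`). W solves the first-order equation of maximal abatement, so h has two
expressions, h = μ x W_x - ρ̄ W + π = η_max (W_x - W_r) (`hh_eq`, `hh_eq_sub`). Therefore, before
`a` is reached, e^{-ρ̄t} W(R,Y) formally moves under a control η at the rate e^{-ρ̄t} (h (1 -
η/η_max) - π): h is the gain from idling instead of abating (`eventually_slope_lt`). After `a` is
reached the profit is π(a(R)), and no control raises R faster than η_max. Thus the payoff of any
control is at most W + ∫ e^{-ρ̄t} G dt whenever G is continuous, nonnegative and dominates h along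
the path (`JF_nuA_le`).

The function h is strictly increasing in x, because π' is nondecreasing and positive
(`hh_hasDerivAt`), and strictly decreasing in r (`hh_anti`). It is negative at a(r) and positive for
some larger x. Its unique zero b(r) above a(r) is therefore increasing, and it is C¹ by the implicit
function theorem. Since R ≥ r and Y ≤ x e^{μt}, the choice G_t = h(r, max(x e^{μt}, b(r))) dominates
h along every path (`hh_le_gain`), and the resulting bound is attained. If x ≤ b(r), then G = 0 and
maximal abatement pays the bound. If x > b(r) and μ = 0, then G is constant and the bound is
π(x)/ρ̄, the payoff of idling. If x > b(r) and μ < 0, then G vanishes from τ_b on and the bound is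
the payoff of idling until τ_b and abating afterwards (`integral_hh_flow`). -/

lemma delta_pos (hg : g.ZeroNoiseAssumption) : 0 < g.delta := by
  have := hg.mu_nonpos; have := hg.rho_pos; unfold delta; linarith

lemma exists_profitIx_eq (hg : g.ZeroNoiseAssumption) {r : ℝ} (hr : 0 < r) :
    ∃ x ∈ Ioi (0 : ℝ), g.profitIx r x = g.alpha * g.delta := by
  have hpos : 0 < g.alpha * g.delta := mul_pos hg.alpha_pos hg.delta_pos
  obtain ⟨x₁, hx₁, hx₁'⟩ := (((hg.inada_zero r hr).eventually_gt_atTop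
    (g.alpha * g.delta)).and self_mem_nhdsWithin).exists
  obtain ⟨x₂, hx₂, hx₂'⟩ := (((hg.inada_top r hr).eventually_lt_const hpos).and
    (eventually_gt_atTop 0)).exists
  have hc : ContinuousOn (g.profitIx r) (Ioi 0) := fun x hx =>
    (hg.profitIx_diff r x hr hx).continuousAt.continuousWithinAt
  exact isPreconnected_Ioi.intermediate_value (mem_Ioi.2 hx₂') hx₁' hc ⟨hx₂.le, hx₁.le⟩

lemma a_eq (hr : 0 < r) : g.a r = g.G r (g.alpha * g.delta) := if_pos hr

lemma a_pos (hg : g.ZeroNoiseAssumption) {r : ℝ} (hr : 0 < r) : 0 < g.a r := by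
  rw [a_eq hr]
  exact Function.invFunOn_mem (hg.exists_profitIx_eq hr)

lemma profitIx_a (hg : g.ZeroNoiseAssumption) {r : ℝ} (hr : 0 < r) :
    g.profitIx r (g.a r) = g.alpha * g.delta := by
  rw [a_eq hr]
  exact Function.invFunOn_eq (hg.exists_profitIx_eq hr)

lemma a_zero : g.a 0 = sInf (g.a '' Ioi 0) := by
  rw [a, if_neg (lt_irrefl _)]
  congr 1
  exact image_congr fun s hs => (a_eq hs).symm

lemma bddBelow_a (hg : g.ZeroNoiseAssumption) : BddBelow (g.a '' Ioi 0) :=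
  ⟨0, by rintro _ ⟨s, hs, rfl⟩; exact (hg.a_pos hs).le⟩

lemma a_zero_nonneg (hg : g.ZeroNoiseAssumption) : 0 ≤ g.a 0 := by
  rw [a_zero]
  exact Real.sInf_nonneg (by rintro _ ⟨s, hs, rfl⟩; exact (hg.a_pos hs).le)

lemma a_nonneg (hg : g.ZeroNoiseAssumption) {r : ℝ} (hr : 0 ≤ r) : 0 ≤ g.a r := by
  rcases hr.eq_or_lt with rfl | hr
  · exact hg.a_zero_nonneg
  · exact (hg.a_pos hr).le

lemma a_zero_lt (hg : g.ZeroNoiseAssumption) {r : ℝ} (hr : 0 < r) : g.a 0 < g.a r := by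
  have h1 : g.a 0 ≤ g.a (r / 2) := by
    rw [a_zero]; exact csInf_le hg.bddBelow_a ⟨r / 2, half_pos hr, rfl⟩
  exact h1.trans_lt (hg.a_strictMono (half_pos hr) hr (half_lt_self hr))

lemma a_strictMonoOn (hg : g.ZeroNoiseAssumption) : StrictMonoOn g.a (Ici 0) := by
  intro r hr s hs hrs
  rcases (mem_Ici.1 hr).eq_or_lt with rfl | hr
  · exact hg.a_zero_lt hrs
  · exact hg.a_strictMono hr (hr.trans hrs) hrs

lemma a_continuousAt (hg : g.ZeroNoiseAssumption) {r : ℝ} (hr : 0 < r) : ContinuousAt g.a r :=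
  (hg.a_contDiff.contDiffAt (Ioi_mem_nhds hr)).continuousAt

lemma a_hasDerivAt (hg : g.ZeroNoiseAssumption) {r : ℝ} (hr : 0 < r) :
    HasDerivAt g.a (deriv g.a r) r :=
  ((hg.a_contDiff.contDiffAt (Ioi_mem_nhds hr)).differentiableAt one_ne_zero).hasDerivAt

lemma a_tendsto_zero (hg : g.ZeroNoiseAssumption) : Tendsto g.a (𝓝[>] 0) (𝓝 (g.a 0)) := by
  rw [tendsto_order]
  constructor
  · intro c hc
    filter_upwards [self_mem_nhdsWithin] with r hr using hc.trans (hg.a_zero_lt hr)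
  · intro c hc
    rw [a_zero] at hc
    obtain ⟨_, ⟨s, hs, rfl⟩, hsc⟩ := exists_lt_of_csInf_lt (nonempty_Ioi.image _) hc
    filter_upwards [Ioo_mem_nhdsGT hs] with r hr
    exact (hg.a_strictMono hr.1 hs hr.2).trans hsc

lemma a_continuousOn (hg : g.ZeroNoiseAssumption) : ContinuousOn g.a (Ici 0) := by
  intro r hr
  rcases (mem_Ici.1 hr).eq_or_lt with rfl | hr
  · rw [← continuousWithinAt_Ioi_iff_Ici]
    exact hg.a_tendsto_zero
  · exact (hg.a_continuousAt hr).continuousWithinAt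

lemma deriv_a_nonneg (hg : g.ZeroNoiseAssumption) {r : ℝ} (hr : 0 < r) : 0 ≤ deriv g.a r := by
  have h := hg.a_strictMono.monotoneOn
  rw [← derivWithin_of_mem_nhds (Ioi_mem_nhds hr)]
  exact h.derivWithin_nonneg

lemma profitF_strictMonoOn (hg : g.ZeroNoiseAssumption) : StrictMonoOn g.profitF (Ici 0) := by
  intro x hx y hy hxy
  rcases (mem_Ici.1 hx).eq_or_lt with rfl | hx
  · have h1 : g.profitF 0 ≤ g.profitF (y / 2) := by
      have ht : Tendsto g.profitF (𝓝[>] 0) (𝓝 (g.profitF 0)) :=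
        (hg.profitF_cont 0 hx).mono Ioi_subset_Ici_self
      refine le_of_tendsto ht ?_
      filter_upwards [Ioo_mem_nhdsGT (half_pos hxy)] with z hz
      exact (hg.profitF_strictMono hz.1 (half_pos hxy) hz.2).le
    exact h1.trans_lt (hg.profitF_strictMono (half_pos hxy) hxy (half_lt_self hxy))
  · exact hg.profitF_strictMono hx (hx.trans hxy) hxy

lemma profitF_hasDerivAt (hg : g.ZeroNoiseAssumption) {x : ℝ} (hx : 0 < x) :
    HasDerivAt g.profitF (deriv g.profitF x) x :=
  ((hg.profitF_contDiff.contDiffAt (Ioi_mem_nhds hx)).differentiableAt one_ne_zero).hasDerivAt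

lemma deriv_profitF_nonneg (hg : g.ZeroNoiseAssumption) {x : ℝ} (hx : 0 < x) :
    0 ≤ deriv g.profitF x := by
  rw [← derivWithin_of_mem_nhds (Ioi_mem_nhds hx)]
  exact hg.profitF_strictMono.monotoneOn.derivWithin_nonneg

/-- A zero of π' at x would force π' ≤ 0 to the left of x, since π' is nondecreasing; the mean value
theorem on [x/2, x] contradicts this. -/
lemma deriv_profitF_pos (hg : g.ZeroNoiseAssumption) {x : ℝ} (hx : 0 < x) :
    0 < deriv g.profitF x := by
  refine (hg.deriv_profitF_nonneg hx).lt_of_ne fun h0 => ?_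
  have hsub : Icc (x / 2) x ⊆ Ioi 0 := fun y hy => (half_pos hx).trans_le hy.1
  obtain ⟨c, hc, hc'⟩ := exists_deriv_eq_slope g.profitF (half_lt_self hx)
    (fun y hy => (hg.profitF_hasDerivAt (hsub hy)).continuousAt.continuousWithinAt)
    (fun y hy => (hg.profitF_hasDerivAt
      (hsub (Ioo_subset_Icc_self hy))).differentiableAt.differentiableWithinAt)
  have h1 : deriv g.profitF c ≤ deriv g.profitF x :=
    hg.profitF_deriv_mono (hsub (Ioo_subset_Icc_self hc)) hx hc.2.le
  have h2 := hg.profitF_strictMono (half_pos hx) hx (half_lt_self hx)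
  have h3 : 0 < deriv g.profitF c := by
    rw [hc']; exact div_pos (by linarith) (by linarith)
  linarith

end ZeroNoiseAssumption

/-- The boundary `a`, extended to negative arguments by the constant `a 0`. -/
noncomputable def aExt (g : AbatementGame) (v : ℝ) : ℝ := g.a (max v 0)

/-- The profit of the firm, extended to negative arguments by the constant `π 0`. -/
noncomputable def piExt (g : AbatementGame) (y : ℝ) : ℝ := g.profitF (max y 0)

lemma aExt_of_nonneg {r : ℝ} (hr : 0 ≤ r) : g.aExt r = g.a r := by rw [aExt, max_eq_left hr]

lemma piExt_of_nonneg {r : ℝ} (hr : 0 ≤ r) : g.piExt r = g.profitF r := by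
  rw [piExt, max_eq_left hr]

namespace ZeroNoiseAssumption

lemma aExt_continuous (hg : g.ZeroNoiseAssumption) : Continuous g.aExt :=
  hg.a_continuousOn.comp_continuous (by fun_prop) fun v => le_max_right v 0

lemma aExt_mono (hg : g.ZeroNoiseAssumption) : Monotone g.aExt := fun _ _ h =>
  hg.a_strictMonoOn.monotoneOn (mem_Ici.2 (le_max_right _ _)) (mem_Ici.2 (le_max_right _ _)) (max_le_max_right 0 h)

lemma aExt_nonneg (hg : g.ZeroNoiseAssumption) (v : ℝ) : 0 ≤ g.aExt v :=
  hg.a_nonneg (le_max_right _ _)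

lemma aExt_hasDerivAt (hg : g.ZeroNoiseAssumption) {r : ℝ} (hr : 0 < r) :
    HasDerivAt g.aExt (deriv g.a r) r :=
  (hg.a_hasDerivAt hr).congr_of_eventuallyEq
    (by filter_upwards [Ioi_mem_nhds hr] with s hs using aExt_of_nonneg (le_of_lt hs))

lemma aExt_contDiffAt (hg : g.ZeroNoiseAssumption) {r : ℝ} (hr : 0 < r) :
    ContDiffAt ℝ 1 g.aExt r :=
  (hg.a_contDiff.contDiffAt (Ioi_mem_nhds hr)).congr_of_eventuallyEq
    (by filter_upwards [Ioi_mem_nhds hr] with s hs using aExt_of_nonneg (le_of_lt hs))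

lemma piExt_continuous (hg : g.ZeroNoiseAssumption) : Continuous g.piExt :=
  hg.profitF_cont.comp_continuous (by fun_prop) fun v => le_max_right v 0

lemma piExt_mono (hg : g.ZeroNoiseAssumption) : Monotone g.piExt := fun _ _ h =>
  hg.profitF_strictMonoOn.monotoneOn (mem_Ici.2 (le_max_right _ _)) (mem_Ici.2 (le_max_right _ _)) (max_le_max_right 0 h)

lemma piExt_nonneg (hg : g.ZeroNoiseAssumption) (v : ℝ) : 0 ≤ g.piExt v :=
  hg.profitF_nonneg _ (le_max_right _ _)

lemma piExt_hasDerivAt (hg : g.ZeroNoiseAssumption) {x : ℝ} (hx : 0 < x) :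
    HasDerivAt g.piExt (deriv g.profitF x) x :=
  (hg.profitF_hasDerivAt hx).congr_of_eventuallyEq
    (by filter_upwards [Ioi_mem_nhds hx] with s hs using piExt_of_nonneg (le_of_lt hs))

lemma piExt_contDiffAt (hg : g.ZeroNoiseAssumption) {r : ℝ} (hr : 0 < r) :
    ContDiffAt ℝ 1 g.piExt r :=
  (hg.profitF_contDiff.contDiffAt (Ioi_mem_nhds hr)).congr_of_eventuallyEq
    (by filter_upwards [Ioi_mem_nhds hr] with s hs using piExt_of_nonneg (le_of_lt hs))

lemma piExt_aExt_strictMonoOn (hg : g.ZeroNoiseAssumption) :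
    StrictMonoOn (fun v => g.piExt (g.aExt v)) (Ici 0) := by
  intro r hr s hs hrs
  simp only [aExt_of_nonneg (mem_Ici.1 hr), aExt_of_nonneg (mem_Ici.1 hs)]
  rw [piExt_of_nonneg (hg.a_nonneg hr), piExt_of_nonneg (hg.a_nonneg hs)]
  exact hg.profitF_strictMonoOn (hg.a_nonneg hr) (hg.a_nonneg hs) (hg.a_strictMonoOn hr hs hrs)

/-- For `r > 0` the boundary `a r` maximises the profit of the investor net of capital cost. -/
lemma profitI_sub_le_at_a (hg : g.ZeroNoiseAssumption) {r y : ℝ} (hr : 0 < r) (hy : 0 ≤ y) :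
    g.profitI r y - g.alpha * g.delta * y
      ≤ g.profitI r (g.a r) - g.alpha * g.delta * g.a r := by
  have ha := hg.a_pos hr
  have hd : HasDerivAt (g.profitI r) (g.alpha * g.delta) (g.a r) := by
    have := (hg.profitI_diff r _ hr ha).hasDerivAt
    rwa [show deriv (g.profitI r) (g.a r) = g.alpha * g.delta from hg.profitIx_a hr] at this
  have hc := (hg.profitI_concave r hr).concaveOn
  rcases lt_trichotomy y (g.a r) with h | h | h
  · have := hc.le_slope_of_hasDerivAt (mem_Ici.2 hy) (mem_Ici.2 ha.le) h hd
    rw [slope_def_field, le_div_iff₀ (by linarith)] at this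
    linarith
  · rw [h]
  · have := hc.slope_le_of_hasDerivAt (mem_Ici.2 ha.le) (mem_Ici.2 hy) h hd
    rw [slope_def_field, div_le_iff₀ (by linarith)] at this
    linarith

/-- Beyond its maximiser `a r` a concave function decreases: the slope from z to y is at most the
slope from `a r` to z, which is at most αδ. -/
lemma profitI_sub_anti (hg : g.ZeroNoiseAssumption) {r y z : ℝ} (hr : 0 < r) (hz : g.a r ≤ z)
    (hzy : z ≤ y) :
    g.profitI r y - g.alpha * g.delta * y ≤ g.profitI r z - g.alpha * g.delta * z := by
  have ha := hg.a_pos hr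
  rcases hz.eq_or_lt with rfl | hz
  · exact hg.profitI_sub_le_at_a hr (ha.le.trans hzy)
  rcases hzy.eq_or_lt with rfl | hzy
  · exact le_rfl
  have h1 := hg.profitI_sub_le_at_a hr (y := z) (ha.le.trans hz.le)
  have hc := (hg.profitI_concave r hr).concaveOn
  have := hc.slope_anti_adjacent (mem_Ici.2 ha.le) (mem_Ici.2 (by linarith : 0 ≤ y)) hz hzy
  have h2 : (g.profitI r z - g.profitI r (g.a r)) / (z - g.a r) ≤ g.alpha * g.delta := by
    rw [div_le_iff₀ (by linarith)]; linarith
  have h3 := this.trans h2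
  rw [div_le_iff₀ (by linarith)] at h3
  linarith

/-- Concavity and differentiability are assumed for r > 0 only; this limit carries the comparison of
profits to r = 0. -/
lemma profitI_tendsto (hg : g.ZeroNoiseAssumption) {f : ℝ → ℝ} {c : ℝ} (hc : 0 ≤ c)
    (hf : Tendsto f (𝓝[>] 0) (𝓝 c)) (hf0 : ∀ r, 0 < r → 0 ≤ f r) :
    Tendsto (fun r => g.profitI r (f r)) (𝓝[>] 0) (𝓝 (g.profitI 0 c)) := by
  have h := hg.profitI_cont (0, c) ⟨mem_Ici.2 le_rfl, mem_Ici.2 hc⟩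
  refine (h.tendsto).comp (f := fun r => (r, f r)) (tendsto_nhdsWithin_iff.2 ⟨?_, ?_⟩)
  · exact (tendsto_nhdsWithin_of_tendsto_nhds tendsto_id).prodMk_nhds hf
  · filter_upwards [self_mem_nhdsWithin] with r hr
    exact ⟨mem_Ici.2 (le_of_lt hr), mem_Ici.2 (hf0 r hr)⟩

/-- The pointwise comparison behind the optimality of reflection at `a`. -/
lemma profitI_sub_le (hg : g.ZeroNoiseAssumption) {r y z : ℝ} (hr : 0 ≤ r) (hy : 0 ≤ y)
    (hz : g.a r ≤ z) (h : z = g.a r ∨ z ≤ y) :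
    g.profitI r y - g.alpha * g.delta * y ≤ g.profitI r z - g.alpha * g.delta * z := by
  rcases hr.eq_or_lt with rfl | hr
  · have ha0 := hg.a_zero_nonneg
    have hty : Tendsto (fun r => g.profitI r y - g.alpha * g.delta * y) (𝓝[>] 0)
        (𝓝 (g.profitI 0 y - g.alpha * g.delta * y)) :=
      (hg.profitI_tendsto hy tendsto_const_nhds fun _ _ => hy).sub_const _
    rcases hz.eq_or_lt with rfl | hz
    · have ht := (hg.profitI_tendsto ha0 hg.a_tendsto_zero fun r hr => (hg.a_pos hr).le).sub
        (hg.a_tendsto_zero.const_mul (g.alpha * g.delta))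
      refine le_of_tendsto_of_tendsto hty ht ?_
      filter_upwards [self_mem_nhdsWithin] with r hr using hg.profitI_sub_le_at_a hr hy
    · have hzy : z ≤ y := h.resolve_left hz.ne'
      have hz0 : 0 ≤ z := ha0.trans hz.le
      have htz : Tendsto (fun r => g.profitI r z - g.alpha * g.delta * z) (𝓝[>] 0)
          (𝓝 (g.profitI 0 z - g.alpha * g.delta * z)) :=
        (hg.profitI_tendsto hz0 tendsto_const_nhds fun _ _ => hz0).sub_const _
      refine le_of_tendsto_of_tendsto hty htz ?_
      filter_upwards [self_mem_nhdsWithin, hg.a_tendsto_zero.eventually_lt_const hz] with r hr hra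
      exact hg.profitI_sub_anti hr hra.le hzy
  · rcases h with rfl | h
    · exact hg.profitI_sub_le_at_a hr hy
    · exact hg.profitI_sub_anti hr hz h

end ZeroNoiseAssumption

end AbatementGame

/-! ### Stieltjes measures, integration by parts, and the capacity without investment -/

namespace AbatementGame

variable {g : AbatementGame}

section Stieltjes

variable {nu : ℝ → ℝ}

lemma stieltjesFunction_apply (hm : Monotone nu) (hr : ∀ t, ContinuousWithinAt nu (Ici t) t)
    (t : ℝ) : hm.stieltjesFunction t = nu t := by
  change Function.rightLim nu t = nu t
  exact rightLim_eq_of_tendsto ((hr t).mono Ioi_subset_Ici_self).tendsto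

lemma dMeasure_eq (hm : Monotone nu) : dMeasure nu = hm.stieltjesFunction.measure := by
  rw [dMeasure, dif_pos hm]

instance : IsLocallyFiniteMeasure (dMeasure nu) := by
  unfold dMeasure
  split_ifs <;> infer_instance

/-- The extension of ν by 0 to negative times makes the left limit at 0 vanish, so the initial jump
is counted as an atom. -/
lemma dMeasure_Icc (hm : Monotone nu) (hr : ∀ t, ContinuousWithinAt nu (Ici t) t)
    (h0 : ∀ t, t < 0 → nu t = 0) (t : ℝ) :
    dMeasure nu (Icc 0 t) = ENNReal.ofReal (nu t) := by
  rw [dMeasure_eq hm, StieltjesFunction.measure_Icc, stieltjesFunction_apply hm hr]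
  have : Function.leftLim hm.stieltjesFunction 0 = 0 := by
    apply leftLim_eq_of_tendsto
    refine tendsto_const_nhds.congr' ?_
    filter_upwards [self_mem_nhdsWithin] with s hs
    rw [stieltjesFunction_apply hm hr, h0 s hs]
  rw [this, sub_zero]

lemma dMeasure_zero : dMeasure (fun _ => (0 : ℝ)) = 0 := by
  have hm : Monotone (fun _ : ℝ => (0 : ℝ)) := monotone_const
  have hr : ∀ t : ℝ, ContinuousWithinAt (fun _ : ℝ => (0 : ℝ)) (Ici t) t :=
    fun t => continuousWithinAt_const
  rw [dMeasure_eq hm]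
  have : hm.stieltjesFunction = StieltjesFunction.const ℝ 0 := by
    ext t
    rw [stieltjesFunction_apply hm hr]; rfl
  rw [this, StieltjesFunction.measure_const]

end Stieltjes

/-- Integration by parts of an exponential against a locally finite measure on `[0, t]`. -/
lemma integral_exp_by_parts (κ : Measure ℝ) [IsLocallyFiniteMeasure κ] (c : ℝ) {t : ℝ}
    (ht : 0 ≤ t) :
    ∫ s in Icc 0 t, Real.exp (-c * s) ∂κ
      = Real.exp (-c * t) * κ.real (Icc 0 t)
        + c * ∫ u in (0 : ℝ)..t, Real.exp (-c * u) * κ.real (Icc 0 u) := by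
  -- The exponential is written as its value at t plus an integral over [s, t]; swapping the two
  -- integrals then proves the formula without any regularity of κ.
  have hkey : ∀ s ∈ Icc 0 t, Real.exp (-c * s)
      = Real.exp (-c * t) + c * ∫ u in Ioc 0 t, if s ≤ u then Real.exp (-c * u) else 0 := by
    intro s hs
    have h1 : ∫ u in Ioc 0 t, (if s ≤ u then Real.exp (-c * u) else 0)
        = ∫ u in s..t, Real.exp (-c * u) := by
      rw [intervalIntegral.integral_of_le hs.2,
        ← integral_indicator measurableSet_Ioc, ← integral_indicator measurableSet_Ioc]
      refine integral_congr_ae ?_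
      have : ∀ᵐ u : ℝ, u ≠ s := by simp [ae_iff]
      filter_upwards [this] with u hu
      simp only [indicator, mem_Ioc]
      have hs0 := hs.1
      by_cases h1 : s ≤ u
      · have h2 : s < u := lt_of_le_of_ne h1 hu.symm
        simp [h1, h2, hs0.trans_lt h2]
      · simp [h1, mt le_of_lt h1]
    have h2 : c * ∫ u in s..t, Real.exp (-c * u) = Real.exp (-c * s) - Real.exp (-c * t) := by
      have hd : ∀ u ∈ uIcc s t, HasDerivAt (fun u => -Real.exp (-c * u))
          (c * Real.exp (-c * u)) u := by
        intro u _
        have := (((hasDerivAt_id' u).const_mul (-c)).exp).neg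
        refine this.congr_deriv ?_
        ring
      rw [← intervalIntegral.integral_const_mul,
        intervalIntegral.integral_eq_sub_of_hasDerivAt hd
          (Continuous.intervalIntegrable (by fun_prop) _ _)]
      ring
    rw [h1, h2]; ring
  have hfin : IsFiniteMeasure (κ.restrict (Icc 0 t)) :=
    ⟨by rw [Measure.restrict_apply_univ]; exact isCompact_Icc.measure_lt_top⟩
  have hmeas : Measurable (Function.uncurry
      fun s u : ℝ => if s ≤ u then Real.exp (-c * u) else 0) := by
    refine Measurable.ite (measurableSet_le measurable_fst measurable_snd) ?_ measurable_const
    fun_prop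
  have hbdd : ∀ s u : ℝ, u ∈ Ioc 0 t →
      ‖(if s ≤ u then Real.exp (-c * u) else 0)‖ ≤ Real.exp (|c| * t) := by
    intro s u hu
    split_ifs
    · rw [Real.norm_eq_abs, Real.abs_exp]
      refine Real.exp_le_exp.2 ?_
      calc -c * u ≤ |c| * u := mul_le_mul_of_nonneg_right (neg_le_abs c) hu.1.le
        _ ≤ |c| * t := mul_le_mul_of_nonneg_left hu.2 (abs_nonneg c)
    · simpa using (Real.exp_pos _).le
  have hint : Integrable (Function.uncurry
      fun s u : ℝ => if s ≤ u then Real.exp (-c * u) else 0)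
      ((κ.restrict (Icc 0 t)).prod (volume.restrict (Ioc 0 t))) := by
    refine Integrable.of_bound hmeas.aestronglyMeasurable (Real.exp (|c| * t)) ?_
    refine Measure.ae_prod_iff_ae_ae ?_ |>.2 ?_
    · exact measurableSet_le hmeas.norm measurable_const
    · refine Eventually.of_forall fun s => ?_
      filter_upwards [ae_restrict_mem measurableSet_Ioc] with u hu using hbdd s u hu
  have hswap := integral_integral_swap hint
  have hinner : ∀ u ∈ Ioc 0 t,
      ∫ s in Icc 0 t, (if s ≤ u then Real.exp (-c * u) else 0) ∂κ
        = Real.exp (-c * u) * κ.real (Icc 0 u) := by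
    intro u hu
    have : (fun s => if s ≤ u then Real.exp (-c * u) else 0)
        = (Iic u).indicator (fun _ => Real.exp (-c * u)) := by
      ext s; simp [indicator]
    rw [this, integral_indicator measurableSet_Iic, Measure.restrict_restrict measurableSet_Iic,
      setIntegral_const, smul_eq_mul, mul_comm]
    congr 2
    ext s; simp only [mem_inter_iff, mem_Iic, mem_Icc]
    constructor
    · rintro ⟨h1, h2, _⟩; exact ⟨h2, h1⟩
    · rintro ⟨h1, h2⟩; exact ⟨h2, h1, h2.trans hu.2⟩
  rw [setIntegral_congr_fun measurableSet_Icc hkey, integral_add (integrable_const _)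
    ((show Integrable (fun s => ∫ u in Ioc 0 t, if s ≤ u then Real.exp (-c * u) else 0)
      (κ.restrict (Icc 0 t)) from hint.integral_prod_left).const_mul c), integral_const_mul, hswap, setIntegral_const,
    intervalIntegral.integral_of_le ht, setIntegral_congr_fun measurableSet_Ioc hinner,
    smul_eq_mul, mul_comm]

/-- The capacity without investment. -/
noncomputable def freeX (g : AbatementGame) (x : ℝ) (eta : ℝ → ℝ) (t : ℝ) : ℝ :=
  Real.exp (g.mu * t) * (x - ∫ s in (0 : ℝ)..t, Real.exp (-g.mu * s) * eta s)

lemma X_zero (x : ℝ) (eta : ℝ → ℝ) (t : ℝ) : g.X x eta (fun _ => 0) t = g.freeX x eta t := by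
  simp [X, freeX, dMeasure_zero]

lemma X_eq_add (x : ℝ) (eta nu : ℝ → ℝ) (t : ℝ) :
    g.X x eta nu t = g.freeX x eta t
      + Real.exp (g.mu * t) * ∫ s in Icc 0 t, Real.exp (-g.mu * s) ∂(dMeasure nu) := by
  simp only [X, freeX]; ring

lemma R_zero (r : ℝ) (eta : ℝ → ℝ) : R r eta 0 = r := by simp [R]

lemma freeX_zero (x : ℝ) (eta : ℝ → ℝ) : g.freeX x eta 0 = x := by simp [freeX]

namespace FirmControl

variable {eta : ℝ → ℝ}

lemma intervalIntegrable_mul (he : g.FirmControl eta) {f : ℝ → ℝ} (hf : Continuous f) {s t : ℝ}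
    (hs : 0 ≤ s) (ht : 0 ≤ t) : IntervalIntegrable (fun u => f u * eta u) volume s t := by
  have h : IntervalIntegrable eta volume s t := by
    refine (intervalIntegrable_const (c := g.etaMax)).mono_fun he.1.aestronglyMeasurable ?_
    filter_upwards [ae_restrict_mem measurableSet_uIoc] with u hu
    have hu0 : 0 ≤ u := (le_min hs ht).trans hu.1.le
    rw [Real.norm_of_nonneg (he.2 u hu0).1]
    exact (he.2 u hu0).2.trans (le_abs_self _)
  exact h.continuousOn_mul hf.continuousOn

lemma intervalIntegrable (he : g.FirmControl eta) {s t : ℝ}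
    (hs : 0 ≤ s) (ht : 0 ≤ t) : IntervalIntegrable eta volume s t := by
  simpa using he.intervalIntegrable_mul (f := fun _ => 1) continuous_const hs ht

lemma R_sub (he : g.FirmControl eta) (r : ℝ) {s t : ℝ} (hs : 0 ≤ s) (ht : 0 ≤ t) :
    R r eta t - R r eta s = ∫ u in s..t, eta u := by
  rw [R, R, ← intervalIntegral.integral_interval_sub_left (he.intervalIntegrable le_rfl ht)
    (he.intervalIntegrable le_rfl hs)]
  ring

lemma R_mono (he : g.FirmControl eta) (r : ℝ) {s t : ℝ} (hs : 0 ≤ s) (hst : s ≤ t) :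
    R r eta s ≤ R r eta t := by
  rw [← sub_nonneg, he.R_sub r hs (hs.trans hst)]
  exact intervalIntegral.integral_nonneg hst fun u hu => (he.2 u (hs.trans hu.1)).1

lemma R_sub_le (he : g.FirmControl eta) (r : ℝ) {s t : ℝ} (hs : 0 ≤ s) (hst : s ≤ t) :
    R r eta t - R r eta s ≤ g.etaMax * (t - s) := by
  rw [he.R_sub r hs (hs.trans hst)]
  have := intervalIntegral.integral_mono_on hst (he.intervalIntegrable hs (hs.trans hst))
    (intervalIntegrable_const (c := g.etaMax)) fun u hu => (he.2 u (hs.trans hu.1)).2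
  simpa [mul_comm] using this

lemma le_R (he : g.FirmControl eta) (r : ℝ) {t : ℝ} (ht : 0 ≤ t) : r ≤ R r eta t := by
  simpa [R_zero] using he.R_mono r le_rfl ht

lemma R_le (he : g.FirmControl eta) (r : ℝ) {t : ℝ} (ht : 0 ≤ t) :
    R r eta t ≤ r + g.etaMax * t := by
  have := he.R_sub_le r le_rfl ht
  rw [R_zero, sub_zero] at this; linarith

/-- A control is bounded on [0, ∞) only and arbitrary before 0, hence the cut-off `max u 0`. It
yields functions continuous on the whole line, which later arguments use in place of the raw paths.
-/
lemma primitive_continuous (he : g.FirmControl eta) {f : ℝ → ℝ} (hf : Continuous f) :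
    Continuous fun u => ∫ s in (0 : ℝ)..(max u 0), f s * eta s := by
  have h1 : ∀ u : ℝ, ∫ s in (0 : ℝ)..(max u 0), f s * eta s
      = ∫ s in (0 : ℝ)..(max u 0), f s * (Ici (0 : ℝ)).indicator eta s := by
    intro u
    refine intervalIntegral.integral_congr fun s hs => ?_
    rw [uIcc_of_le (le_max_right _ _)] at hs
    simp [indicator, hs.1]
  simp_rw [h1]
  have hm : Continuous fun u => ∫ s in (0 : ℝ)..u, f s * (Ici (0 : ℝ)).indicator eta s := by
    refine intervalIntegral.continuous_primitive (fun a b => ?_) 0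
    have hb : IntervalIntegrable ((Ici (0 : ℝ)).indicator eta) volume a b := by
      refine (intervalIntegrable_const (c := g.etaMax)).mono_fun
        (he.1.indicator measurableSet_Ici).aestronglyMeasurable ?_
      refine Eventually.of_forall fun u => ?_
      by_cases hu : 0 ≤ u
      · simp only [indicator, mem_Ici, hu, if_true]
        rw [Real.norm_of_nonneg (he.2 u hu).1]
        exact (he.2 u hu).2.trans (le_abs_self _)
      · simp [indicator, hu]
    exact hb.continuousOn_mul hf.continuousOn
  exact hm.comp (by fun_prop)

lemma R_continuous (he : g.FirmControl eta) (r : ℝ) :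
    Continuous fun u => R r eta (max u 0) := by
  have := he.primitive_continuous (f := fun _ => 1) continuous_const
  simp only [one_mul] at this
  exact continuous_const.add this

lemma freeX_continuous (he : g.FirmControl eta) (x : ℝ) :
    Continuous fun u => g.freeX x eta (max u 0) := by
  have h := he.primitive_continuous (f := fun s => Real.exp (-g.mu * s)) (by fun_prop)
  unfold freeX
  fun_prop

/-- Discounting by e^{-μt} removes the natural decline, and only the nonpositive effect of abatement
is left. -/
lemma discounted_antitone (he : g.FirmControl eta) (x : ℝ) {s t : ℝ} (hs : 0 ≤ s)
    (hst : s ≤ t) :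
    Real.exp (-g.mu * t) * g.freeX x eta t ≤ Real.exp (-g.mu * s) * g.freeX x eta s := by
  have hf : Continuous fun s => Real.exp (-g.mu * s) := by fun_prop
  have h1 := intervalIntegral.integral_interval_sub_left
    (he.intervalIntegrable_mul hf le_rfl (hs.trans hst)) (he.intervalIntegrable_mul hf le_rfl hs)
  have h2 : 0 ≤ ∫ u in s..t, Real.exp (-g.mu * u) * eta u :=
    intervalIntegral.integral_nonneg hst fun u hu =>
      mul_nonneg (Real.exp_pos _).le (he.2 u (hs.trans hu.1)).1
  have h3 : ∀ v, Real.exp (-g.mu * v) * Real.exp (g.mu * v) = 1 := fun v => by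
    rw [← Real.exp_add]; simp
  simp only [freeX, ← mul_assoc, h3, one_mul]
  linarith

/-- Integration by parts for the cumulated abatement. -/
lemma integral_exp_mul (he : g.FirmControl eta) (r c : ℝ) {t : ℝ} (ht : 0 ≤ t) :
    ∫ s in (0 : ℝ)..t, Real.exp (-c * s) * eta s
      = Real.exp (-c * t) * (R r eta t - r)
        + c * ∫ u in (0 : ℝ)..t, Real.exp (-c * u) * (R r eta u - r) := by
  set f : ℝ → ℝ := (Ici (0 : ℝ)).indicator eta with hf
  have hfm : Measurable f := he.1.indicator measurableSet_Ici
  have hf0 : ∀ u, 0 ≤ f u := fun u => indicator_nonneg (fun u hu => (he.2 u hu).1) u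
  have hfm' : ∀ u, f u ≤ g.etaMax := fun u =>
    indicator_le' (fun u hu => (he.2 u hu).2) (fun u _ =>
      (he.2 0 le_rfl).1.trans (he.2 0 le_rfl).2) u
  have hfe : ∀ u, 0 ≤ u → f u = eta u := fun u hu => by simp [hf, hu]
  -- Cumulated abatement is viewed as the distribution function of a measure with density η, so that
  -- `integral_exp_by_parts` applies to it as well.
  set κ : Measure ℝ := volume.withDensity fun u => ENNReal.ofReal (f u) with hκ
  have hreal : ∀ u, 0 ≤ u → κ.real (Icc 0 u) = R r eta u - r := by
    intro u hu
    rw [measureReal_def, hκ, withDensity_apply _ measurableSet_Icc,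
      ← ofReal_integral_eq_lintegral_ofReal, ENNReal.toReal_ofReal
        (integral_nonneg hf0), integral_Icc_eq_integral_Ioc,
      ← intervalIntegral.integral_of_le hu, R]
    · rw [add_sub_cancel_left]
      refine intervalIntegral.integral_congr fun s hs => ?_
      rw [uIcc_of_le hu] at hs
      exact hfe s hs.1
    · have := (he.intervalIntegrable le_rfl hu).1
      rw [← integrableOn_Icc_iff_integrableOn_Ioc] at this
      exact this.congr_fun (fun s hs => (hfe s hs.1).symm) measurableSet_Icc
    · exact Eventually.of_forall hf0
  have hlf : IsLocallyFiniteMeasure κ := by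
    refine ⟨fun u => ⟨Ioo (u - 1) (u + 1), Ioo_mem_nhds (by linarith) (by linarith), ?_⟩⟩
    rw [hκ, withDensity_apply _ measurableSet_Ioo]
    calc ∫⁻ v in Ioo (u - 1) (u + 1), ENNReal.ofReal (f v)
        ≤ ∫⁻ v in Ioo (u - 1) (u + 1), ENNReal.ofReal g.etaMax :=
          lintegral_mono fun v => ENNReal.ofReal_le_ofReal (hfm' v)
      _ < ⊤ := by
          rw [setLIntegral_const]
          exact ENNReal.mul_lt_top ENNReal.ofReal_lt_top (by simp)
  have h := integral_exp_by_parts κ c ht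
  rw [hreal t ht] at h
  have h1 : ∫ s in Icc 0 t, Real.exp (-c * s) ∂κ
      = ∫ s in (0 : ℝ)..t, Real.exp (-c * s) * eta s := by
    rw [hκ, restrict_withDensity measurableSet_Icc,
      integral_withDensity_eq_integral_toReal_smul hfm.ennreal_ofReal
        (Eventually.of_forall fun _ => ENNReal.ofReal_lt_top),
      integral_Icc_eq_integral_Ioc, intervalIntegral.integral_of_le ht]
    refine setIntegral_congr_fun measurableSet_Ioc fun s hs => ?_
    rw [ENNReal.toReal_ofReal (hf0 s), hfe s hs.1.le, smul_eq_mul, mul_comm]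
  have h2 : ∫ u in (0 : ℝ)..t, Real.exp (-c * u) * κ.real (Icc 0 u)
      = ∫ u in (0 : ℝ)..t, Real.exp (-c * u) * (R r eta u - r) := by
    refine intervalIntegral.integral_congr fun s hs => ?_
    rw [uIcc_of_le ht] at hs
    simp only [hreal s hs.1]
  rw [← h1, h, h2]

end FirmControl

end AbatementGame

/-! ### The reflecting policy and the capacity it produces -/

namespace AbatementGame

variable {g : AbatementGame}

/-- Either the uncontrolled capacity stays above the boundary, or it has a first time below. -/
lemma tau_cases (hg : g.ZeroNoiseAssumption) {eta : ℝ → ℝ} (he : g.FirmControl eta) {r : ℝ}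
    (hr : 0 ≤ r) (x : ℝ) :
    (g.tau r x eta = ⊤ ∧ ∀ t, 0 ≤ t → g.a (R r eta t) < g.freeX x eta t) ∨
    ∃ τ : ℝ, g.tau r x eta = τ ∧ 0 ≤ τ ∧ g.freeX x eta τ ≤ g.a (R r eta τ) ∧
      ∀ t, 0 ≤ t → t < τ → g.a (R r eta t) < g.freeX x eta t := by
  set S : Set ℝ := {t | 0 ≤ t ∧ g.X x eta (fun _ => 0) t ≤ g.a (R r eta t)} with hS
  have hmem : ∀ t, t ∈ S ↔ 0 ≤ t ∧ g.freeX x eta t ≤ g.a (R r eta t) := fun t => by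
    rw [hS, mem_ofPred_eq, X_zero]
  have htau : g.tau r x eta = sInf ((fun t : ℝ => (t : EReal)) '' S) := rfl
  rcases S.eq_empty_or_nonempty with h | h
  · left
    refine ⟨by rw [htau, h]; simp, fun t ht => ?_⟩
    by_contra hc
    have : t ∈ S := (hmem t).2 ⟨ht, not_lt.1 hc⟩
    rw [h] at this
    exact this
  · right
    -- Closedness means that the infimum is attained; on nonnegative times S agrees with a sublevel
    -- set of the continuous cut-off paths.
    have hcl : IsClosed S := by
      have : S = Ici 0 ∩ {t | g.freeX x eta (max t 0) ≤ g.aExt (R r eta (max t 0))} := by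
        ext t
        rw [hmem, mem_inter_iff, mem_Ici, mem_ofPred_eq]
        refine and_congr_right fun ht => ?_
        rw [max_eq_left ht, aExt_of_nonneg (hr.trans (he.le_R r ht))]
      rw [this]
      exact isClosed_Ici.inter (isClosed_le (he.freeX_continuous x)
        (hg.aExt_continuous.comp (he.R_continuous r)))
    have hbdd : BddBelow S := ⟨0, fun t ht => ht.1⟩
    have hτ : sInf S ∈ S := hcl.csInf_mem h hbdd
    refine ⟨sInf S, ?_, hτ.1, ((hmem _).1 hτ).2, fun t ht htτ => ?_⟩
    · rw [htau]
      refine IsLeast.csInf_eq ⟨mem_image_of_mem _ hτ, ?_⟩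
      rintro _ ⟨t, ht, rfl⟩
      exact EReal.coe_le_coe_iff.2 (csInf_le hbdd ht)
    · by_contra hc
      exact absurd (csInf_le hbdd ((hmem t).2 ⟨ht, not_lt.1 hc⟩)) (not_le.2 htτ)

lemma nuA_eq_zero {r x : ℝ} {eta : ℝ → ℝ} (h : g.tau r x eta = ⊤) (t : ℝ) :
    g.nuA r x eta t = 0 := by
  rw [nuA, if_neg]; rw [h, not_le]; exact EReal.coe_lt_top t

lemma nuA_of_lt {r x τ t : ℝ} {eta : ℝ → ℝ} (h : g.tau r x eta = τ) (ht : t < τ) :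
    g.nuA r x eta t = 0 := by
  rw [nuA, if_neg]; rw [h, not_le]; exact EReal.coe_lt_coe_iff.2 ht

lemma nuA_of_le {r x τ t : ℝ} {eta : ℝ → ℝ} (h : g.tau r x eta = τ) (ht : τ ≤ t) :
    g.nuA r x eta t = max (g.a r - x) 0 + g.a (R r eta t) + R r eta t
      - g.a (R r eta τ) - R r eta τ - ∫ s in τ..t, g.mu * g.a (R r eta s) := by
  rw [nuA, if_pos]
  · rw [h]; rfl
  · rw [h]; exact EReal.coe_le_coe_iff.2 ht

lemma tau_nonneg (r x : ℝ) (eta : ℝ → ℝ) : 0 ≤ g.tau r x eta := by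
  refine le_sInf ?_
  rintro _ ⟨t, ht, rfl⟩
  exact EReal.coe_nonneg.2 ht.1

lemma nuA_neg (r x : ℝ) (eta : ℝ → ℝ) {t : ℝ} (ht : t < 0) : g.nuA r x eta t = 0 := by
  rw [nuA, if_neg]
  rw [not_le]
  exact (EReal.coe_neg'.2 ht).trans_le (tau_nonneg r x eta)

/-- The continuous function that `ν^a` follows from `τ` on. -/
lemma nuA_of_le' {r x τ t : ℝ} {eta : ℝ → ℝ} (hr : 0 ≤ r) (he : g.FirmControl eta)
    (hτ : 0 ≤ τ) (h : g.tau r x eta = τ) (ht : τ ≤ t) :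
    g.nuA r x eta t = max (g.a r - x) 0 + g.aExt (R r eta (max t 0)) + R r eta (max t 0)
      - g.a (R r eta τ) - R r eta τ - ∫ s in τ..t, g.mu * g.aExt (R r eta (max s 0)) := by
  rw [nuA_of_le h ht, max_eq_left (hτ.trans ht),
    aExt_of_nonneg (hr.trans (he.le_R r (hτ.trans ht)))]
  congr 1
  refine intervalIntegral.integral_congr fun s hs => ?_
  rw [uIcc_of_le ht] at hs
  simp only [max_eq_left (hτ.trans hs.1), aExt_of_nonneg (hr.trans (he.le_R r (hτ.trans hs.1)))]

section nuA

variable {eta : ℝ → ℝ} {r : ℝ}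

lemma continuous_aR (hg : g.ZeroNoiseAssumption) (he : g.FirmControl eta) (r : ℝ) :
    Continuous fun s => g.aExt (R r eta (max s 0)) :=
  hg.aExt_continuous.comp (he.R_continuous r)

lemma nuA_mono (hg : g.ZeroNoiseAssumption) (he : g.FirmControl eta) (hr : 0 ≤ r) (x : ℝ) :
    Monotone (g.nuA r x eta) := by
  rcases tau_cases hg he hr x with ⟨h, _⟩ | ⟨τ, h, hτ, _⟩
  · simp only [show g.nuA r x eta = fun _ => 0 from funext (nuA_eq_zero h)]
    exact monotone_const
  have hc := continuous_aR hg he r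
  have hmono : ∀ s t, τ ≤ s → s ≤ t → g.nuA r x eta s ≤ g.nuA r x eta t := by
    intro s t hs hst
    have hR : R r eta (max s 0) ≤ R r eta (max t 0) :=
      he.R_mono r (le_max_right _ _) (max_le_max_right 0 hst)
    have ha := hg.aExt_mono hR
    have hi : ∫ u in s..t, g.mu * g.aExt (R r eta (max u 0)) ≤ 0 := by
      have : 0 ≤ ∫ u in s..t, -(g.mu * g.aExt (R r eta (max u 0))) :=
        intervalIntegral.integral_nonneg hst fun u _ =>
          neg_nonneg.2 (mul_nonpos_of_nonpos_of_nonneg hg.mu_nonpos (hg.aExt_nonneg _))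
      rw [intervalIntegral.integral_neg] at this; linarith
    have hadd := intervalIntegral.integral_add_adjacent_intervals
      ((hc.const_mul g.mu).intervalIntegrable τ s) ((hc.const_mul g.mu).intervalIntegrable s t)
      (μ := volume)
    rw [nuA_of_le' hr he hτ h hs, nuA_of_le' hr he hτ h (hs.trans hst)]
    linarith
  have hτ0 : 0 ≤ g.nuA r x eta τ := by
    rw [nuA_of_le h le_rfl, intervalIntegral.integral_same]
    have := le_max_right (g.a r - x) 0
    linarith
  intro s t hst
  rcases lt_or_ge s τ with hs | hs
  · rw [nuA_of_lt h hs]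
    rcases lt_or_ge t τ with ht | ht
    · rw [nuA_of_lt h ht]
    · exact hτ0.trans (hmono τ t le_rfl ht)
  · exact hmono s t hs hst

lemma nuA_rightCont (hg : g.ZeroNoiseAssumption) (he : g.FirmControl eta) (hr : 0 ≤ r) (x t : ℝ) :
    ContinuousWithinAt (g.nuA r x eta) (Ici t) t := by
  rcases tau_cases hg he hr x with ⟨h, _⟩ | ⟨τ, h, hτ, _⟩
  · simp only [show g.nuA r x eta = fun _ => 0 from funext (nuA_eq_zero h)]
    exact continuousWithinAt_const
  have hc := continuous_aR hg he r
  rcases lt_or_ge t τ with ht | ht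
  · refine (continuousWithinAt_const (b := (0 : ℝ))).congr_of_eventuallyEq ?_ (nuA_of_lt h ht)
    filter_upwards [mem_nhdsWithin_of_mem_nhds (Iio_mem_nhds ht)] with s hs using nuA_of_lt h hs
  · have hcont : Continuous fun t => max (g.a r - x) 0 + g.aExt (R r eta (max t 0))
        + R r eta (max t 0) - g.a (R r eta τ) - R r eta τ
        - ∫ s in τ..t, g.mu * g.aExt (R r eta (max s 0)) := by
      have h1 : Continuous fun t => ∫ s in τ..t, g.mu * g.aExt (R r eta (max s 0)) :=
        intervalIntegral.continuous_primitive
          (fun a b => (hc.const_mul g.mu).intervalIntegrable a b) τ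
      have h2 := he.R_continuous r
      fun_prop
    exact hcont.continuousWithinAt.congr
      (fun s hs => nuA_of_le' hr he hτ h (ht.trans hs)) (nuA_of_le' hr he hτ h ht)

/-- Integration by parts replaces dν by ν itself, for which the reflecting policy has an explicit
formula. -/
lemma X_of_path {nu : ℝ → ℝ} (hm : Monotone nu) (hrc : ∀ t, ContinuousWithinAt nu (Ici t) t)
    (h0 : ∀ t, t < 0 → nu t = 0) (x : ℝ) (eta : ℝ → ℝ) {t : ℝ} (ht : 0 ≤ t) :
    g.X x eta nu t = g.freeX x eta t + Real.exp (g.mu * t) *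
      (Real.exp (-g.mu * t) * nu t + g.mu * ∫ u in (0 : ℝ)..t, Real.exp (-g.mu * u) * nu u) := by
  have hreal : ∀ u, 0 ≤ u → (dMeasure nu).real (Icc 0 u) = nu u := by
    intro u hu
    rw [measureReal_def, dMeasure_Icc hm hrc h0, ENNReal.toReal_ofReal]
    have := hm (show (-1 : ℝ) ≤ u by linarith)
    rwa [h0 (-1) (by norm_num)] at this
  rw [X_eq_add, integral_exp_by_parts (dMeasure nu) g.mu ht, hreal t ht]
  congr 4
  refine intervalIntegral.integral_congr fun s hs => ?_
  rw [uIcc_of_le ht] at hs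
  simp only [hreal s hs.1]

/-- Before `τ` nothing is invested. -/
lemma X_nuA_of_lt (hg : g.ZeroNoiseAssumption) (he : g.FirmControl eta) (hr : 0 ≤ r) (x : ℝ)
    {t : ℝ} (ht : 0 ≤ t) (h : (t : EReal) < g.tau r x eta) :
    g.X x eta (g.nuA r x eta) t = g.freeX x eta t := by
  have hz : ∀ s, s ≤ t → g.nuA r x eta s = 0 := fun s hs => by
    rw [nuA, if_neg]
    exact not_le.2 ((EReal.coe_le_coe_iff.2 hs).trans_lt h)
  rw [X_of_path (nuA_mono hg he hr x) (nuA_rightCont hg he hr x) (fun t ht => nuA_neg r x eta ht)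
    x eta ht, hz t le_rfl]
  have : ∫ u in (0 : ℝ)..t, Real.exp (-g.mu * u) * g.nuA r x eta u = 0 := by
    rw [intervalIntegral.integral_congr (g := fun _ => (0 : ℝ)) fun s hs => ?_]
    · simp
    · rw [uIcc_of_le ht] at hs
      simp [hz s hs.2]
  rw [this]; simp

/-- If τ = 0, the lump sum fills the gap a(r) - x. If τ > 0, there is no lump sum, and continuity
forces the free capacity to meet a(R) exactly at τ. -/
lemma freeX_tau (hg : g.ZeroNoiseAssumption) (he : g.FirmControl eta) (hr : 0 ≤ r) {x τ : ℝ}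
    (hτ : 0 ≤ τ) (hle : g.freeX x eta τ ≤ g.a (R r eta τ))
    (hlt : ∀ t, 0 ≤ t → t < τ → g.a (R r eta t) < g.freeX x eta t) :
    max (g.a r - x) 0 - g.a (R r eta τ) + g.freeX x eta τ = 0 := by
  rcases hτ.eq_or_lt with rfl | hτ'
  · rw [R_zero, freeX_zero] at *
    rw [max_eq_left (by linarith)]; ring
  · have hx := hlt 0 le_rfl hτ'
    rw [R_zero, freeX_zero] at hx
    rw [max_eq_right (by linarith)]
    have h1 : Tendsto (fun t => g.aExt (R r eta (max t 0))) (𝓝[<] τ)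
        (𝓝 (g.aExt (R r eta (max τ 0)))) :=
      ((continuous_aR hg he r).tendsto τ).mono_left nhdsWithin_le_nhds
    have h2 : Tendsto (fun t => g.freeX x eta (max t 0)) (𝓝[<] τ)
        (𝓝 (g.freeX x eta (max τ 0))) :=
      ((he.freeX_continuous x).tendsto τ).mono_left nhdsWithin_le_nhds
    have h3 := le_of_tendsto_of_tendsto h1 h2 (by
      filter_upwards [Ioo_mem_nhdsLT hτ'] with t ht
      rw [max_eq_left ht.1.le, aExt_of_nonneg (hr.trans (he.le_R r ht.1.le))]
      exact (hlt t ht.1.le ht.2).le)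
    rw [max_eq_left hτ, aExt_of_nonneg (hr.trans (he.le_R r hτ))] at h3
    linarith

/-- From `τ` on the capacity is kept at the boundary. -/
lemma X_nuA_of_le (hg : g.ZeroNoiseAssumption) (he : g.FirmControl eta) (hr : 0 ≤ r) {x τ t : ℝ}
    (h : g.tau r x eta = τ) (hτ : 0 ≤ τ) (hle : g.freeX x eta τ ≤ g.a (R r eta τ))
    (hlt : ∀ t, 0 ≤ t → t < τ → g.a (R r eta t) < g.freeX x eta t) (ht : τ ≤ t) :
    g.X x eta (g.nuA r x eta) t = g.a (R r eta t) := by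
  have ht0 := hτ.trans ht
  have hc := continuous_aR hg he r
  have hRc := he.R_continuous r
  set I : ℝ → ℝ := fun t => ∫ s in τ..t, g.mu * g.aExt (R r eta (max s 0)) with hI
  have hId : ∀ u, HasDerivAt I (g.mu * g.aExt (R r eta (max u 0))) u := fun u =>
    intervalIntegral.integral_hasDerivAt_right ((hc.const_mul g.mu).intervalIntegrable _ _)
      ((hc.const_mul g.mu).stronglyMeasurableAtFilter volume _) (hc.const_mul g.mu).continuousAt
  have hIc : Continuous I := continuous_iff_continuousAt.2 fun u => (hId u).continuousAt
  set K : ℝ := max (g.a r - x) 0 - g.a (R r eta τ) - R r eta τ with hK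
  have hnu : ∀ u, τ ≤ u → g.nuA r x eta u
      = K - I u + g.aExt (R r eta (max u 0)) + R r eta (max u 0) := by
    intro u hu
    rw [nuA_of_le' hr he hτ h hu]; ring
  -- the part of the investment that does not depend on `R` solves a linear equation
  have hconst : ∀ u, Real.exp (-g.mu * u) * (K - I u) + g.mu * ∫ v in τ..u,
      Real.exp (-g.mu * v) * (K - I v + g.aExt (R r eta (max v 0)))
        = Real.exp (-g.mu * τ) * K := by
    have hcont : Continuous fun v => Real.exp (-g.mu * v) *
        (K - I v + g.aExt (R r eta (max v 0))) := by fun_prop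
    have hd : ∀ u, HasDerivAt (fun u => Real.exp (-g.mu * u) * (K - I u) + g.mu * ∫ v in τ..u,
        Real.exp (-g.mu * v) * (K - I v + g.aExt (R r eta (max v 0)))) 0 u := by
      intro u
      have h1 := ((hasDerivAt_id' u).const_mul (-g.mu)).exp.mul ((hId u).const_sub K)
      have h2 := (intervalIntegral.integral_hasDerivAt_right (hcont.intervalIntegrable τ u)
        (hcont.stronglyMeasurableAtFilter volume _) hcont.continuousAt).const_mul g.mu
      refine (h1.add h2).congr_deriv ?_
      ring
    intro u
    have := is_const_of_deriv_eq_zero (fun u => (hd u).differentiableAt) (fun u => (hd u).deriv) u τ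
    simp only [hI, intervalIntegral.integral_same] at this ⊢
    rw [this]; ring
  have hsplit : ∫ u in (0 : ℝ)..t, Real.exp (-g.mu * u) * g.nuA r x eta u
      = (∫ v in τ..t, Real.exp (-g.mu * v) * (K - I v + g.aExt (R r eta (max v 0))))
        + ∫ v in τ..t, Real.exp (-g.mu * v) * R r eta (max v 0) := by
    have h1 : IntervalIntegrable (fun u => Real.exp (-g.mu * u) * g.nuA r x eta u) volume 0 t :=
      ((nuA_mono hg he hr x).intervalIntegrable (a := 0) (b := t)).continuousOn_mul
        (by fun_prop)
    rw [← intervalIntegral.integral_add_adjacent_intervals (b := τ)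
      (h1.mono_set (by rw [uIcc_of_le ht0, uIcc_of_le hτ]; exact Icc_subset_Icc_right ht))
      (h1.mono_set (by rw [uIcc_of_le ht0, uIcc_of_le ht]; exact Icc_subset_Icc_left hτ)),
      ← intervalIntegral.integral_add (Continuous.intervalIntegrable (by fun_prop) _ _)
        (Continuous.intervalIntegrable (by fun_prop) _ _)]
    have h2 : ∫ u in (0 : ℝ)..τ, Real.exp (-g.mu * u) * g.nuA r x eta u = 0 := by
      rw [intervalIntegral.integral_of_le hτ, integral_Ioc_eq_integral_Ioo,
        setIntegral_congr_fun (g := fun _ => (0 : ℝ)) measurableSet_Ioo fun s hs => ?_]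
      · simp
      · simp [nuA_of_lt h hs.2]
    rw [h2, zero_add]
    refine intervalIntegral.integral_congr fun s hs => ?_
    rw [uIcc_of_le ht] at hs
    simp only [hnu s hs.1]; ring
  have hpt := he.integral_exp_mul r g.mu ht0
  have hpτ := he.integral_exp_mul r g.mu hτ
  have hRi : ∀ s, IntervalIntegrable (fun u => Real.exp (-g.mu * u) * (R r eta (max u 0) - r))
      volume 0 s := fun s => Continuous.intervalIntegrable (by fun_prop) _ _
  have hcg : ∀ s, 0 ≤ s → ∫ u in (0 : ℝ)..s, Real.exp (-g.mu * u) * (R r eta u - r)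
      = ∫ u in (0 : ℝ)..s, Real.exp (-g.mu * u) * (R r eta (max u 0) - r) := by
    intro s hs
    refine intervalIntegral.integral_congr fun u hu => ?_
    rw [uIcc_of_le hs] at hu
    simp only [max_eq_left hu.1]
  rw [hcg t ht0] at hpt
  rw [hcg τ hτ] at hpτ
  have hdiff := intervalIntegral.integral_interval_sub_left (hRi t) (hRi τ)
  have hRlin : ∫ v in τ..t, Real.exp (-g.mu * v) * (R r eta (max v 0) - r)
      = (∫ v in τ..t, Real.exp (-g.mu * v) * R r eta (max v 0))
        - r * ∫ v in τ..t, Real.exp (-g.mu * v) := by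
    rw [← intervalIntegral.integral_const_mul, ← intervalIntegral.integral_sub
      (Continuous.intervalIntegrable (by fun_prop) _ _)
      (Continuous.intervalIntegrable (by fun_prop) _ _)]
    refine intervalIntegral.integral_congr fun u _ => ?_
    ring
  have hexp : g.mu * ∫ v in τ..t, Real.exp (-g.mu * v)
      = Real.exp (-g.mu * τ) - Real.exp (-g.mu * t) := by
    have hd : ∀ u ∈ uIcc τ t, HasDerivAt (fun u => -Real.exp (-g.mu * u))
        (g.mu * Real.exp (-g.mu * u)) u := by
      intro u _
      refine (((hasDerivAt_id' u).const_mul (-g.mu)).exp).neg.congr_deriv ?_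
      ring
    rw [← intervalIntegral.integral_const_mul,
      intervalIntegral.integral_eq_sub_of_hasDerivAt hd
        (Continuous.intervalIntegrable (by fun_prop) _ _)]
    ring
  have hbase := freeX_tau hg he hr hτ hle hlt
  rw [freeX] at hbase
  have hct := hconst t
  rw [X_of_path (nuA_mono hg he hr x) (nuA_rightCont hg he hr x) (fun t ht => nuA_neg r x eta ht)
    x eta ht0, hsplit, hnu t ht, max_eq_left ht0, aExt_of_nonneg (hr.trans (he.le_R r ht0)), freeX,
    hpt]
  rw [hpτ] at hbase
  have e1 : Real.exp (g.mu * t) * Real.exp (-g.mu * t) = 1 := by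
    rw [← Real.exp_add]; simp
  have e2 : Real.exp (-g.mu * τ) * Real.exp (g.mu * τ) = 1 := by
    rw [← Real.exp_add]; simp
  have hb' : Real.exp (-g.mu * τ) * (max (g.a r - x) 0 - g.a (R r eta τ))
      + (x - (Real.exp (-g.mu * τ) * (R r eta τ - r)
        + g.mu * ∫ u in (0 : ℝ)..τ, Real.exp (-g.mu * u) * (R r eta (max u 0) - r))) = 0 := by
    linear_combination Real.exp (-g.mu * τ) * hbase - (x - (Real.exp (-g.mu * τ) * (R r eta τ - r)
        + g.mu * ∫ u in (0 : ℝ)..τ, Real.exp (-g.mu * u) * (R r eta (max u 0) - r))) * e2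
  linear_combination Real.exp (g.mu * t) * hct + Real.exp (g.mu * t) * hb'
    + g.a (R r eta t) * e1 - Real.exp (g.mu * t) * g.mu * hdiff
    - Real.exp (g.mu * t) * g.mu * hRlin + Real.exp (g.mu * t) * r * hexp

/-- The reflected capacity in closed form. -/
theorem X_nuA (hg : g.ZeroNoiseAssumption) (he : g.FirmControl eta) (hr : 0 ≤ r) (x : ℝ) {t : ℝ}
    (ht : 0 ≤ t) :
    g.X x eta (g.nuA r x eta) t = max (g.freeX x eta t) (g.a (R r eta t)) := by
  rcases tau_cases hg he hr x with ⟨h, hlt⟩ | ⟨τ, h, hτ, hle, hlt⟩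
  · rw [X_nuA_of_lt hg he hr x ht (by rw [h]; exact EReal.coe_lt_top t),
      max_eq_left (hlt t ht).le]
  rcases lt_or_ge t τ with htτ | htτ
  · rw [X_nuA_of_lt hg he hr x ht (by rw [h]; exact EReal.coe_lt_coe_iff.2 htτ),
      max_eq_left (hlt t ht htτ).le]
  · rw [X_nuA_of_le hg he hr h hτ hle hlt htτ, max_eq_right]
    -- The discounted free capacity decreases, whereas e^{-μt} a(R_t) increases because μ ≤ 0; the
    -- order at τ therefore persists.
    have h1 := he.discounted_antitone x hτ htτ
    have h2 : Real.exp (-g.mu * τ) ≤ Real.exp (-g.mu * t) :=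
      Real.exp_le_exp.2 (mul_le_mul_of_nonneg_left htτ (neg_nonneg.2 hg.mu_nonpos))
    have h3 : g.a (R r eta τ) ≤ g.a (R r eta t) :=
      hg.a_strictMonoOn.monotoneOn (hr.trans (he.le_R r hτ)) (hr.trans (he.le_R r ht))
        (he.R_mono r hτ htτ)
    have h4 : 0 ≤ g.a (R r eta τ) := hg.a_nonneg (hr.trans (he.le_R r hτ))
    have hp := Real.exp_pos (-g.mu * τ)
    have hpt := Real.exp_pos (-g.mu * t)
    have h5 : Real.exp (-g.mu * t) * g.freeX x eta t
        ≤ Real.exp (-g.mu * t) * g.a (R r eta t) :=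
      calc _ ≤ Real.exp (-g.mu * τ) * g.freeX x eta τ := h1
        _ ≤ Real.exp (-g.mu * τ) * g.a (R r eta τ) := mul_le_mul_of_nonneg_left hle hp.le
        _ ≤ Real.exp (-g.mu * t) * g.a (R r eta τ) := mul_le_mul_of_nonneg_right h2 h4
        _ ≤ _ := mul_le_mul_of_nonneg_left h3 hpt.le
    exact le_of_mul_le_mul_left h5 hpt

end nuA

end AbatementGame

/-! ### Investment cost as a running cost, and optimality of reflection for the investor -/

namespace AbatementGame

variable {g : AbatementGame}

lemma lintegral_exp_tail {d : ℝ} (hd : 0 < d) (s : ℝ) :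
    ∫⁻ t in Ioi s, ENNReal.ofReal (d * Real.exp (-d * t)) = ENNReal.ofReal (Real.exp (-d * s)) := by
  have hi : IntegrableOn (fun t => d * Real.exp (-d * t)) (Ioi s) :=
    (integrableOn_exp_mul_Ioi (neg_neg_of_pos hd) s).const_mul d
  rw [← ofReal_integral_eq_lintegral_ofReal hi
    (Eventually.of_forall fun t => (mul_pos hd (Real.exp_pos _)).le), integral_const_mul,
    integral_exp_mul_Ioi (neg_neg_of_pos hd)]
  congr 1
  field_simp

instance (nu : ℝ → ℝ) : SFinite (dMeasure nu) := inferInstance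

/-- The discounted cost of investment, expressed through the additional capacity it creates. -/
lemma lintegral_cost (hg : g.ZeroNoiseAssumption) (x : ℝ) (eta nu : ℝ → ℝ) :
    ∫⁻ t in Ici 0, ENNReal.ofReal (Real.exp (-g.rho * t)) ∂(dMeasure nu)
      = ∫⁻ t in Ioi 0, ENNReal.ofReal
          (g.delta * (Real.exp (-g.rho * t) * (g.X x eta nu t - g.freeX x eta t))) := by
  have hd := hg.delta_pos
  -- Integrating this kernel over t ≥ s gives e^{-δs} e^{-μs} = e^{-ρs}, the cost at s. Integrating
  -- it in dν over s ≤ t gives δ e^{-ρt} times the additional capacity at t.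
  set F : ℝ → ℝ → ℝ≥0∞ := fun t s => if s ≤ t then
    ENNReal.ofReal (g.delta * Real.exp (-g.delta * t)) * ENNReal.ofReal (Real.exp (-g.mu * s))
    else 0 with hF
  have hFm : Measurable (Function.uncurry F) := by
    refine Measurable.ite (measurableSet_le measurable_snd measurable_fst) ?_ measurable_const
    fun_prop
  have hswap := lintegral_lintegral_swap (μ := volume.restrict (Ioi (0 : ℝ)))
    (ν := (dMeasure nu).restrict (Ici 0)) hFm.aemeasurable
  have h1 : ∫⁻ t in Ioi 0, ENNReal.ofReal
      (g.delta * (Real.exp (-g.rho * t) * (g.X x eta nu t - g.freeX x eta t)))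
      = ∫⁻ t in Ioi 0, ∫⁻ s in Ici 0, F t s ∂(dMeasure nu) := by
    refine setLIntegral_congr_fun measurableSet_Ioi fun t ht => ?_
    have hFt : (fun s => F t s) = (Iic t).indicator fun s =>
        ENNReal.ofReal (g.delta * Real.exp (-g.delta * t))
          * ENNReal.ofReal (Real.exp (-g.mu * s)) := by
      ext s; simp [hF, indicator]
    have hIcc : Iic t ∩ Ici 0 = Icc 0 t := by
      ext s; simp only [mem_inter_iff, mem_Iic, mem_Ici, mem_Icc]; tauto
    simp only [hFt]
    rw [lintegral_indicator measurableSet_Iic, Measure.restrict_restrict measurableSet_Iic, hIcc,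
      lintegral_const_mul _ (by fun_prop), ← ofReal_integral_eq_lintegral_ofReal
        (Continuous.integrableOn_Icc (by fun_prop))
        (Eventually.of_forall fun s => (Real.exp_pos _).le),
      ← ENNReal.ofReal_mul (by positivity), X_eq_add]
    congr 1
    rw [show -g.delta * t = -g.rho * t + g.mu * t by unfold delta; ring, Real.exp_add]
    ring
  rw [h1, hswap]
  refine setLIntegral_congr_fun measurableSet_Ici fun s hs => ?_
  have hFs : (fun t => F t s) = (Ici s).indicator fun t =>
      ENNReal.ofReal (Real.exp (-g.mu * s))
        * ENNReal.ofReal (g.delta * Real.exp (-g.delta * t)) := by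
    ext t; simp [hF, indicator, mul_comm]
  simp only [hFs]
  have hae : (Ici s ∩ Ioi 0 : Set ℝ) =ᵐ[volume] Ioi s := by
    refine ae_eq_set.2 ⟨?_, ?_⟩
    · refine measure_mono_null (t := {s}) (fun t ht => ?_) (by simp)
      exact le_antisymm (not_lt.1 ht.2) ht.1.1
    · refine measure_mono_null (t := ∅) (fun t ht => ?_) (by simp)
      exact ht.2 ⟨mem_Ici.2 (le_of_lt ht.1), (mem_Ici.1 hs).trans_lt ht.1⟩
  rw [lintegral_indicator measurableSet_Ici, Measure.restrict_restrict measurableSet_Ici,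
    Measure.restrict_congr_set hae, lintegral_const_mul _ (by fun_prop), lintegral_exp_tail hd,
    ← ENNReal.ofReal_mul (Real.exp_pos _).le, ← Real.exp_add]
  congr 2
  unfold delta; ring

namespace ZeroNoiseAssumption

/-- Integrability of a discounted function along `v ↦ r + m v`, from that along `v ↦ m v`. -/
lemma _root_.MeasureTheory.IntegrableOn.discounted_shift {f : ℝ → ℝ} {c m r : ℝ} (hm : 0 < m)
    (hr : 0 ≤ r) (h : IntegrableOn (fun t => Real.exp (-c * t) * f (m * t)) (Ioi 0)) :
    IntegrableOn (fun t => Real.exp (-c * t) * f (r + m * t)) (Ioi 0) := by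
  -- Starting at r amounts to a time shift by r/m, at the price of the constant factor e^{c r/m}.
  have h1 : IntegrableOn (fun t => Real.exp (-c * t) * f (m * t)) (Ioi (r / m)) :=
    h.mono_set (Ioi_subset_Ioi (by positivity))
  have h2 := (MeasurePreserving.integrableOn_comp_preimage
    (measurePreserving_add_right volume (r / m))
    (measurableEmbedding_addRight (r / m))).2 h1
  have h3 : (fun t : ℝ => t + r / m) ⁻¹' Ioi (r / m) = Ioi 0 := by
    ext t; simp
  rw [h3] at h2
  refine IntegrableOn.congr_fun (h2.const_mul (Real.exp (c * (r / m)))) (fun t _ => ?_)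
    measurableSet_Ioi
  simp only [Function.comp]
  rw [← mul_assoc, ← Real.exp_add]
  congr 2
  · ring
  · field_simp; ring

lemma integrable_a (hg : g.ZeroNoiseAssumption) {r : ℝ} (hr : 0 ≤ r) :
    IntegrableOn (fun t => Real.exp (-g.rho * t) * g.a (r + g.etaMax * t)) (Ioi 0) :=
  hg.a_integrable.discounted_shift hg.etaMax_pos hr

end ZeroNoiseAssumption

lemma abs_freeX_le (hg : g.ZeroNoiseAssumption) {eta : ℝ → ℝ} (he : g.FirmControl eta) {x t : ℝ}
    (hx : 0 ≤ x) (ht : 0 ≤ t) : |g.freeX x eta t| ≤ x + g.etaMax * t := by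
  have hmt : g.mu * t ≤ 0 := mul_nonpos_of_nonpos_of_nonneg hg.mu_nonpos ht
  have hf : Continuous fun s => Real.exp (-g.mu * s) := by fun_prop
  have hI0 : 0 ≤ ∫ s in (0 : ℝ)..t, Real.exp (-g.mu * s) * eta s :=
    intervalIntegral.integral_nonneg ht fun u hu =>
      mul_nonneg (Real.exp_pos _).le (he.2 u hu.1).1
  have hI1 : ∫ s in (0 : ℝ)..t, Real.exp (-g.mu * s) * eta s
      ≤ Real.exp (-g.mu * t) * (g.etaMax * t) := by
    have := intervalIntegral.integral_mono_on ht (he.intervalIntegrable_mul hf le_rfl ht)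
      (intervalIntegrable_const (c := Real.exp (-g.mu * t) * g.etaMax)) fun u hu =>
        mul_le_mul (Real.exp_le_exp.2 (mul_le_mul_of_nonneg_left hu.2
          (neg_nonneg.2 hg.mu_nonpos))) (he.2 u hu.1).2 (he.2 u hu.1).1 (Real.exp_pos _).le
    rw [intervalIntegral.integral_const, smul_eq_mul, sub_zero] at this
    linarith
  have he1 : Real.exp (g.mu * t) ≤ 1 := Real.exp_le_one_iff.2 hmt
  have hep := Real.exp_pos (g.mu * t)
  have h1 : Real.exp (g.mu * t) * ∫ s in (0 : ℝ)..t, Real.exp (-g.mu * s) * eta s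
      ≤ g.etaMax * t := by
    have := mul_le_mul_of_nonneg_left hI1 hep.le
    rwa [← mul_assoc, ← Real.exp_add, show g.mu * t + -g.mu * t = 0 by ring, Real.exp_zero,
      one_mul] at this
  have h2 : Real.exp (g.mu * t) * x ≤ x := by nlinarith
  have h3 := mul_nonneg hep.le hI0
  have h4 := mul_nonneg hep.le hx
  rw [freeX, mul_sub, abs_le]
  constructor <;> nlinarith

lemma R_nonneg {r : ℝ} (hr : 0 ≤ r) {eta : ℝ → ℝ} (he : g.FirmControl eta) {t : ℝ}
    (ht : 0 ≤ t) : 0 ≤ R r eta t := hr.trans (he.le_R r ht)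

/-- By `lintegral_cost` it is enough to bound X - Y, and max(Y, a(R)) - Y is at most a(r + η_max t)
plus a linear function of t. -/
lemma nuA_finite_cost (hg : g.ZeroNoiseAssumption) {eta : ℝ → ℝ} (he : g.FirmControl eta)
    {r x : ℝ} (hr : 0 ≤ r) (hx : 0 ≤ x) :
    ∫⁻ t in Ici 0, ENNReal.ofReal (Real.exp (-g.rho * t)) ∂(dMeasure (g.nuA r x eta)) < ⊤ := by
  rw [lintegral_cost hg x eta]
  have hlin : IntegrableOn (fun t => Real.exp (-g.rho * t) * (2 * (x + g.etaMax * t)))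
      (Ioi 0) := by
    have h1 : IntegrableOn (fun t : ℝ => Real.exp (-g.rho * t)) (Ioi 0) :=
      integrableOn_exp_mul_Ioi (neg_neg_of_pos hg.rho_pos) 0
    have h2 : IntegrableOn (fun t : ℝ => t * Real.exp (-g.rho * t)) (Ioi 0) := by
      have := integrableOn_rpow_mul_exp_neg_mul_rpow (s := 1) (p := 1) (b := g.rho)
        (by norm_num) one_pos hg.rho_pos
      simpa using this
    refine IntegrableOn.congr_fun ((h1.const_mul (2 * x)).add (h2.const_mul (2 * g.etaMax)))
      (fun t _ => ?_) measurableSet_Ioi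
    simp only [Pi.add_apply]; ring
  have hint := ((hg.integrable_a hr).add hlin).const_mul g.delta
  refine lt_of_le_of_lt (setLIntegral_mono' measurableSet_Ioi fun t ht =>
    ENNReal.ofReal_le_ofReal ?_) hint.lintegral_lt_top
  have ht0 : 0 ≤ t := le_of_lt ht
  simp only [Pi.add_apply]
  rw [← mul_add]
  refine mul_le_mul_of_nonneg_left (mul_le_mul_of_nonneg_left ?_ (Real.exp_pos _).le)
    hg.delta_pos.le
  have h1 := abs_freeX_le hg he hx ht0
  have h2 := abs_le.1 h1
  have h3 : g.a (R r eta t) ≤ g.a (r + g.etaMax * t) :=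
    hg.a_strictMonoOn.monotoneOn (R_nonneg hr he ht0)
      (mem_Ici.2 ((R_nonneg hr he ht0).trans (he.R_le r ht0))) (he.R_le r ht0)
  have h4 : 0 ≤ g.a (r + g.etaMax * t) := hg.a_nonneg ((R_nonneg hr he ht0).trans (he.R_le r ht0))
  rw [X_nuA hg he hr x ht0]
  rcases max_cases (g.freeX x eta t) (g.a (R r eta t)) with ⟨h, _⟩ | ⟨h, _⟩ <;> rw [h] <;> linarith

theorem nuA_investorControl (hg : g.ZeroNoiseAssumption) {eta : ℝ → ℝ} (he : g.FirmControl eta)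
    {r x : ℝ} (hr : 0 ≤ r) (hx : 0 ≤ x) : g.InvestorControl (g.nuA r x eta) where
  mono := nuA_mono hg he hr x
  rightCont := nuA_rightCont hg he hr x
  eq_zero := fun _ ht => nuA_neg r x eta ht
  finite_cost := nuA_finite_cost hg he hr hx

lemma le_X_nuA (hg : g.ZeroNoiseAssumption) {eta : ℝ → ℝ} (he : g.FirmControl eta) {r : ℝ}
    (hr : 0 ≤ r) (x : ℝ) {t : ℝ} (ht : 0 ≤ t) :
    g.a (R r eta t) ≤ g.X x eta (g.nuA r x eta) t := by
  rw [X_nuA hg he hr x ht]; exact le_max_right _ _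

lemma X_nuA_nonneg (hg : g.ZeroNoiseAssumption) {eta : ℝ → ℝ} (he : g.FirmControl eta) {r : ℝ}
    (hr : 0 ≤ r) (x : ℝ) {t : ℝ} (ht : 0 ≤ t) : 0 ≤ g.X x eta (g.nuA r x eta) t :=
  (hg.a_nonneg (R_nonneg hr he ht)).trans (le_X_nuA hg he hr x ht)

lemma freeX_le_X (g : AbatementGame) (x : ℝ) (eta nu : ℝ → ℝ) (t : ℝ) :
    g.freeX x eta t ≤ g.X x eta nu t := by
  rw [X_eq_add]
  exact le_add_of_nonneg_right (mul_nonneg (Real.exp_pos _).le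
    (integral_nonneg fun s => (Real.exp_pos _).le))

/-- The reflecting policy is optimal for the investor against any control of the firm. -/
theorem JI_le_JI_nuA (hg : g.ZeroNoiseAssumption) {eta : ℝ → ℝ} (he : g.FirmControl eta)
    {r x : ℝ} (hr : 0 ≤ r) (hx : 0 ≤ x) {nu : ℝ → ℝ} (hnu : g.InvestorControl nu) :
    g.JI r x eta nu ≤ g.JI r x eta (g.nuA r x eta) := by
  by_cases hpos : ∀ t, 0 ≤ t → 0 ≤ g.X x eta nu t
  swap
  · rw [JI, if_neg hpos]; exact bot_le
  rw [JI, if_pos hpos, JI, if_pos fun t ht => X_nuA_nonneg hg he hr x ht]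
  set P : (ℝ → ℝ) → ℝ≥0∞ := fun n => ∫⁻ t in Ioi 0, ENNReal.ofReal
    (Real.exp (-g.rho * t) * g.profitI (R r eta t) (g.X x eta n t)) with hP
  set C : (ℝ → ℝ) → ℝ≥0∞ := fun n =>
    ∫⁻ t in Ici 0, ENNReal.ofReal (Real.exp (-g.rho * t)) ∂(dMeasure n) with hC
  change ((P nu : ℝ≥0∞) : EReal) - ((ENNReal.ofReal g.alpha * C nu : ℝ≥0∞) : EReal)
    ≤ ((P (g.nuA r x eta) : ℝ≥0∞) : EReal)
      - ((ENNReal.ofReal g.alpha * C (g.nuA r x eta) : ℝ≥0∞) : EReal)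
  have hfin : ∀ n, g.InvestorControl n → ENNReal.ofReal g.alpha * C n ≠ ⊤ := fun n hn =>
    ENNReal.mul_ne_top ENNReal.ofReal_ne_top hn.finite_cost.ne
  have hCn : ∀ n, ENNReal.ofReal g.alpha * C n = ∫⁻ t in Ioi 0, ENNReal.ofReal
      (g.alpha * g.delta * (Real.exp (-g.rho * t) * (g.X x eta n t - g.freeX x eta t))) := by
    intro n
    rw [hC]
    simp only
    rw [lintegral_cost hg x eta, ← lintegral_const_mul' _ _ ENNReal.ofReal_ne_top]
    refine lintegral_congr fun t => ?_
    rw [← ENNReal.ofReal_mul hg.alpha_pos.le, mul_assoc g.alpha]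
  have hmeas : ∀ n, Measurable fun t => ENNReal.ofReal
      (g.alpha * g.delta * (Real.exp (-g.rho * t) * (g.X x eta n t - g.freeX x eta t))) := by
    intro n
    have hmono : Monotone fun t => ∫ s in Icc 0 t, Real.exp (-g.mu * s) ∂(dMeasure n) := by
      intro s t hst
      exact setIntegral_mono_set (Continuous.integrableOn_Icc (by fun_prop))
        (Eventually.of_forall fun s => (Real.exp_pos _).le)
        (Icc_subset_Icc_right hst).eventuallyLE
    have := hmono.measurable
    simp only [X_eq_add, add_sub_cancel_left]
    fun_prop
  -- The comparison is stated with sums, because the profit integrals may be infinite; the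
  -- integrands then compare pointwise through `profitI_sub_le`.
  have hkey : P nu + ENNReal.ofReal g.alpha * C (g.nuA r x eta)
      ≤ P (g.nuA r x eta) + ENNReal.ofReal g.alpha * C nu := by
    rw [hCn, hCn, ← lintegral_add_right _ (hmeas _), ← lintegral_add_right _ (hmeas _)]
    refine setLIntegral_mono' measurableSet_Ioi fun t ht => ?_
    have ht0 : 0 ≤ t := le_of_lt ht
    have hR := R_nonneg hr he ht0
    have hX := X_nuA_nonneg hg he hr x ht0
    have hαδ := mul_pos hg.alpha_pos hg.delta_pos
    have hexp := Real.exp_pos (-g.rho * t)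
    rw [← ENNReal.ofReal_add (mul_nonneg hexp.le (hg.profitI_nonneg _ _ hR (hpos t ht0)))
      (mul_nonneg hαδ.le (mul_nonneg hexp.le (sub_nonneg.2 (freeX_le_X ..)))),
      ← ENNReal.ofReal_add (mul_nonneg hexp.le (hg.profitI_nonneg _ _ hR hX))
      (mul_nonneg hαδ.le (mul_nonneg hexp.le (sub_nonneg.2 (freeX_le_X ..))))]
    refine ENNReal.ofReal_le_ofReal ?_
    have hmain := hg.profitI_sub_le hR (hpos t ht0) (le_X_nuA hg he hr x ht0) (by
      rw [X_nuA hg he hr x ht0]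
      rcases max_cases (g.freeX x eta t) (g.a (R r eta t)) with ⟨h, _⟩ | ⟨h, _⟩ <;> rw [h]
      · exact Or.inr (freeX_le_X ..)
      · exact Or.inl rfl)
    have := mul_le_mul_of_nonneg_left hmain hexp.le
    linarith
  have h1 := hfin nu hnu
  have h2 := hfin _ (nuA_investorControl hg he hr hx)
  generalize hc1 : ENNReal.ofReal g.alpha * C nu = c₁ at *
  generalize hc2 : ENNReal.ofReal g.alpha * C (g.nuA r x eta) = c₂ at *
  lift c₁ to NNReal using h1
  lift c₂ to NNReal using h2
  generalize P (g.nuA r x eta) = p₂ at *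
  generalize P nu = p₁ at *
  have hcast : ∀ c : NNReal, ((c : ℝ≥0∞) : EReal) = ((c : ℝ) : EReal) := fun c => rfl
  -- Costs are finite, so only profits can be infinite. If the profit under reflection is infinite
  -- there is nothing to prove; otherwise all four quantities are real.
  rcases eq_or_ne p₂ ⊤ with rfl | hp2
  · rw [EReal.coe_ennreal_top, hcast c₂, EReal.top_sub_coe]; exact le_top
  have hp1 : p₁ ≠ ⊤ := by
    rintro rfl
    rw [top_add, top_le_iff] at hkey
    exact (ENNReal.add_ne_top.2 ⟨hp2, ENNReal.coe_ne_top⟩) hkey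
  lift p₁ to NNReal using hp1
  lift p₂ to NNReal using hp2
  simp only [hcast]
  norm_cast at hkey ⊢
  have hk : (p₁ : ℝ) + c₂ ≤ p₂ + c₁ := by exact_mod_cast hkey
  linarith

/-- The reflecting policy only uses the past of the control of the firm. -/
lemma nuA_nonanticipative (hg : g.ZeroNoiseAssumption) {r : ℝ} (hr : 0 ≤ r) (x : ℝ)
    {eta₁ eta₂ : ℝ → ℝ} (he₁ : g.FirmControl eta₁) (he₂ : g.FirmControl eta₂) {t : ℝ}
    (h : ∀ s, 0 ≤ s → s ≤ t → eta₁ s = eta₂ s) :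
    g.nuA r x eta₁ t = g.nuA r x eta₂ t := by
  have hR : ∀ s, 0 ≤ s → s ≤ t → R r eta₁ s = R r eta₂ s := by
    intro s hs hst
    rw [R, R, intervalIntegral.integral_congr fun u hu => ?_]
    rw [uIcc_of_le hs] at hu
    exact h u hu.1 (hu.2.trans hst)
  have hX : ∀ s, 0 ≤ s → s ≤ t → g.freeX x eta₁ s = g.freeX x eta₂ s := by
    intro s hs hst
    rw [freeX, freeX, intervalIntegral.integral_congr fun u hu => ?_]
    rw [uIcc_of_le hs] at hu
    simp only [h u hu.1 (hu.2.trans hst)]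
  rcases tau_cases hg he₁ hr x with ⟨h₁, hlt₁⟩ | ⟨τ₁, h₁, hτ₁, hle₁, hlt₁⟩ <;>
    rcases tau_cases hg he₂ hr x with ⟨h₂, hlt₂⟩ | ⟨τ₂, h₂, hτ₂, hle₂, hlt₂⟩
  · rw [nuA_eq_zero h₁, nuA_eq_zero h₂]
  · rw [nuA_eq_zero h₁, nuA_of_lt h₂ (lt_of_not_ge fun hτt => ?_)]
    have := hlt₁ τ₂ hτ₂
    rw [hR _ hτ₂ hτt, hX _ hτ₂ hτt] at this
    exact absurd hle₂ (not_le.2 this)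
  · rw [nuA_eq_zero h₂, nuA_of_lt h₁ (lt_of_not_ge fun hτt => ?_)]
    have := hlt₂ τ₁ hτ₁
    rw [← hR _ hτ₁ hτt, ← hX _ hτ₁ hτt] at this
    exact absurd hle₁ (not_le.2 this)
  · rcases lt_or_ge t τ₁ with ht₁ | ht₁ <;> rcases lt_or_ge t τ₂ with ht₂ | ht₂
    · rw [nuA_of_lt h₁ ht₁, nuA_of_lt h₂ ht₂]
    · have := hlt₁ τ₂ hτ₂ (ht₂.trans_lt ht₁)
      rw [hR _ hτ₂ ht₂, hX _ hτ₂ ht₂] at this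
      exact absurd hle₂ (not_le.2 this)
    · have := hlt₂ τ₁ hτ₁ (ht₁.trans_lt ht₂)
      rw [← hR _ hτ₁ ht₁, ← hX _ hτ₁ ht₁] at this
      exact absurd hle₁ (not_le.2 this)
    · have heq : τ₁ = τ₂ := by
        rcases lt_trichotomy τ₁ τ₂ with hlt | heq | hlt
        · have := hlt₂ τ₁ hτ₁ hlt
          rw [← hR _ hτ₁ ht₁, ← hX _ hτ₁ ht₁] at this
          exact absurd hle₁ (not_le.2 this)
        · exact heq
        · have := hlt₁ τ₂ hτ₂ hlt
          rw [hR _ hτ₂ ht₂, hX _ hτ₂ ht₂] at this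
          exact absurd hle₂ (not_le.2 this)
      subst heq
      rw [nuA_of_le h₁ ht₁, nuA_of_le h₂ ht₂, hR t (hτ₁.trans ht₁) le_rfl, hR τ₁ hτ₁ ht₁]
      congr 1
      refine intervalIntegral.integral_congr fun u hu => ?_
      rw [uIcc_of_le ht₁] at hu
      simp only [hR u (hτ₁.trans hu.1) hu.2]

/-- The reflecting policy supports a Nash equilibrium as soon as the firm has no profitable
deviation from its control. -/
theorem isNash_nuA (hg : g.ZeroNoiseAssumption) {r x : ℝ} (hr : 0 ≤ r) (hx : 0 ≤ x)
    {eta : ℝ → ℝ} (he : g.FirmControl eta)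
    (hopt : ∀ eta', g.FirmControl eta' →
      g.JF x eta' (g.nuA r x eta') ≤ g.JF x eta (g.nuA r x eta)) :
    g.IsNash r x eta (g.nuA r x) where
  firm_control := he
  investor_control := fun _ he' => nuA_investorControl hg he' hr hx
  nonanticipative := fun _ _ h₁ h₂ _ _ h => nuA_nonanticipative hg hr x h₁ h₂ h
  nonneg := fun _ ht => X_nuA_nonneg hg he hr x ht
  firm_opt := hopt
  investor_opt := fun _ hnu => JI_le_JI_nuA hg he hr hx hnu

/-- The payoff of the firm against the reflecting policy. -/
lemma JF_nuA (hg : g.ZeroNoiseAssumption) {r : ℝ} (hr : 0 ≤ r) (x : ℝ)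
    {eta : ℝ → ℝ} (he : g.FirmControl eta) :
    g.JF x eta (g.nuA r x eta) = ∫⁻ t in Ioi 0, ENNReal.ofReal (Real.exp (-g.rhoBar * t)
      * g.piExt (max (g.freeX x eta t) (g.a (R r eta t)))) := by
  refine setLIntegral_congr_fun measurableSet_Ioi fun t ht => ?_
  simp only [X_nuA hg he hr x (le_of_lt ht), piExt]

end AbatementGame

/-! ### The flow under maximal abatement and the level at which it meets the boundary `a` -/

lemma hasDerivAt_primitive_of_continuousOn {f : ℝ → ℝ} {U : Set ℝ} (hU : IsOpen U)
    (hc : U.OrdConnected) {c y : ℝ} (h0 : c ∈ U) (hf : ContinuousOn f U) (hy : y ∈ U) :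
    HasDerivAt (fun y => ∫ z in c..y, f z) (f y) y :=
  intervalIntegral.integral_hasDerivAt_right
    ((hf.mono (hc.uIcc_subset h0 hy)).intervalIntegrable)
    (hf.stronglyMeasurableAtFilter hU y hy) (hf.continuousAt (hU.mem_nhds hy))

lemma contDiffAt_one_of_hasDerivAt {f f' : ℝ → ℝ} {U : Set ℝ} (hU : IsOpen U) {x : ℝ} (hx : x ∈ U)
    (hd : ∀ y ∈ U, HasDerivAt f (f' y) y) (hf' : ContinuousOn f' U) : ContDiffAt ℝ 1 f x := by
  have h : ContDiffOn ℝ 1 f U := by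
    rw [show (1 : WithTop ℕ∞) = 0 + 1 by rfl, contDiffOn_succ_iff_deriv_of_isOpen hU]
    refine ⟨fun y hy => (hd y hy).differentiableAt.differentiableWithinAt, by simp, ?_⟩
    rw [contDiffOn_zero]
    exact hf'.congr fun y hy => (hd y hy).deriv
  exact h.contDiffAt (hU.mem_nhds hx)

namespace AbatementGame

variable {g : AbatementGame}

/-- The capacities from which the flow under maximal abatement decreases. -/
def Dom (g : AbatementGame) : Set ℝ := {y | 0 < g.etaMax - g.mu * y}

/-- The (signed) time that maximal abatement takes to bring the capacity from `y` to `0`. -/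
noncomputable def tm (g : AbatementGame) (y : ℝ) : ℝ := ∫ z in (0 : ℝ)..y, (g.etaMax - g.mu * z)⁻¹

/-- Under maximal abatement the boundary is hit at the technology level `ξ` with
`bA ξ = tm x + r / etaMax`. -/
noncomputable def bA (g : AbatementGame) (ξ : ℝ) : ℝ := g.tm (g.aExt ξ) + ξ / g.etaMax

/-- The inverse of `bA`. -/
noncomputable def Xi (g : AbatementGame) (s : ℝ) : ℝ := Function.invFun g.bA s

/-- The profit of the firm on the boundary. -/
noncomputable def piA (g : AbatementGame) (v : ℝ) : ℝ := g.piExt (g.aExt v)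

/-- The ratio of the discount rate and the maximal speed of the firm. -/
noncomputable def kappa (g : AbatementGame) : ℝ := g.rhoBar / g.etaMax

/-- The discounted payoff of the firm along the boundary, from technology level `ξ` on. -/
noncomputable def P0 (g : AbatementGame) (ξ : ℝ) : ℝ :=
  g.etaMax⁻¹ * ((∫ v in Ioi 0, Real.exp (-g.kappa * v) * g.piA v)
    - ∫ v in (0 : ℝ)..ξ, Real.exp (-g.kappa * v) * g.piA v)

/-- The gain over staying at `ξ` from moving along the boundary. -/
noncomputable def P1 (g : AbatementGame) (ξ : ℝ) : ℝ :=
  g.rhoBar * g.P0 ξ - Real.exp (-g.kappa * ξ) * g.piA ξ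

/-- The substitution z = Y_t turns the profit collected while maximal abatement brings the capacity
from y down to 0 into e^{-ρ̄ tm y} Q0 y. Differences of `Q0` give the profit collected before `a` is
reached. -/
noncomputable def Q0 (g : AbatementGame) (y : ℝ) : ℝ :=
  ∫ z in (0 : ℝ)..y, Real.exp (g.rhoBar * g.tm z) * g.piExt z * (g.etaMax - g.mu * z)⁻¹

/-- The combination is chosen so that π is differentiated and nothing else survives: its derivative
on (0, ∞) is e^{ρ̄ tm} π'. -/
noncomputable def Nf (g : AbatementGame) (y : ℝ) : ℝ :=
  Real.exp (g.rhoBar * g.tm y) * g.piExt y - g.rhoBar * g.Q0 y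

/-- The technology level at which the boundary is hit from `(r, x)` under maximal abatement. -/
noncomputable def hit (g : AbatementGame) (r x : ℝ) : ℝ := g.Xi (g.tm x + r / g.etaMax)

/-- The payoff of the firm for permanent maximal abatement, in closed form. -/
noncomputable def W (g : AbatementGame) (r x : ℝ) : ℝ :=
  Real.exp (-g.rhoBar * g.tm x) * (g.Q0 x - g.Q0 (g.aExt (g.hit r x)))
    + Real.exp (g.kappa * r) * g.P0 (g.hit r x)

/-- `Wx` and `Wr` are the partial derivatives of `W` when the hitting level is positive, see
`W_hasFDerivAt`. -/
noncomputable def Wx (g : AbatementGame) (r x : ℝ) : ℝ :=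
  (g.etaMax - g.mu * x)⁻¹ * Real.exp (-g.rhoBar * g.tm x) * (g.Nf x - g.Nf (g.aExt (g.hit r x)))

noncomputable def Wr (g : AbatementGame) (r x : ℝ) : ℝ :=
  g.etaMax⁻¹ * (Real.exp (g.kappa * r) * g.P1 (g.hit r x))

/-- Closed form of the free-boundary function `h`. -/
noncomputable def hh (g : AbatementGame) (r x : ℝ) : ℝ :=
  Real.exp (-(g.rhoBar - g.mu) * g.tm x) * (g.Nf x - g.Nf (g.aExt (g.hit r x)))
    - Real.exp (g.kappa * r) * g.P1 (g.hit r x)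

lemma Dom_isOpen : IsOpen g.Dom := isOpen_lt continuous_const (by fun_prop)

lemma mem_Dom {y : ℝ} : y ∈ g.Dom ↔ 0 < g.etaMax - g.mu * y := Iff.rfl

lemma Dom_ordConnected : g.Dom.OrdConnected := by
  refine ⟨fun x hx y hy z hz => ?_⟩
  rw [mem_Dom] at *
  rcases le_total 0 g.mu with h | h
  · nlinarith [hz.1, hz.2]
  · nlinarith [hz.1, hz.2]

lemma nonneg_mem_Dom (hg : g.ZeroNoiseAssumption) {y : ℝ} (hy : 0 ≤ y) : y ∈ g.Dom := by
  rw [mem_Dom]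
  have := hg.etaMax_pos
  have := mul_nonpos_of_nonpos_of_nonneg hg.mu_nonpos hy
  linarith

lemma Dom_inv_continuousOn : ContinuousOn (fun z => (g.etaMax - g.mu * z)⁻¹) g.Dom :=
  ContinuousOn.inv₀ (by fun_prop) fun z hz => (mem_Dom.1 hz).ne'

section Flow

lemma tm_zero : g.tm 0 = 0 := by simp [tm]

lemma tm_hasDerivAt (hg : g.ZeroNoiseAssumption) {y : ℝ} (hy : y ∈ g.Dom) :
    HasDerivAt g.tm (g.etaMax - g.mu * y)⁻¹ y :=
  hasDerivAt_primitive_of_continuousOn Dom_isOpen Dom_ordConnected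
    (nonneg_mem_Dom hg le_rfl) Dom_inv_continuousOn hy

lemma tm_contDiffAt (hg : g.ZeroNoiseAssumption) {y : ℝ} (hy : y ∈ g.Dom) :
    ContDiffAt ℝ 1 g.tm y :=
  contDiffAt_one_of_hasDerivAt Dom_isOpen hy (fun _ h => tm_hasDerivAt hg h) Dom_inv_continuousOn

lemma tm_continuousOn (hg : g.ZeroNoiseAssumption) : ContinuousOn g.tm g.Dom := fun _ hy =>
  (tm_hasDerivAt hg hy).continuousAt.continuousWithinAt

lemma tm_strictMonoOn (hg : g.ZeroNoiseAssumption) : StrictMonoOn g.tm g.Dom := by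
  refine strictMonoOn_of_deriv_pos Dom_ordConnected.convex (tm_continuousOn hg) fun y hy => ?_
  rw [Dom_isOpen.interior_eq] at hy
  rw [(tm_hasDerivAt hg hy).deriv]
  exact inv_pos.2 hy

/-- The left side has zero derivative in y and equals η_max at 0. This integrated form of `tm`
treats μ = 0 and μ < 0 together. -/
lemma exp_tm (hg : g.ZeroNoiseAssumption) {y : ℝ} (hy : y ∈ g.Dom) :
    Real.exp (g.mu * g.tm y) * (g.etaMax - g.mu * y) = g.etaMax := by
  have hd : ∀ z ∈ g.Dom, HasDerivAt
      (fun z => Real.exp (g.mu * g.tm z) * (g.etaMax - g.mu * z)) 0 z := by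
    intro z hz
    have h1 := ((tm_hasDerivAt hg hz).const_mul g.mu).exp.mul
      (((hasDerivAt_id' z).const_mul g.mu).const_sub g.etaMax)
    refine h1.congr_deriv ?_
    have := (mem_Dom.1 hz).ne'
    field_simp
    ring
  have := Dom_isOpen.is_const_of_deriv_eq_zero Dom_ordConnected.isPreconnected
    (fun z hz => (hd z hz).differentiableAt.differentiableWithinAt)
    (fun z hz => (hd z hz).deriv) hy (nonneg_mem_Dom hg le_rfl)
  simpa [tm_zero] using this

lemma tm_nonneg (hg : g.ZeroNoiseAssumption) {y : ℝ} (hy : 0 ≤ y) : 0 ≤ g.tm y := by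
  rw [← tm_zero (g := g)]
  exact (tm_strictMonoOn hg).monotoneOn (nonneg_mem_Dom hg le_rfl) (nonneg_mem_Dom hg hy) hy

lemma tm_lt_iff (hg : g.ZeroNoiseAssumption) {y z : ℝ} (hy : y ∈ g.Dom) (hz : z ∈ g.Dom) :
    g.tm y < g.tm z ↔ y < z := (tm_strictMonoOn hg).lt_iff_lt hy hz

lemma tm_le_iff (hg : g.ZeroNoiseAssumption) {y z : ℝ} (hy : y ∈ g.Dom) (hz : z ∈ g.Dom) :
    g.tm y ≤ g.tm z ↔ y ≤ z := (tm_strictMonoOn hg).le_iff_le hy hz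

lemma exists_tm_eq (hg : g.ZeroNoiseAssumption) {s : ℝ} (hs : 0 ≤ s) :
    ∃ y, 0 ≤ y ∧ g.tm y = s := by
  have hm := hg.etaMax_pos
  rcases hg.mu_nonpos.eq_or_lt with h | h
  · refine ⟨g.etaMax * s, by positivity, ?_⟩
    simp [tm, h]
    field_simp
  · set y := g.etaMax * (Real.exp (-g.mu * s) - 1) / (-g.mu) with hy
    have hy0 : 0 ≤ y := by
      have : 1 ≤ Real.exp (-g.mu * s) := Real.one_le_exp (by nlinarith)
      exact div_nonneg (mul_nonneg hm.le (by linarith)) (by linarith)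
    refine ⟨y, hy0, ?_⟩
    have h1 := exp_tm hg (nonneg_mem_Dom hg hy0)
    have h2 : g.etaMax - g.mu * y = g.etaMax * Real.exp (-g.mu * s) := by
      have hmu := h.ne
      rw [hy]; field_simp; ring
    rw [h2, mul_left_comm, ← Real.exp_add] at h1
    have h3 : Real.exp (g.mu * g.tm y + -g.mu * s) = 1 :=
      mul_left_cancel₀ hm.ne' (h1.trans (mul_one _).symm)
    rw [Real.exp_eq_one_iff] at h3
    have h4 : g.mu * (g.tm y - s) = 0 := by linarith
    rcases mul_eq_zero.1 h4 with h5 | h5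
    · exact absurd h5 h.ne
    · linarith

/-- The control of permanent maximal abatement is admissible. -/
lemma firmControl_const (hg : g.ZeroNoiseAssumption) : g.FirmControl fun _ => g.etaMax :=
  ⟨measurable_const, fun _ _ => ⟨hg.etaMax_pos.le, le_rfl⟩⟩

lemma R_const (r c t : ℝ) : R r (fun _ => c) t = r + c * t := by
  simp [R, mul_comm]

lemma freeX_const_hasDerivAt (x c t : ℝ) :
    HasDerivAt (g.freeX x fun _ => c) (g.mu * g.freeX x (fun _ => c) t - c) t := by
  have hc : Continuous fun s => Real.exp (-g.mu * s) * c := by fun_prop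
  have h1 := (intervalIntegral.integral_hasDerivAt_right (hc.intervalIntegrable 0 t)
    (hc.stronglyMeasurableAtFilter volume _) hc.continuousAt).const_sub x
  have h2 := ((hasDerivAt_id' t).const_mul g.mu).exp.mul h1
  refine h2.congr_deriv ?_
  have e : Real.exp (g.mu * t) * Real.exp (-g.mu * t) = 1 := by rw [← Real.exp_add]; simp
  rw [freeX]
  linear_combination -c * e

lemma freeX_const_continuous (x c : ℝ) : Continuous (g.freeX x fun _ => c) :=
  continuous_iff_continuousAt.2 fun t => (freeX_const_hasDerivAt x c t).continuousAt

lemma freeX_max_eq (x t : ℝ) :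
    g.etaMax - g.mu * g.freeX x (fun _ => g.etaMax) t
      = Real.exp (g.mu * t) * (g.etaMax - g.mu * x) := by
  have hd : ∀ t, HasDerivAt (fun t => Real.exp (-g.mu * t)
      * (g.etaMax - g.mu * g.freeX x (fun _ => g.etaMax) t)) 0 t := by
    intro t
    have h1 := ((hasDerivAt_id' t).const_mul (-g.mu)).exp.mul
      (((freeX_const_hasDerivAt (g := g) x g.etaMax t).const_mul g.mu).const_sub g.etaMax)
    refine h1.congr_deriv ?_
    ring
  have := is_const_of_deriv_eq_zero (fun u => (hd u).differentiableAt) (fun u => (hd u).deriv) t 0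
  simp only [mul_zero, Real.exp_zero, one_mul, freeX_zero] at this
  rw [← this, ← mul_assoc, ← Real.exp_add]
  simp

lemma freeX_max_mem_Dom (hg : g.ZeroNoiseAssumption) {x : ℝ} (hx : 0 ≤ x) (t : ℝ) :
    g.freeX x (fun _ => g.etaMax) t ∈ g.Dom := by
  rw [mem_Dom, freeX_max_eq]
  exact mul_pos (Real.exp_pos _) (nonneg_mem_Dom hg hx)

/-- In the clock `tm` the flow under maximal abatement runs down at unit speed. -/
lemma tm_freeX_max (hg : g.ZeroNoiseAssumption) {x : ℝ} (hx : 0 ≤ x) (t : ℝ) :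
    g.tm (g.freeX x (fun _ => g.etaMax) t) = g.tm x - t := by
  have hd : ∀ t, HasDerivAt (fun t => g.tm (g.freeX x (fun _ => g.etaMax) t) + t) 0 t := by
    intro t
    have hD := freeX_max_mem_Dom hg hx t
    have h1 := ((tm_hasDerivAt hg hD).comp t (freeX_const_hasDerivAt x g.etaMax t)).add
      (hasDerivAt_id' t)
    refine h1.congr_deriv ?_
    have := (mem_Dom.1 hD).ne'
    field_simp
    ring
  have := is_const_of_deriv_eq_zero (fun u => (hd u).differentiableAt) (fun u => (hd u).deriv) t 0
  simp only [freeX_zero] at this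
  linarith

end Flow

section Hit

lemma tm_aExt_continuous (hg : g.ZeroNoiseAssumption) : Continuous fun ξ => g.tm (g.aExt ξ) :=
  (tm_continuousOn hg).comp_continuous hg.aExt_continuous
    fun _ => nonneg_mem_Dom hg (hg.aExt_nonneg _)

lemma bA_continuous (hg : g.ZeroNoiseAssumption) : Continuous g.bA :=
  (tm_aExt_continuous hg).add (by fun_prop)

lemma bA_strictMono (hg : g.ZeroNoiseAssumption) : StrictMono g.bA := by
  intro ξ ζ h
  have h1 : g.tm (g.aExt ξ) ≤ g.tm (g.aExt ζ) :=
    (tm_strictMonoOn hg).monotoneOn (nonneg_mem_Dom hg (hg.aExt_nonneg _))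
      (nonneg_mem_Dom hg (hg.aExt_nonneg _)) (hg.aExt_mono h.le)
  exact add_lt_add_of_le_of_lt h1 (div_lt_div_of_pos_right h hg.etaMax_pos)

/-- The constant extension of `a` to negative arguments makes `bA` a bijection of the whole line, so
its inverse needs no domain conditions. -/
lemma bA_surjective (hg : g.ZeroNoiseAssumption) : Function.Surjective g.bA := by
  have hm := hg.etaMax_pos
  refine (bA_continuous hg).surjective ?_ ?_
  · refine tendsto_atTop_mono (fun ξ => ?_) (tendsto_id.atTop_div_const hm)
    exact le_add_of_nonneg_left (tm_nonneg hg (hg.aExt_nonneg _))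
  · have : Tendsto (fun ξ => g.tm (g.aExt 0) + ξ / g.etaMax) atBot atBot :=
      tendsto_atBot_add_const_left _ _ (tendsto_id.atBot_div_const hm)
    refine tendsto_atBot_mono' _ ?_ this
    filter_upwards [eventually_le_atBot 0] with ξ hξ
    refine add_le_add_left ?_ _
    exact (tm_strictMonoOn hg).monotoneOn (nonneg_mem_Dom hg (hg.aExt_nonneg _))
      (nonneg_mem_Dom hg (hg.aExt_nonneg _)) (hg.aExt_mono hξ)

lemma bA_Xi (hg : g.ZeroNoiseAssumption) (s : ℝ) : g.bA (g.Xi s) = s :=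
  Function.rightInverse_invFun (bA_surjective hg) s

lemma Xi_bA (hg : g.ZeroNoiseAssumption) (ξ : ℝ) : g.Xi (g.bA ξ) = ξ :=
  Function.leftInverse_invFun (bA_strictMono hg).injective ξ

/-- `bA` as an order isomorphism. -/
noncomputable def bAIso (hg : g.ZeroNoiseAssumption) : ℝ ≃o ℝ :=
  (bA_strictMono hg).orderIsoOfSurjective g.bA (bA_surjective hg)

lemma bAIso_symm (hg : g.ZeroNoiseAssumption) : ⇑(bAIso hg).symm = g.Xi := by
  ext s
  rw [OrderIso.symm_apply_eq]
  exact (bA_Xi hg s).symm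

lemma Xi_continuous (hg : g.ZeroNoiseAssumption) : Continuous g.Xi := by
  rw [← bAIso_symm hg]; exact (bAIso hg).symm.continuous

lemma Xi_strictMono (hg : g.ZeroNoiseAssumption) : StrictMono g.Xi := by
  rw [← bAIso_symm hg]; exact (bAIso hg).symm.strictMono

lemma lt_hit_iff (hg : g.ZeroNoiseAssumption) {r x ξ : ℝ} :
    ξ < g.hit r x ↔ g.bA ξ < g.tm x + r / g.etaMax := by
  rw [hit, ← (bA_strictMono hg).lt_iff_lt (b := g.Xi _), bA_Xi hg]

lemma lt_hit (hg : g.ZeroNoiseAssumption) {r x : ℝ} (hr : 0 ≤ r) (hx : g.a r < x) :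
    r < g.hit r x := by
  rw [lt_hit_iff hg, bA, aExt_of_nonneg hr]
  have ha := hg.a_nonneg hr
  have := (tm_lt_iff hg (nonneg_mem_Dom hg ha) (nonneg_mem_Dom hg (ha.trans hx.le))).2 hx
  linarith

lemma hit_pos (hg : g.ZeroNoiseAssumption) {r x : ℝ} (hr : 0 ≤ r) (hx : g.a r < x) :
    0 < g.hit r x := hr.trans_lt (lt_hit hg hr hx)

lemma bA_hit (hg : g.ZeroNoiseAssumption) (r x : ℝ) :
    g.tm (g.aExt (g.hit r x)) + g.hit r x / g.etaMax = g.tm x + r / g.etaMax := bA_Xi hg _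

/-- The sum of `tm` and R/η_max is conserved, so a rise in technology is paid for by a fall in
capacity. -/
lemma aExt_hit_lt (hg : g.ZeroNoiseAssumption) {r x : ℝ} (hx : 0 ≤ x) (h : r < g.hit r x) :
    g.aExt (g.hit r x) < x := by
  rw [← tm_lt_iff hg (nonneg_mem_Dom hg (hg.aExt_nonneg _)) (nonneg_mem_Dom hg hx)]
  have := bA_hit hg r x
  have := div_lt_div_of_pos_right h hg.etaMax_pos
  linarith

/-- The derivative of `bA`. -/
noncomputable def bA' (g : AbatementGame) (ξ : ℝ) : ℝ :=
  (g.etaMax - g.mu * g.a ξ)⁻¹ * deriv g.a ξ + g.etaMax⁻¹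

lemma bA'_pos (hg : g.ZeroNoiseAssumption) {ξ : ℝ} (hξ : 0 < ξ) : 0 < g.bA' ξ := by
  have h1 := inv_pos.2 (mem_Dom.1 (nonneg_mem_Dom hg (hg.a_pos hξ).le))
  exact add_pos_of_nonneg_of_pos (mul_nonneg h1.le (hg.deriv_a_nonneg hξ)) (inv_pos.2 hg.etaMax_pos)

lemma bA_hasDerivAt (hg : g.ZeroNoiseAssumption) {ξ : ℝ} (hξ : 0 < ξ) :
    HasDerivAt g.bA (g.bA' ξ) ξ := by
  have h1 := (tm_hasDerivAt hg (nonneg_mem_Dom hg (hg.aExt_nonneg ξ))).comp ξ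
    (hg.aExt_hasDerivAt hξ)
  refine (h1.add ((hasDerivAt_id' ξ).div_const g.etaMax)).congr_deriv ?_
  rw [aExt_of_nonneg hξ.le, bA', one_div]

lemma bA_contDiffAt (hg : g.ZeroNoiseAssumption) {ξ : ℝ} (hξ : 0 < ξ) : ContDiffAt ℝ 1 g.bA ξ :=
  ((tm_contDiffAt hg (nonneg_mem_Dom hg (hg.aExt_nonneg ξ))).comp ξ
    (hg.aExt_contDiffAt hξ)).add (by fun_prop)

lemma Xi_hasDerivAt (hg : g.ZeroNoiseAssumption) {s : ℝ} (hs : 0 < g.Xi s) :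
    HasDerivAt g.Xi (g.bA' (g.Xi s))⁻¹ s :=
  HasDerivAt.of_local_left_inverse (Xi_continuous hg).continuousAt (bA_hasDerivAt hg hs)
    (bA'_pos hg hs).ne' (Eventually.of_forall (bA_Xi hg))

lemma Xi_contDiffAt (hg : g.ZeroNoiseAssumption) {s : ℝ} (hs : 0 < g.Xi s) :
    ContDiffAt ℝ 1 g.Xi s := by
  have := (bAIso hg).toHomeomorph.toOpenPartialHomeomorph.contDiffAt_symm_deriv (n := 1) (a := s)
    (f₀' := g.bA' (g.Xi s)) (bA'_pos hg hs).ne' (mem_univ _)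
    (by
      change HasDerivAt g.bA _ ((bAIso hg).symm s)
      rw [bAIso_symm]; exact bA_hasDerivAt hg hs)
    (by
      change ContDiffAt ℝ 1 g.bA ((bAIso hg).symm s)
      rw [bAIso_symm]; exact bA_contDiffAt hg hs)
  change ContDiffAt ℝ 1 (bAIso hg).symm s at this
  rwa [bAIso_symm] at this

end Hit

end AbatementGame

/-! ### Payoff and gain along the boundary `a` -/

namespace AbatementGame

variable {g : AbatementGame}

section Boundary

lemma kappa_mul (hg : g.ZeroNoiseAssumption) (t : ℝ) : g.kappa * (g.etaMax * t) = g.rhoBar * t := by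
  have := hg.etaMax_pos.ne'
  rw [kappa]; field_simp

lemma piA_continuous (hg : g.ZeroNoiseAssumption) : Continuous g.piA :=
  hg.piExt_continuous.comp hg.aExt_continuous

lemma piA_nonneg (hg : g.ZeroNoiseAssumption) (v : ℝ) : 0 ≤ g.piA v := hg.piExt_nonneg _

lemma piA_lt (hg : g.ZeroNoiseAssumption) {v w : ℝ} (hv : 0 ≤ v) (hvw : v < w) :
    g.piA v < g.piA w :=
  hg.piExt_aExt_strictMonoOn (mem_Ici.2 hv) (mem_Ici.2 (hv.trans hvw.le)) hvw

lemma piA_hasDerivAt (hg : g.ZeroNoiseAssumption) {v : ℝ} (hv : 0 < v) :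
    HasDerivAt g.piA (deriv g.profitF (g.a v) * deriv g.a v) v := by
  have h1 := hg.aExt_hasDerivAt hv
  have h2 := hg.piExt_hasDerivAt (hg.a_pos hv)
  rw [← aExt_of_nonneg hv.le] at h2 ⊢
  exact h2.comp v h1

lemma piA_discounted_continuous (hg : g.ZeroNoiseAssumption) :
    Continuous fun v => Real.exp (-g.kappa * v) * g.piA v := by
  have := piA_continuous hg
  fun_prop

lemma integrable_piA (hg : g.ZeroNoiseAssumption) :
    IntegrableOn (fun v => Real.exp (-g.kappa * v) * g.piA v) (Ioi 0) := by
  have hm := hg.etaMax_pos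
  rw [show (0 : ℝ) = g.etaMax * 0 by simp, ← integrableOn_Ioi_comp_mul_left_iff _ _ hm]
  refine hg.profitF_integrable.congr_fun (fun t ht => ?_) measurableSet_Ioi
  have ht0 : 0 ≤ g.etaMax * t := mul_nonneg hm.le (le_of_lt ht)
  simp only
  rw [piA, aExt_of_nonneg ht0, piExt_of_nonneg (hg.a_nonneg ht0), neg_mul, neg_mul,
    kappa_mul hg]

lemma P0_hasDerivAt (hg : g.ZeroNoiseAssumption) (ξ : ℝ) :
    HasDerivAt g.P0 (-(g.etaMax⁻¹ * (Real.exp (-g.kappa * ξ) * g.piA ξ))) ξ := by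
  have hc := piA_discounted_continuous hg
  have h1 := ((intervalIntegral.integral_hasDerivAt_right (hc.intervalIntegrable 0 ξ)
    (hc.stronglyMeasurableAtFilter volume _) hc.continuousAt).const_sub
    (∫ v in Ioi 0, Real.exp (-g.kappa * v) * g.piA v)).const_mul g.etaMax⁻¹
  exact h1.congr_deriv (by ring)

lemma P0_continuous (hg : g.ZeroNoiseAssumption) : Continuous g.P0 :=
  continuous_iff_continuousAt.2 fun ξ => (P0_hasDerivAt hg ξ).continuousAt

lemma P0_contDiff (hg : g.ZeroNoiseAssumption) (ξ : ℝ) : ContDiffAt ℝ 1 g.P0 ξ :=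
  contDiffAt_one_of_hasDerivAt isOpen_univ (mem_univ ξ) (fun ξ _ => P0_hasDerivAt hg ξ)
    ((piA_discounted_continuous hg).const_mul _).neg.continuousOn

lemma P0_eq (hg : g.ZeroNoiseAssumption) {ξ : ℝ} (hξ : 0 ≤ ξ) :
    g.P0 ξ = g.etaMax⁻¹ * ∫ v in Ioi ξ, Real.exp (-g.kappa * v) * g.piA v := by
  have h := intervalIntegral.integral_Ioi_sub_Ioi (integrable_piA hg)  hξ
  rw [P0, ← h, sub_sub_cancel]

lemma P0_tendsto (hg : g.ZeroNoiseAssumption) : Tendsto g.P0 atTop (𝓝 0) := by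
  have h := intervalIntegral_tendsto_integral_Ioi 0 (integrable_piA hg) tendsto_id
  have := (h.const_sub (∫ v in Ioi 0, Real.exp (-g.kappa * v) * g.piA v)).const_mul g.etaMax⁻¹
  rw [sub_self, mul_zero] at this
  exact this

lemma boundary_discount (hg : g.ZeroNoiseAssumption) (r t : ℝ) :
    Real.exp (-g.rhoBar * t) * g.piA (r + g.etaMax * t)
      = Real.exp (g.kappa * r) *
        (Real.exp (-g.kappa * (r + g.etaMax * t)) * g.piA (r + g.etaMax * t)) := by
  rw [← mul_assoc, ← Real.exp_add]
  congr 2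
  rw [mul_add, neg_mul _ (g.etaMax * t), kappa_mul hg]; ring

lemma integrable_boundary (hg : g.ZeroNoiseAssumption) {r : ℝ} (hr : 0 ≤ r) :
    IntegrableOn (fun t => Real.exp (-g.rhoBar * t) * g.piA (r + g.etaMax * t)) (Ioi 0) := by
  refine IntegrableOn.discounted_shift hg.etaMax_pos hr (c := g.rhoBar) (f := g.piA) ?_
  refine hg.profitF_integrable.congr_fun (fun t ht => ?_) measurableSet_Ioi
  have ht0 : 0 ≤ g.etaMax * t := mul_nonneg hg.etaMax_pos.le (le_of_lt ht)
  simp only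
  rw [piA, aExt_of_nonneg ht0, piExt_of_nonneg (hg.a_nonneg ht0)]

/-- The payoff of the firm along the boundary. -/
lemma integral_boundary (hg : g.ZeroNoiseAssumption) {r S : ℝ} (h : 0 ≤ r + g.etaMax * S) :
    ∫ t in Ioi S, Real.exp (-g.rhoBar * t) * g.piA (r + g.etaMax * t)
      = Real.exp (g.kappa * r) * g.P0 (r + g.etaMax * S) := by
  simp_rw [boundary_discount hg]
  rw [integral_const_mul, P0_eq hg h,
    integral_comp_mul_left_Ioi (fun u => Real.exp (-g.kappa * (r + u)) * g.piA (r + u)) S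
      hg.etaMax_pos, smul_eq_mul]
  congr 2
  have := (measurePreserving_add_left volume r).setIntegral_preimage_emb
    (measurableEmbedding_addLeft r) (fun v => Real.exp (-g.kappa * v) * g.piA v)
    (Ioi (r + g.etaMax * S))
  rw [← this]
  congr 2
  ext u; simp

lemma integral_exp_one (hg : g.ZeroNoiseAssumption) :
    ∫ t in Ioi 0, g.rhoBar * Real.exp (-g.rhoBar * t) = 1 := by
  have h := hg.rhoBar_pos
  rw [integral_const_mul, integral_exp_mul_Ioi (neg_neg_of_pos h)]
  simp; field_simp

lemma integrable_gain (hg : g.ZeroNoiseAssumption) {ξ : ℝ} (hξ : 0 ≤ ξ) :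
    IntegrableOn (fun t => g.rhoBar * Real.exp (-g.rhoBar * t)
      * (g.piA (ξ + g.etaMax * t) - g.piA ξ)) (Ioi 0) := by
  have h1 := (integrable_boundary hg hξ).const_mul g.rhoBar
  have h2 : IntegrableOn (fun t => g.rhoBar * g.piA ξ * Real.exp (-g.rhoBar * t)) (Ioi 0) :=
    (integrableOn_exp_mul_Ioi (neg_neg_of_pos hg.rhoBar_pos) 0).const_mul _
  refine IntegrableOn.congr_fun (h1.sub h2) (fun t _ => ?_) measurableSet_Ioi
  simp only [Pi.sub_apply]; ring

lemma exp_mul_P1 (hg : g.ZeroNoiseAssumption) {ξ : ℝ} (hξ : 0 ≤ ξ) :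
    Real.exp (g.kappa * ξ) * g.P1 ξ = ∫ t in Ioi 0, g.rhoBar * Real.exp (-g.rhoBar * t)
      * (g.piA (ξ + g.etaMax * t) - g.piA ξ) := by
  have h1 := (integrable_boundary hg hξ).const_mul g.rhoBar
  have h2 : IntegrableOn (fun t => g.piA ξ * (g.rhoBar * Real.exp (-g.rhoBar * t))) (Ioi 0) :=
    ((integrableOn_exp_mul_Ioi (neg_neg_of_pos hg.rhoBar_pos) 0).const_mul _).const_mul _
  have h3 := integral_sub h1 h2
  rw [integral_const_mul, integral_const_mul (g.piA ξ), integral_exp_one hg,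
    integral_boundary hg (S := 0) (by simpa using hξ)] at h3
  have e : Real.exp (g.kappa * ξ) * Real.exp (-g.kappa * ξ) = 1 := by
    rw [← Real.exp_add]; simp
  rw [P1]
  calc _ = g.rhoBar * (Real.exp (g.kappa * ξ) * g.P0 (ξ + g.etaMax * 0)) - g.piA ξ * 1 := by
        rw [mul_zero, add_zero]; linear_combination -g.piA ξ * e
    _ = _ := by
        rw [← h3]
        refine setIntegral_congr_fun measurableSet_Ioi fun t _ => ?_
        ring

/-- Up to a positive factor this is a discounted average of the increments of π ∘ a, which are
positive. -/
lemma P1_pos (hg : g.ZeroNoiseAssumption) {ξ : ℝ} (hξ : 0 ≤ ξ) : 0 < g.P1 ξ := by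
  have hpos : ∀ t ∈ Ioi (0 : ℝ), 0 < g.rhoBar * Real.exp (-g.rhoBar * t)
      * (g.piA (ξ + g.etaMax * t) - g.piA ξ) := fun t ht =>
    mul_pos (mul_pos hg.rhoBar_pos (Real.exp_pos _)) (sub_pos.2 (piA_lt hg hξ
      (lt_add_of_pos_right _ (mul_pos hg.etaMax_pos ht))))
  have h : 0 < Real.exp (g.kappa * ξ) * g.P1 ξ := by
    rw [exp_mul_P1 hg hξ, setIntegral_pos_iff_support_of_nonneg_ae
      (ae_restrict_of_forall_mem measurableSet_Ioi fun t ht => (hpos t ht).le)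
      (integrable_gain hg hξ)]
    have hsub : Ioi (0 : ℝ) ⊆ Function.support fun t => g.rhoBar * Real.exp (-g.rhoBar * t)
        * (g.piA (ξ + g.etaMax * t) - g.piA ξ) := fun t ht => (hpos t ht).ne'
    rw [inter_eq_right.2 hsub]
    simp
  exact pos_of_mul_pos_right h (Real.exp_pos _).le

lemma P1_tendsto (hg : g.ZeroNoiseAssumption) : Tendsto g.P1 atTop (𝓝 0) := by
  have h := (P0_tendsto hg).const_mul g.rhoBar
  rw [mul_zero] at h
  refine tendsto_of_tendsto_of_tendsto_of_le_of_le' tendsto_const_nhds h ?_ ?_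
  · filter_upwards [eventually_ge_atTop 0] with ξ hξ using (P1_pos hg hξ).le
  · refine Eventually.of_forall fun ξ => ?_
    exact sub_le_self _ (mul_nonneg (Real.exp_pos _).le (piA_nonneg hg ξ))

/-- Since κ = ρ̄/η_max, the derivative of ρ̄ P0 cancels the term from the exponential, and only the
derivative of π ∘ a is left. -/
lemma P1_hasDerivAt (hg : g.ZeroNoiseAssumption) {ξ : ℝ} (hξ : 0 < ξ) :
    HasDerivAt g.P1 (-(Real.exp (-g.kappa * ξ) * (deriv g.profitF (g.a ξ) * deriv g.a ξ))) ξ := by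
  have h1 := ((P0_hasDerivAt hg ξ).const_mul g.rhoBar).sub
    ((((hasDerivAt_id' ξ).const_mul (-g.kappa)).exp).mul (piA_hasDerivAt hg hξ))
  refine h1.congr_deriv ?_
  rw [kappa]; ring

lemma P1_continuous (hg : g.ZeroNoiseAssumption) : Continuous g.P1 := by
  have h1 := P0_continuous hg
  have h2 := piA_discounted_continuous hg
  exact (h1.const_mul _).sub h2

lemma P1_contDiffAt (hg : g.ZeroNoiseAssumption) {ξ : ℝ} (hξ : 0 < ξ) : ContDiffAt ℝ 1 g.P1 ξ := by
  have h1 := P0_contDiff hg ξ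
  have h2 : ContDiffAt ℝ 1 g.piA ξ :=
    (hg.piExt_contDiffAt (by rw [aExt_of_nonneg hξ.le]; exact hg.a_pos hξ)).comp ξ
      (hg.aExt_contDiffAt hξ)
  have h3 : ContDiffAt ℝ 1 (fun ξ => Real.exp (-g.kappa * ξ)) ξ := by fun_prop
  exact (contDiffAt_const.mul h1).sub (h3.mul h2)

/-- For a strictly negative growth rate, the undiscounted gain increases along the boundary. -/
lemma exp_mul_P1_mono (hg : g.ZeroNoiseAssumption) (hmu : g.mu < 0) {ξ ζ : ℝ} (hξ : 0 ≤ ξ)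
    (h : ξ ≤ ζ) : Real.exp (g.kappa * ξ) * g.P1 ξ ≤ Real.exp (g.kappa * ζ) * g.P1 ζ := by
  rw [exp_mul_P1 hg hξ, exp_mul_P1 hg (hξ.trans h)]
  refine setIntegral_mono_on (integrable_gain hg hξ) (integrable_gain hg (hξ.trans h))
    measurableSet_Ioi fun t ht => ?_
  refine mul_le_mul_of_nonneg_left ?_ (mul_pos hg.rhoBar_pos (Real.exp_pos _)).le
  have hs : 0 < g.etaMax * t := mul_pos hg.etaMax_pos ht
  have hc := piA_continuous hg
  -- The third assumption says that the derivative of π ∘ a is nondecreasing, so increments over a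
  -- step of fixed length increase with the starting level.
  have hmono : MonotoneOn (fun ξ => g.piA (ξ + g.etaMax * t) - g.piA ξ) (Ici 0) := by
    have hd : ∀ ξ ∈ interior (Ici (0 : ℝ)), HasDerivAt
        (fun ξ => g.piA (ξ + g.etaMax * t) - g.piA ξ)
        (deriv g.profitF (g.a (ξ + g.etaMax * t)) * deriv g.a (ξ + g.etaMax * t)
          - deriv g.profitF (g.a ξ) * deriv g.a ξ) ξ := by
      intro ξ hξ
      rw [interior_Ici, mem_Ioi] at hξ
      exact ((piA_hasDerivAt hg (add_pos hξ hs)).comp_add_const ξ _).sub (piA_hasDerivAt hg hξ)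
    refine monotoneOn_of_deriv_nonneg (convex_Ici 0) (by fun_prop)
      (fun ξ hξ => (hd ξ hξ).differentiableAt.differentiableWithinAt) fun ξ hξ => ?_
    rw [(hd ξ hξ).deriv, sub_nonneg]
    rw [interior_Ici, mem_Ioi] at hξ
    exact hg.deriv_comp_mono hmu hξ (add_pos hξ hs) (le_add_of_nonneg_right hs.le)
  exact hmono (mem_Ici.2 hξ) (mem_Ici.2 (hξ.trans h)) h

end Boundary

/-! ### Primitives along the flow and two-sided bounds from the monotonicity of π' -/

section Primitive

lemma Q0_integrand_continuousOn (hg : g.ZeroNoiseAssumption) : ContinuousOn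
    (fun z => Real.exp (g.rhoBar * g.tm z) * g.piExt z * (g.etaMax - g.mu * z)⁻¹) g.Dom := by
  have h1 := tm_continuousOn hg
  have h2 := hg.piExt_continuous.continuousOn (s := g.Dom)
  have h3 := Dom_inv_continuousOn (g := g)
  fun_prop

lemma Q0_hasDerivAt (hg : g.ZeroNoiseAssumption) {y : ℝ} (hy : y ∈ g.Dom) :
    HasDerivAt g.Q0 (Real.exp (g.rhoBar * g.tm y) * g.piExt y * (g.etaMax - g.mu * y)⁻¹) y :=
  hasDerivAt_primitive_of_continuousOn Dom_isOpen Dom_ordConnected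
    (nonneg_mem_Dom hg le_rfl) (Q0_integrand_continuousOn hg) hy

lemma Q0_continuousOn (hg : g.ZeroNoiseAssumption) : ContinuousOn g.Q0 g.Dom := fun _ hy =>
  (Q0_hasDerivAt hg hy).continuousAt.continuousWithinAt

lemma Q0_contDiffAt (hg : g.ZeroNoiseAssumption) {y : ℝ} (hy : y ∈ g.Dom) :
    ContDiffAt ℝ 1 g.Q0 y :=
  contDiffAt_one_of_hasDerivAt Dom_isOpen hy (fun _ h => Q0_hasDerivAt hg h)
    (Q0_integrand_continuousOn hg)

lemma Nf_continuousOn (hg : g.ZeroNoiseAssumption) : ContinuousOn g.Nf g.Dom := by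
  have h1 := tm_continuousOn hg
  have h2 := hg.piExt_continuous.continuousOn (s := g.Dom)
  have h3 := Q0_continuousOn hg
  unfold Nf
  fun_prop

lemma Nf_hasDerivAt (hg : g.ZeroNoiseAssumption) {y : ℝ} (hy : 0 < y) :
    HasDerivAt g.Nf (Real.exp (g.rhoBar * g.tm y) * deriv g.profitF y) y := by
  have hD := nonneg_mem_Dom hg hy.le
  have h1 := (((tm_hasDerivAt hg hD).const_mul g.rhoBar).exp.mul (hg.piExt_hasDerivAt hy)).sub
    ((Q0_hasDerivAt hg hD).const_mul g.rhoBar)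
  refine h1.congr_deriv ?_
  ring

lemma Nf_contDiffAt (hg : g.ZeroNoiseAssumption) {y : ℝ} (hy : 0 < y) :
    ContDiffAt ℝ 1 g.Nf y := by
  have hD := nonneg_mem_Dom hg hy.le
  have h1 : ContDiffAt ℝ 1 (fun y => Real.exp (g.rhoBar * g.tm y)) y :=
    (contDiffAt_const.mul (tm_contDiffAt hg hD)).exp
  exact (h1.mul (hg.piExt_contDiffAt hy)).sub (contDiffAt_const.mul (Q0_contDiffAt hg hD))

lemma Nf_strictMonoOn (hg : g.ZeroNoiseAssumption) : StrictMonoOn g.Nf (Ici 0) := by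
  refine strictMonoOn_of_deriv_pos (convex_Ici 0)
    ((Nf_continuousOn hg).mono fun y hy => nonneg_mem_Dom hg hy) fun y hy => ?_
  rw [interior_Ici, mem_Ioi] at hy
  rw [(Nf_hasDerivAt hg hy).deriv]
  exact mul_pos (Real.exp_pos _) (hg.deriv_profitF_pos hy)

/-- The discount rate `q = ρ̄ - μ` in the estimates for `h`. -/
lemma rate_pos (hg : g.ZeroNoiseAssumption) : 0 < g.rhoBar - g.mu := by
  have := hg.rhoBar_pos; have := hg.mu_nonpos; linarith

/-- By `exp_tm`, the derivative of η_max e^{(ρ̄-μ) tm} is (ρ̄-μ) e^{ρ̄ tm}, the weight that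
multiplies π' in the derivative of `Nf`, up to ρ̄ - μ. An affine π would make `Nf` an affine
function of this exponential. -/
lemma exp_rate_tm (hg : g.ZeroNoiseAssumption) {y : ℝ} (hy : y ∈ g.Dom) :
    g.etaMax * Real.exp ((g.rhoBar - g.mu) * g.tm y) * (g.etaMax - g.mu * y)⁻¹
      = Real.exp (g.rhoBar * g.tm y) := by
  have h1 := exp_tm hg hy
  have h2 := (mem_Dom.1 hy).ne'
  have h3 : Real.exp (g.rhoBar * g.tm y)
      = Real.exp ((g.rhoBar - g.mu) * g.tm y) * Real.exp (g.mu * g.tm y) := by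
    rw [← Real.exp_add]; ring_nf
  rw [h3]
  have h4 : (g.etaMax - g.mu * y) * (g.etaMax - g.mu * y)⁻¹ = 1 := mul_inv_cancel₀ h2
  linear_combination (Real.exp (g.mu * g.tm y) * Real.exp ((g.rhoBar - g.mu) * g.tm y)) * h4
    - Real.exp ((g.rhoBar - g.mu) * g.tm y) * (g.etaMax - g.mu * y)⁻¹ * h1

lemma Nf_sub_exp_hasDerivAt (hg : g.ZeroNoiseAssumption) (c : ℝ) {y : ℝ} (hy : 0 < y) :
    HasDerivAt (fun y => (g.rhoBar - g.mu) * g.Nf y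
        - c * g.etaMax * Real.exp ((g.rhoBar - g.mu) * g.tm y))
      ((g.rhoBar - g.mu) * Real.exp (g.rhoBar * g.tm y) * (deriv g.profitF y - c)) y := by
  have hD := nonneg_mem_Dom hg hy.le
  have h1 := ((Nf_hasDerivAt hg hy).const_mul (g.rhoBar - g.mu)).sub
    ((((tm_hasDerivAt hg hD).const_mul (g.rhoBar - g.mu)).exp).const_mul (c * g.etaMax))
  refine h1.congr_deriv ?_
  linear_combination -(g.rhoBar - g.mu) * c * exp_rate_tm hg hD

/-- On [y, x] one has π' ≤ π'(x); replacing π' by this constant makes the weighted integral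
explicit. The companion `le_Nf_sub` uses π' ≥ π'(y). -/
lemma Nf_sub_le (hg : g.ZeroNoiseAssumption) {y x : ℝ} (hy : 0 < y) (hyx : y ≤ x) :
    (g.rhoBar - g.mu) * (g.Nf x - g.Nf y) ≤ deriv g.profitF x * g.etaMax *
      (Real.exp ((g.rhoBar - g.mu) * g.tm x) - Real.exp ((g.rhoBar - g.mu) * g.tm y)) := by
  have hpos : ∀ z ∈ Icc y x, 0 < z := fun z hz => hy.trans_le hz.1
  have hanti : AntitoneOn (fun z => (g.rhoBar - g.mu) * g.Nf z
      - deriv g.profitF x * g.etaMax * Real.exp ((g.rhoBar - g.mu) * g.tm z)) (Icc y x) := by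
    refine antitoneOn_of_deriv_nonpos (convex_Icc y x)
      (fun z hz => (Nf_sub_exp_hasDerivAt hg _ (hpos z hz)).continuousAt.continuousWithinAt)
      (fun z hz => (Nf_sub_exp_hasDerivAt hg _
        (hpos z (interior_subset hz))).differentiableAt.differentiableWithinAt) fun z hz => ?_
    have hz' := interior_subset hz
    rw [(Nf_sub_exp_hasDerivAt hg _ (hpos z hz')).deriv]
    exact mul_nonpos_of_nonneg_of_nonpos (mul_pos (rate_pos hg) (Real.exp_pos _)).le
      (sub_nonpos.2 (hg.profitF_deriv_mono (hpos z hz') (hy.trans_le hyx) hz'.2))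
  have := hanti (left_mem_Icc.2 hyx) (right_mem_Icc.2 hyx) hyx
  simp only at this
  linarith

lemma le_Nf_sub (hg : g.ZeroNoiseAssumption) {y x : ℝ} (hy : 0 < y) (hyx : y ≤ x) :
    deriv g.profitF y * g.etaMax *
      (Real.exp ((g.rhoBar - g.mu) * g.tm x) - Real.exp ((g.rhoBar - g.mu) * g.tm y))
      ≤ (g.rhoBar - g.mu) * (g.Nf x - g.Nf y) := by
  have hpos : ∀ z ∈ Icc y x, 0 < z := fun z hz => hy.trans_le hz.1
  have hmono : MonotoneOn (fun z => (g.rhoBar - g.mu) * g.Nf z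
      - deriv g.profitF y * g.etaMax * Real.exp ((g.rhoBar - g.mu) * g.tm z)) (Icc y x) := by
    refine monotoneOn_of_deriv_nonneg (convex_Icc y x)
      (fun z hz => (Nf_sub_exp_hasDerivAt hg _ (hpos z hz)).continuousAt.continuousWithinAt)
      (fun z hz => (Nf_sub_exp_hasDerivAt hg _
        (hpos z (interior_subset hz))).differentiableAt.differentiableWithinAt) fun z hz => ?_
    have hz' := interior_subset hz
    rw [(Nf_sub_exp_hasDerivAt hg _ (hpos z hz')).deriv]
    exact mul_nonneg (mul_pos (rate_pos hg) (Real.exp_pos _)).le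
      (sub_nonneg.2 (hg.profitF_deriv_mono hy (hpos z hz') hz'.1))
  have := hmono (left_mem_Icc.2 hyx) (right_mem_Icc.2 hyx) hyx
  simp only at this
  linarith

end Primitive

end AbatementGame

/-! ### The closed form of the payoff and its derivatives -/

namespace AbatementGame

variable {g : AbatementGame}

section Value

/-- The part of the payoff that is constant along the flow under maximal abatement. -/
noncomputable def Theta (g : AbatementGame) (s : ℝ) : ℝ :=
  Real.exp (g.rhoBar * s) * g.P0 (g.Xi s) - g.Q0 (g.aExt (g.Xi s))

/-- The defining relation of `Xi` in exponential form: discounting by time up to the hit equals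
discounting by technology there. -/
lemma exp_bA (hg : g.ZeroNoiseAssumption) (s : ℝ) :
    Real.exp (g.rhoBar * s) * Real.exp (-g.kappa * g.Xi s)
      = Real.exp (g.rhoBar * g.tm (g.aExt (g.Xi s))) := by
  have h := bA_Xi hg s
  rw [bA] at h
  rw [← Real.exp_add]
  congr 1
  have hm := hg.etaMax_pos.ne'
  nth_rewrite 1 [← h]
  rw [kappa]; field_simp; ring

/-- The contributions of the moving hitting point combine to π(a(ξ)) times bA'(ξ) Ξ' = 1, so neither
a' nor Ξ' appears in the result. -/
lemma Theta_hasDerivAt (hg : g.ZeroNoiseAssumption) {s : ℝ} (hs : 0 < g.Xi s) :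
    HasDerivAt g.Theta (Real.exp (g.rhoBar * s) * g.P1 (g.Xi s)) s := by
  have hX := Xi_hasDerivAt hg hs
  have hD := nonneg_mem_Dom hg (hg.aExt_nonneg (g.Xi s))
  have h1 := (((hasDerivAt_id' s).const_mul g.rhoBar).exp.mul
    ((P0_hasDerivAt hg (g.Xi s)).comp s hX)).sub
    ((Q0_hasDerivAt hg hD).comp s ((hg.aExt_hasDerivAt hs).comp s hX))
  refine h1.congr_deriv ?_
  have e := exp_bA hg s
  have hb := (bA'_pos hg hs).ne'
  have hb' : ((g.etaMax - g.mu * g.aExt (g.Xi s))⁻¹ * deriv g.a (g.Xi s) + g.etaMax⁻¹)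
      * (g.bA' (g.Xi s))⁻¹ = 1 := by
    rw [aExt_of_nonneg hs.le]; exact mul_inv_cancel₀ hb
  simp only [P1, piA, Function.comp]
  rw [← e]
  linear_combination -(Real.exp (g.rhoBar * s) * Real.exp (-g.kappa * g.Xi s)
    * g.piExt (g.aExt (g.Xi s))) * hb'

lemma exp_kappa (hg : g.ZeroNoiseAssumption) (r x : ℝ) :
    Real.exp (-g.rhoBar * g.tm x) * Real.exp (g.rhoBar * (g.tm x + r / g.etaMax))
      = Real.exp (g.kappa * r) := by
  have hm := hg.etaMax_pos.ne'
  rw [← Real.exp_add, kappa]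
  congr 1
  field_simp; ring

/-- Here the hitting level enters only through the invariant s = tm x + r/η_max, and differentiating
W becomes a one-variable matter. -/
lemma W_eq_Theta (hg : g.ZeroNoiseAssumption) (r x : ℝ) :
    g.W r x = Real.exp (-g.rhoBar * g.tm x) * (g.Q0 x + g.Theta (g.tm x + r / g.etaMax)) := by
  rw [W, Theta, ← exp_kappa hg r x, hit]; ring

lemma hasFDerivAt_slope (hg : g.ZeroNoiseAssumption) {r x : ℝ} (hx : x ∈ g.Dom) :
    HasFDerivAt (fun p : ℝ × ℝ => g.tm p.2 + p.1 / g.etaMax)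
      ((g.etaMax - g.mu * x)⁻¹ • ContinuousLinearMap.snd ℝ ℝ ℝ
        + g.etaMax⁻¹ • ContinuousLinearMap.fst ℝ ℝ ℝ) (r, x) := by
  have h0 : HasFDerivAt (fun p : ℝ × ℝ => p.2) (ContinuousLinearMap.snd ℝ ℝ ℝ) (r, x) :=
    hasFDerivAt_snd
  have h1 := (tm_hasDerivAt hg hx).comp_hasFDerivAt (f := fun p : ℝ × ℝ => p.2) (r, x) h0
  have h2 : HasFDerivAt (fun p : ℝ × ℝ => p.1) (ContinuousLinearMap.fst ℝ ℝ ℝ) (r, x) :=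
    hasFDerivAt_fst
  refine (h1.add (h2.const_mul g.etaMax⁻¹)).congr_of_eventuallyEq
    (Eventually.of_forall fun p => ?_)
  simp only [Function.comp, Pi.add_apply]
  rw [div_eq_inv_mul]

lemma W_hasFDerivAt (hg : g.ZeroNoiseAssumption) {r x : ℝ} (hx : x ∈ g.Dom)
    (h : 0 < g.hit r x) :
    HasFDerivAt (fun p : ℝ × ℝ => g.W p.1 p.2)
      (g.Wr r x • ContinuousLinearMap.fst ℝ ℝ ℝ + g.Wx r x • ContinuousLinearMap.snd ℝ ℝ ℝ)
      (r, x) := by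
  have h2 : HasFDerivAt (fun p : ℝ × ℝ => p.2) (ContinuousLinearMap.snd ℝ ℝ ℝ) (r, x) :=
    hasFDerivAt_snd
  have hE := (((tm_hasDerivAt hg hx).const_mul (-g.rhoBar)).exp).comp_hasFDerivAt
    (f := fun p : ℝ × ℝ => p.2) (r, x) h2
  have hQ := (Q0_hasDerivAt hg hx).comp_hasFDerivAt (f := fun p : ℝ × ℝ => p.2) (r, x) h2
  have hT := (Theta_hasDerivAt hg h).comp_hasFDerivAt (r, x) (hasFDerivAt_slope hg hx)
  have hW := (hE.mul (hQ.add hT)).congr_of_eventuallyEq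
    (f₁ := fun p : ℝ × ℝ => g.W p.1 p.2) (Eventually.of_forall fun p => W_eq_Theta hg p.1 p.2)
  refine hW.congr_fderiv ?_
  have e1 := exp_kappa hg r x
  have e2 := exp_bA hg (g.tm x + r / g.etaMax)
  have e3 : Real.exp (-g.rhoBar * g.tm x) * Real.exp (g.rhoBar * g.tm x) = 1 := by
    rw [← Real.exp_add]; simp
  refine ContinuousLinearMap.ext fun v => ?_
  simp only [_root_.add_apply, _root_.smul_apply, smul_eq_mul,
    ContinuousLinearMap.coe_fst', ContinuousLinearMap.coe_snd', Function.comp, Wr, Wx, Nf, Theta,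
    P1, Pi.add_apply]
  rw [← e1, hit, ← e2]
  simp only [piA]
  ring

lemma W_hasDerivAt (hg : g.ZeroNoiseAssumption) {r x : ℝ} (hx : x ∈ g.Dom)
    (h : 0 < g.hit r x) : HasDerivAt (fun y => g.W r y) (g.Wx r x) x := by
  have := (W_hasFDerivAt hg hx h).comp_hasDerivAt x
    ((hasDerivAt_const x r).prodMk (hasDerivAt_id' x))
  simpa [Function.comp_def] using this

lemma W_hasDerivAt_fst (hg : g.ZeroNoiseAssumption) {r x : ℝ} (hx : x ∈ g.Dom)
    (h : 0 < g.hit r x) : HasDerivAt (fun s => g.W s x) (g.Wr r x) r := by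
  have := (W_hasFDerivAt hg hx h).comp_hasDerivAt r
    ((hasDerivAt_id' r).prodMk (hasDerivAt_const r x))
  simpa [Function.comp_def] using this

lemma exp_rate_tm_neg (hg : g.ZeroNoiseAssumption) {x : ℝ} (hx : x ∈ g.Dom) :
    Real.exp (-(g.rhoBar - g.mu) * g.tm x)
      = g.etaMax * ((g.etaMax - g.mu * x)⁻¹ * Real.exp (-g.rhoBar * g.tm x)) := by
  have h1 := exp_tm hg hx
  have h2 := (mem_Dom.1 hx).ne'
  have h3 : Real.exp (-(g.rhoBar - g.mu) * g.tm x)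
      = Real.exp (g.mu * g.tm x) * Real.exp (-g.rhoBar * g.tm x) := by
    rw [← Real.exp_add]; ring_nf
  rw [h3]
  have h4 : (g.etaMax - g.mu * x) * (g.etaMax - g.mu * x)⁻¹ = 1 := mul_inv_cancel₀ h2
  linear_combination -(Real.exp (g.mu * g.tm x) * Real.exp (-g.rhoBar * g.tm x)) * h4
    + (g.etaMax - g.mu * x)⁻¹ * Real.exp (-g.rhoBar * g.tm x) * h1

/-- This form enters the verification through the coefficient W_r - W_x of abatement. Its equality
with the form in `hh_eq` is the differential equation satisfied by W under maximal abatement. -/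
lemma hh_eq_sub (hg : g.ZeroNoiseAssumption) (r : ℝ) {x : ℝ} (hx : x ∈ g.Dom) :
    g.hh r x = g.etaMax * (g.Wx r x - g.Wr r x) := by
  have hm : g.etaMax * g.etaMax⁻¹ = 1 := mul_inv_cancel₀ hg.etaMax_pos.ne'
  rw [hh, exp_rate_tm_neg hg hx, Wx, Wr]
  linear_combination Real.exp (g.kappa * r) * g.P1 (g.hit r x) * hm

lemma hh_eq (hg : g.ZeroNoiseAssumption) (r : ℝ) {x : ℝ} (hx : x ∈ g.Dom) :
    g.hh r x = g.mu * x * g.Wx r x - g.rhoBar * g.W r x + g.piExt x := by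
  have h2 : (g.etaMax - g.mu * x) * (g.etaMax - g.mu * x)⁻¹ = 1 :=
    mul_inv_cancel₀ (mem_Dom.1 hx).ne'
  have e1 := exp_kappa hg r x
  have e2 := exp_bA hg (g.tm x + r / g.etaMax)
  have e3 : Real.exp (-g.rhoBar * g.tm x) * Real.exp (g.rhoBar * g.tm x) = 1 := by
    rw [← Real.exp_add]; simp
  rw [hh, exp_rate_tm_neg hg hx, Wx, W, P1, ← e1]
  rw [← hit] at e2
  simp only [Nf, piA] at e2 ⊢
  linear_combination (Real.exp (-g.rhoBar * g.tm x) * ((Real.exp (g.rhoBar * g.tm x) * g.piExt x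
    - g.rhoBar * g.Q0 x) - (Real.exp (g.rhoBar * g.tm (g.aExt (g.hit r x)))
      * g.piExt (g.aExt (g.hit r x)) - g.rhoBar * g.Q0 (g.aExt (g.hit r x))))) * h2
    + g.piExt x * e3 + Real.exp (-g.rhoBar * g.tm x) * g.piExt (g.aExt (g.hit r x)) * e2

end Value

/-! ### Monotonicity and sign of the free-boundary function -/

section FreeBoundaryFunction

lemma hit_hasDerivAt (hg : g.ZeroNoiseAssumption) {r x : ℝ} (hx : x ∈ g.Dom)
    (h : 0 < g.hit r x) :
    HasDerivAt (fun y => g.hit r y) ((g.bA' (g.hit r x))⁻¹ * (g.etaMax - g.mu * x)⁻¹) x :=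
  (Xi_hasDerivAt hg h).comp x ((tm_hasDerivAt hg hx).add_const (r / g.etaMax))

lemma hit_contDiffAt (hg : g.ZeroNoiseAssumption) {r x : ℝ} (hx : x ∈ g.Dom)
    (h : 0 < g.hit r x) : ContDiffAt ℝ 1 (fun p : ℝ × ℝ => g.hit p.1 p.2) (r, x) := by
  have h1 : ContDiffAt ℝ 1 (fun p : ℝ × ℝ => g.tm p.2) (r, x) :=
    ContDiffAt.comp (g := g.tm) (r, x) (tm_contDiffAt hg hx) contDiffAt_snd
  have h2 : ContDiffAt ℝ 1 (fun p : ℝ × ℝ => g.tm p.2 + p.1 / g.etaMax) (r, x) :=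
    h1.add (contDiffAt_fst.div_const _)
  exact ContDiffAt.comp (g := g.Xi) (r, x) (Xi_contDiffAt hg h) h2

lemma hh_contDiffAt (hg : g.ZeroNoiseAssumption) {r x : ℝ} (hx : 0 < x) (h : 0 < g.hit r x) :
    ContDiffAt ℝ 1 (fun p : ℝ × ℝ => g.hh p.1 p.2) (r, x) := by
  have hD := nonneg_mem_Dom hg hx.le
  have hhit := hit_contDiffAt hg hD h
  have htm : ContDiffAt ℝ 1 (fun p : ℝ × ℝ => g.tm p.2) (r, x) :=
    ContDiffAt.comp (g := g.tm) (r, x) (tm_contDiffAt hg hD) contDiffAt_snd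
  have hN : ContDiffAt ℝ 1 (fun p : ℝ × ℝ => g.Nf p.2) (r, x) :=
    ContDiffAt.comp (g := g.Nf) (r, x) (Nf_contDiffAt hg hx) contDiffAt_snd
  have ha : ContDiffAt ℝ 1 (fun p : ℝ × ℝ => g.aExt (g.hit p.1 p.2)) (r, x) :=
    ContDiffAt.comp (g := g.aExt) (r, x) (hg.aExt_contDiffAt h) hhit
  have hNa : ContDiffAt ℝ 1 (fun p : ℝ × ℝ => g.Nf (g.aExt (g.hit p.1 p.2))) (r, x) :=
    ContDiffAt.comp (g := g.Nf) (f := fun p : ℝ × ℝ => g.aExt (g.hit p.1 p.2)) (r, x)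
      (Nf_contDiffAt hg (by rw [aExt_of_nonneg h.le]; exact hg.a_pos h)) ha
  have hP : ContDiffAt ℝ 1 (fun p : ℝ × ℝ => g.P1 (g.hit p.1 p.2)) (r, x) :=
    ContDiffAt.comp (g := g.P1) (r, x) (P1_contDiffAt hg h) hhit
  exact ((contDiffAt_const.mul htm).exp.mul (hN.sub hNa)).sub
    ((contDiffAt_const.mul contDiffAt_fst).exp.mul hP)

/-- `h` is strictly increasing in the capacity, with a positive derivative. -/
lemma hh_hasDerivAt (hg : g.ZeroNoiseAssumption) {r x : ℝ} (hr : 0 ≤ r) (hx : g.a r < x) :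
    ∃ d, 0 < d ∧ HasDerivAt (fun y => g.hh r y) d x := by
  have hξ := hit_pos hg hr hx
  have hx0 : 0 < x := (hg.a_nonneg hr).trans_lt hx
  have hD := nonneg_mem_Dom hg hx0.le
  set ξ := g.hit r x with hξdef
  have hA := hg.aExt_hasDerivAt hξ
  have haξ : g.aExt ξ = g.a ξ := aExt_of_nonneg hξ.le
  have ha0 : 0 < g.a ξ := hg.a_pos hξ
  have hax : g.a ξ < x := by rw [← haξ]; exact aExt_hit_lt hg hx0.le (lt_hit hg hr hx)
  have hDa := nonneg_mem_Dom hg ha0.le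
  have hhit := hit_hasDerivAt hg hD hξ
  have hN : HasDerivAt (fun y => g.Nf (g.aExt (g.hit r y)))
      (Real.exp (g.rhoBar * g.tm (g.a ξ)) * deriv g.profitF (g.a ξ)
        * (deriv g.a ξ * ((g.bA' ξ)⁻¹ * (g.etaMax - g.mu * x)⁻¹))) x := by
    have h1 := Nf_hasDerivAt hg ha0
    rw [← haξ] at h1 ⊢
    exact h1.comp x (hA.comp x hhit)
  have hP := (P1_hasDerivAt hg hξ).comp x hhit
  have htot := ((((tm_hasDerivAt hg hD).const_mul (-(g.rhoBar - g.mu))).exp.mul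
    ((Nf_hasDerivAt hg hx0).sub hN))).sub (hP.const_mul (Real.exp (g.kappa * r)))
  refine ⟨_, ?_, htot⟩
  simp only [Pi.sub_apply]
  rw [← hξdef, haξ]
  have hq := rate_pos hg
  have hm := hg.etaMax_pos
  have hi := inv_pos.2 (mem_Dom.1 hD)
  have hia := inv_pos.2 (mem_Dom.1 hDa)
  have hpx := hg.deriv_profitF_pos hx0
  have hpa := hg.deriv_profitF_nonneg ha0
  have hda := hg.deriv_a_nonneg hξ
  have hb := bA'_pos hg hξ
  have hpp := hg.profitF_deriv_mono ha0 hx0 hax.le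
  have hsub := Nf_sub_le hg ha0 hax.le
  have ex := exp_rate_tm hg hD
  have ea := exp_rate_tm hg hDa
  have hbdef : g.bA' ξ = (g.etaMax - g.mu * g.a ξ)⁻¹ * deriv g.a ξ + g.etaMax⁻¹ := rfl
  have hbinv : g.bA' ξ * (g.bA' ξ)⁻¹ = 1 := mul_inv_cancel₀ hb.ne'
  set i := (g.etaMax - g.mu * x)⁻¹
  set ia := (g.etaMax - g.mu * g.a ξ)⁻¹
  set β := (g.bA' ξ)⁻¹
  have hβ : 0 < β := inv_pos.2 hb
  set E := Real.exp (-(g.rhoBar - g.mu) * g.tm x)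
  have hE : 0 < E := Real.exp_pos _
  set qx := Real.exp ((g.rhoBar - g.mu) * g.tm x)
  set qa := Real.exp ((g.rhoBar - g.mu) * g.tm (g.a ξ))
  have hqa : 0 < qa := Real.exp_pos _
  set rx := Real.exp (g.rhoBar * g.tm x)
  set ra := Real.exp (g.rhoBar * g.tm (g.a ξ))
  set πx := deriv g.profitF x
  set πa := deriv g.profitF (g.a ξ)
  set a' := deriv g.a ξ
  -- The slope of `a` accounts for only a part of `bA'`, because technology adds 1/η_max; hence a
  -- marginal unit of capacity raises the hit point by a fraction of itself in the clock `tm`.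
  have hlt : ia * a' * β < 1 := by
    have : ia * a' * β + g.etaMax⁻¹ * β = 1 := by rw [← hbinv, hbdef]; ring
    have := mul_pos (inv_pos.2 hm) hβ
    linarith
  have h0 : 0 ≤ ia * a' * β := by positivity
  have h1 : πa * (ia * a' * β) ≤ πx * (ia * a' * β) := mul_le_mul_of_nonneg_right hpp h0
  have h2 : 0 < πx - πa * (ia * a' * β) := by nlinarith
  have h3 : 0 < E * i * g.etaMax * qa * (πx - πa * (ia * a' * β)) := by positivity
  have h4 : 0 ≤ E * i * (πx * g.etaMax * (qx - qa)
      - (g.rhoBar - g.mu) * (g.Nf x - g.Nf (g.a ξ))) :=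
    mul_nonneg (by positivity) (sub_nonneg.2 hsub)
  have h5 : 0 ≤ Real.exp (g.kappa * r) * (Real.exp (-g.kappa * ξ) * (πa * a') * (β * i)) := by
    positivity
  -- Adding and subtracting π'(x) η_max (qx - qa) splits the derivative into the slack in
  -- `Nf_sub_le` and a term that is positive by the bound on ia a' β and π'(a(ξ)) ≤ π'(x).
  have key : E * (-(g.rhoBar - g.mu) * i) * (g.Nf x - g.Nf (g.a ξ))
      + E * (rx * πx - ra * πa * (a' * (β * i)))
      = E * i * (πx * g.etaMax * (qx - qa) - (g.rhoBar - g.mu) * (g.Nf x - g.Nf (g.a ξ)))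
        + E * i * g.etaMax * qa * (πx - πa * (ia * a' * β)) := by
    rw [← ex, ← ea]; ring
  linarith [key, h3, h4, h5]

lemma hh_strictMonoOn (hg : g.ZeroNoiseAssumption) {r : ℝ} (hr : 0 ≤ r) :
    StrictMonoOn (fun x => g.hh r x) (Ioi (g.a r)) := by
  choose! d hd hd' using fun x (hx : g.a r < x) => hh_hasDerivAt hg hr hx
  refine strictMonoOn_of_deriv_pos (convex_Ioi _)
    (fun x hx => (hd' x hx).continuousAt.continuousWithinAt) fun x hx => ?_
  rw [interior_Ioi] at hx
  rw [(hd' x hx).deriv]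
  exact hd x hx

lemma hit_continuous_fst (hg : g.ZeroNoiseAssumption) (x : ℝ) :
    Continuous fun r => g.hit r x :=
  (Xi_continuous hg).comp (by fun_prop)

lemma Nf_aExt_continuous (hg : g.ZeroNoiseAssumption) : Continuous fun ξ => g.Nf (g.aExt ξ) :=
  (Nf_continuousOn hg).comp_continuous hg.aExt_continuous
    fun _ => nonneg_mem_Dom hg (hg.aExt_nonneg _)

lemma hh_continuous_fst (hg : g.ZeroNoiseAssumption) (x : ℝ) : Continuous fun r => g.hh r x := by
  have h1 := (Nf_aExt_continuous hg).comp (hit_continuous_fst hg x)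
  have h2 := (P1_continuous hg).comp (hit_continuous_fst hg x)
  simp only [Function.comp_def] at h1 h2
  unfold hh
  fun_prop

lemma hh_continuousWithinAt_snd (hg : g.ZeroNoiseAssumption) (r : ℝ) :
    ContinuousOn (fun x => g.hh r x) g.Dom := by
  have h0 := tm_continuousOn hg
  have h3 : ContinuousOn (fun x => g.hit r x) g.Dom :=
    (Xi_continuous hg).comp_continuousOn (h0.add continuousOn_const)
  have h1 := (Nf_aExt_continuous hg).comp_continuousOn h3
  have h2 := (P1_continuous hg).comp_continuousOn h3
  have h4 := Nf_continuousOn hg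
  simp only [Function.comp_def] at h1 h2
  unfold hh
  fun_prop

lemma hit_a (hg : g.ZeroNoiseAssumption) {r : ℝ} (hr : 0 ≤ r) : g.hit r (g.a r) = r := by
  rw [← aExt_of_nonneg hr]
  exact Xi_bA hg r

/-- On the boundary the hit is immediate, so the first term vanishes and minus the gain from moving
along `a` is left. -/
lemma hh_a_neg (hg : g.ZeroNoiseAssumption) {r : ℝ} (hr : 0 ≤ r) : g.hh r (g.a r) < 0 := by
  rw [hh, hit_a hg hr, aExt_of_nonneg hr, sub_self, mul_zero, zero_sub, neg_neg_iff_pos]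
  exact mul_pos (Real.exp_pos _) (P1_pos hg hr)

lemma exists_hh_pos (hg : g.ZeroNoiseAssumption) {r : ℝ} (hr : 0 ≤ r) :
    ∃ x, g.a r < x ∧ 0 < g.hh r x := by
  have hq := rate_pos hg
  have hm := hg.etaMax_pos
  -- The level r + 1 is used instead of r because a(0) may be 0, where π' is not controlled.
  have hp1 := hg.deriv_profitF_pos (hg.a_pos (r := r + 1) (by linarith))
  set c := deriv g.profitF (g.a (r + 1)) * g.etaMax / (g.rhoBar - g.mu)
  have hc : 0 < c := by positivity
  have hlim : Tendsto (fun ξ => c * (1 - Real.exp (-(g.rhoBar - g.mu) * ((ξ - r) / g.etaMax)))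
      - Real.exp (g.kappa * r) * g.P1 ξ) atTop
      (𝓝 (c * (1 - 0) - Real.exp (g.kappa * r) * 0)) := by
    refine Tendsto.sub (Tendsto.const_mul _ (Tendsto.const_sub _ ?_))
      ((P1_tendsto hg).const_mul _)
    refine Real.tendsto_exp_atBot.comp ?_
    refine Tendsto.const_mul_atTop_of_neg (neg_neg_of_pos hq) ?_
    exact (tendsto_atTop_add_const_right _ (-r) tendsto_id).atTop_div_const hm
  have hev := hlim.eventually_const_lt (show (0 : ℝ) < _ by simpa using hc)
  -- It is easier to choose the hitting level ξ than x: the lower bound for h is explicit in ξ and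
  -- tends to c > 0 as ξ grows. The capacity x that hits at ξ is then found from `exists_tm_eq`.
  obtain ⟨ξ, hξ, hξr⟩ := (hev.and (eventually_gt_atTop (r + 1))).exists
  have hξ0 : 0 < ξ := by linarith
  have hT : 0 ≤ g.tm (g.aExt ξ) + (ξ - r) / g.etaMax :=
    add_nonneg (tm_nonneg hg (hg.aExt_nonneg _)) (div_nonneg (by linarith) hm.le)
  obtain ⟨x, hx0, hx⟩ := exists_tm_eq hg hT
  have hhit : g.hit r x = ξ := by
    rw [hit, hx, ← Xi_bA hg ξ]
    congr 1
    rw [Xi_bA hg, bA]; ring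
  have hD := nonneg_mem_Dom hg hx0
  have hax : g.aExt ξ < x := by
    rw [← hhit]; exact aExt_hit_lt hg hx0 (by rw [hhit]; linarith)
  rw [aExt_of_nonneg hξ0.le] at hax
  have hrξ : g.a r < g.a ξ := hg.a_strictMonoOn hr (mem_Ici.2 hξ0.le) (by linarith)
  refine ⟨x, hrξ.trans hax, hξ.trans_le ?_⟩
  rw [hh, hhit]
  refine sub_le_sub_right ?_ _
  rw [aExt_of_nonneg hξ0.le] at hx ⊢
  have h1 := le_Nf_sub hg (hg.a_pos hξ0) hax.le
  have h2 : deriv g.profitF (g.a (r + 1)) ≤ deriv g.profitF (g.a ξ) :=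
    hg.profitF_deriv_mono (hg.a_pos (by linarith)) (hg.a_pos hξ0)
      (hg.a_strictMonoOn.monotoneOn (mem_Ici.2 (by linarith)) (mem_Ici.2 hξ0.le) hξr.le)
  have h3 : Real.exp ((g.rhoBar - g.mu) * g.tm (g.a ξ))
      ≤ Real.exp ((g.rhoBar - g.mu) * g.tm x) :=
    Real.exp_le_exp.2 (mul_le_mul_of_nonneg_left
      ((tm_le_iff hg (nonneg_mem_Dom hg (hg.a_pos hξ0).le) hD).2 hax.le) hq.le)
  have h4 : deriv g.profitF (g.a (r + 1)) * g.etaMax * (Real.exp ((g.rhoBar - g.mu) * g.tm x)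
      - Real.exp ((g.rhoBar - g.mu) * g.tm (g.a ξ)))
      ≤ (g.rhoBar - g.mu) * (g.Nf x - g.Nf (g.a ξ)) :=
    (mul_le_mul_of_nonneg_right (mul_le_mul_of_nonneg_right h2 hm.le) (sub_nonneg.2 h3)).trans h1
  have h5 : c * (Real.exp ((g.rhoBar - g.mu) * g.tm x)
      - Real.exp ((g.rhoBar - g.mu) * g.tm (g.a ξ))) ≤ g.Nf x - g.Nf (g.a ξ) := by
    rw [div_mul_eq_mul_div, div_le_iff₀ hq]; linarith
  have h6 := mul_le_mul_of_nonneg_left h5 (Real.exp_pos (-(g.rhoBar - g.mu) * g.tm x)).le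
  refine le_trans (le_of_eq ?_) h6
  have e1 : Real.exp (-(g.rhoBar - g.mu) * g.tm x) * Real.exp ((g.rhoBar - g.mu) * g.tm x) = 1 := by
    rw [← Real.exp_add, ← add_mul, neg_add_cancel, zero_mul, Real.exp_zero]
  have e2 : Real.exp (-(g.rhoBar - g.mu) * g.tm x) * Real.exp ((g.rhoBar - g.mu) * g.tm (g.a ξ))
      = Real.exp (-(g.rhoBar - g.mu) * ((ξ - r) / g.etaMax)) := by
    rw [← Real.exp_add, hx]; ring_nf
  rw [← e2]
  linear_combination -c * e1

/-- `h` is strictly decreasing in the technology level. -/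
lemma hh_anti (hg : g.ZeroNoiseAssumption) {r s x : ℝ} (hr : 0 ≤ r) (hrs : r < s)
    (hx : g.a s < x) : g.hh s x < g.hh r x := by
  have hs : 0 ≤ s := hr.trans hrs.le
  have hx0 : 0 < x := (hg.a_nonneg hs).trans_lt hx
  have hD := nonneg_mem_Dom hg hx0.le
  have hax : ∀ u ∈ Icc r s, g.a u < x := fun u hu =>
    (hg.a_strictMonoOn.monotoneOn (mem_Ici.2 (hr.trans hu.1)) (mem_Ici.2 hs) hu.2).trans_lt hx
  rcases hg.mu_nonpos.eq_or_lt with hmu | hmu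
  -- For μ = 0 one has h = π - ρ̄ W, so it suffices that W increases in r, which is the positivity
  -- of `P1`.
  · have hW : StrictMonoOn (fun u => g.W u x) (Icc r s) := by
      have hd : ∀ u ∈ Icc r s, HasDerivAt (fun u => g.W u x) (g.Wr u x) u := fun u hu =>
        W_hasDerivAt_fst hg hD (hit_pos hg (hr.trans hu.1) (hax u hu))
      refine strictMonoOn_of_deriv_pos (convex_Icc r s)
        (fun u hu => (hd u hu).continuousAt.continuousWithinAt) fun u hu => ?_
      have hu' := interior_subset hu
      rw [(hd u hu').deriv]
      exact mul_pos (inv_pos.2 hg.etaMax_pos) (mul_pos (Real.exp_pos _)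
        (P1_pos hg (hit_pos hg (hr.trans hu'.1) (hax u hu')).le))
    have := hW (left_mem_Icc.2 hrs.le) (right_mem_Icc.2 hrs.le) hrs
    have := mul_lt_mul_of_pos_left this hg.rhoBar_pos
    rw [hh_eq hg r hD, hh_eq hg s hD, hmu]
    linarith
  · have h1 : g.hit r x < g.hit s x :=
      Xi_strictMono hg (by have := div_lt_div_of_pos_right hrs hg.etaMax_pos; linarith)
    have hr0 : 0 < g.hit r x := hit_pos hg hr (hax r (left_mem_Icc.2 hrs.le))
    have hs0 := hr0.trans h1
    have haa : g.a (g.hit r x) < g.a (g.hit s x) :=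
      hg.a_strictMonoOn (mem_Ici.2 hr0.le) (mem_Ici.2 hs0.le) h1
    have hN : g.Nf (g.a (g.hit r x)) < g.Nf (g.a (g.hit s x)) :=
      Nf_strictMonoOn hg (mem_Ici.2 (hg.a_pos hr0).le) (mem_Ici.2 (hg.a_pos hs0).le) haa
    have hP := exp_mul_P1_mono hg hmu hr0.le h1.le
    have hT : g.tm (g.a (g.hit r x)) < g.tm (g.a (g.hit s x)) :=
      tm_strictMonoOn hg (nonneg_mem_Dom hg (hg.a_pos hr0).le)
        (nonneg_mem_Dom hg (hg.a_pos hs0).le) haa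
    -- Eliminating u through the invariant of the flow leaves two factors that are nondecreasing in
    -- the hitting level, the second by the third assumption (`exp_mul_P1_mono`).
    have hkey : ∀ u, 0 < g.hit u x → Real.exp (g.kappa * u) * g.P1 (g.hit u x)
        = Real.exp (g.rhoBar * g.tm (g.a (g.hit u x)) - g.rhoBar * g.tm x)
          * (Real.exp (g.kappa * g.hit u x) * g.P1 (g.hit u x)) := by
      intro u hu
      rw [← mul_assoc, ← Real.exp_add]
      congr 2
      have hb := bA_hit hg u x
      rw [aExt_of_nonneg hu.le] at hb
      have : u = g.etaMax * (g.tm (g.a (g.hit u x)) - g.tm x) + g.hit u x := by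
        have := hg.etaMax_pos.ne'
        field_simp at hb
        linarith
      nth_rewrite 1 [this]
      rw [mul_add, kappa_mul hg]; ring
    have h2 : Real.exp (g.kappa * r) * g.P1 (g.hit r x)
        ≤ Real.exp (g.kappa * s) * g.P1 (g.hit s x) := by
      rw [hkey r hr0, hkey s hs0]
      refine mul_le_mul (Real.exp_le_exp.2 ?_) hP
        (mul_pos (Real.exp_pos _) (P1_pos hg hr0.le)).le (Real.exp_pos _).le
      have := mul_le_mul_of_nonneg_left hT.le hg.rhoBar_pos.le
      linarith
    rw [hh, hh, aExt_of_nonneg hr0.le, aExt_of_nonneg hs0.le]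
    have h3 := mul_lt_mul_of_pos_left (sub_lt_sub_left hN (g.Nf x))
      (Real.exp_pos (-(g.rhoBar - g.mu) * g.tm x))
    linarith

end FreeBoundaryFunction

end AbatementGame

/-! ### Identification of the payoff of permanent maximal abatement with the closed form -/

namespace AbatementGame

variable {g : AbatementGame}

section Payoff

/-- In the clock `tm` both sides state that `bA` at the current technology has reached the invariant
tm x + r/η_max. -/
lemma freeX_max_le_iff (hg : g.ZeroNoiseAssumption) {r x : ℝ} (hx : 0 ≤ x) (t : ℝ) :
    g.freeX x (fun _ => g.etaMax) t ≤ g.aExt (r + g.etaMax * t)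
      ↔ g.hit r x ≤ r + g.etaMax * t := by
  rw [← tm_le_iff hg (freeX_max_mem_Dom hg hx t) (nonneg_mem_Dom hg (hg.aExt_nonneg _)),
    tm_freeX_max hg hx, ← (bA_strictMono hg).le_iff_le (a := g.hit r x), hit, bA_Xi hg, bA, add_div,
    mul_div_cancel_left₀ _ hg.etaMax_pos.ne']
  constructor <;> intro h <;> linarith

/-- The flow of profits of the firm under permanent maximal abatement. -/
noncomputable def maxFlow (g : AbatementGame) (r x t : ℝ) : ℝ := Real.exp (-g.rhoBar * t)
  * g.piExt (max (g.freeX x (fun _ => g.etaMax) t) (g.aExt (r + g.etaMax * t)))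

lemma maxFlow_continuous (hg : g.ZeroNoiseAssumption) (r x : ℝ) :
    Continuous fun t => g.maxFlow r x t := by
  have h1 := freeX_const_continuous (g := g) x g.etaMax
  have h2 := hg.aExt_continuous
  have h3 := hg.piExt_continuous
  unfold maxFlow
  fun_prop

lemma maxFlow_nonneg (hg : g.ZeroNoiseAssumption) (r x t : ℝ) : 0 ≤ g.maxFlow r x t :=
  mul_nonneg (Real.exp_pos _).le (hg.piExt_nonneg _)

lemma payoffConst_max_eq (hg : g.ZeroNoiseAssumption) {r : ℝ} (hr : 0 ≤ r) (x : ℝ) :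
    g.payoffConst g.etaMax r x = ∫⁻ t in Ioi 0, ENNReal.ofReal (g.maxFlow r x t) := by
  rw [payoffConst, JF_nuA hg hr x (firmControl_const hg)]
  refine setLIntegral_congr_fun measurableSet_Ioi fun t ht => ?_
  have h0 : 0 ≤ r + g.etaMax * t := add_nonneg hr (mul_nonneg hg.etaMax_pos.le (le_of_lt ht))
  simp only [maxFlow, R_const, aExt_of_nonneg h0]

lemma freeX_flow_hasDerivAt (hg : g.ZeroNoiseAssumption) {x : ℝ} (hx : 0 ≤ x) (t : ℝ) :
    HasDerivAt (fun t => -(Real.exp (-g.rhoBar * g.tm x)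
        * g.Q0 (g.freeX x (fun _ => g.etaMax) t)))
      (Real.exp (-g.rhoBar * t) * g.piExt (g.freeX x (fun _ => g.etaMax) t)) t := by
  have hD := freeX_max_mem_Dom hg hx t
  have h1 := (((Q0_hasDerivAt hg hD).comp t (freeX_const_hasDerivAt x g.etaMax t)).const_mul
    (Real.exp (-g.rhoBar * g.tm x))).neg
  refine h1.congr_deriv ?_
  rw [tm_freeX_max hg hx]
  have e : Real.exp (-g.rhoBar * g.tm x) * Real.exp (g.rhoBar * (g.tm x - t))
      = Real.exp (-g.rhoBar * t) := by
    rw [← Real.exp_add]; ring_nf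
  have h4 := mul_inv_cancel₀ (mem_Dom.1 hD).ne'
  rw [← e]
  linear_combination (Real.exp (-g.rhoBar * g.tm x) * Real.exp (g.rhoBar * (g.tm x - t))
    * g.piExt (g.freeX x (fun _ => g.etaMax) t)) * h4

lemma le_hit (hg : g.ZeroNoiseAssumption) {r x : ℝ} (hr : 0 ≤ r) (hx : g.a r ≤ x) :
    r ≤ g.hit r x := by
  rcases hx.eq_or_lt with rfl | hx
  · rw [hit_a hg hr]
  · exact (lt_hit hg hr hx).le

/-- The time axis is split at the hitting time S = (hit - r)/η_max. Before S the profit is a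
difference of `Q0`; after S the capacity follows `a` and the profit is given by `P0`. -/
lemma maxFlow_integral (hg : g.ZeroNoiseAssumption) {r x : ℝ} (hr : 0 ≤ r) (hx : g.a r ≤ x) :
    IntegrableOn (g.maxFlow r x) (Ioi 0) ∧ ∫ t in Ioi 0, g.maxFlow r x t = g.W r x := by
  have hm := hg.etaMax_pos
  have hx0 : 0 ≤ x := (hg.a_nonneg hr).trans hx
  have hD := nonneg_mem_Dom hg hx0
  set S := (g.hit r x - r) / g.etaMax with hS
  have hS0 : 0 ≤ S := div_nonneg (sub_nonneg.2 (le_hit hg hr hx)) hm.le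
  have hrS : r + g.etaMax * S = g.hit r x := by rw [hS]; field_simp; ring
  have hlate : ∀ t ∈ Ioi S, g.maxFlow r x t
      = Real.exp (-g.rhoBar * t) * g.piA (r + g.etaMax * t) := by
    intro t ht
    have : g.hit r x ≤ r + g.etaMax * t := by
      rw [← hrS]
      have := mul_le_mul_of_nonneg_left (le_of_lt (mem_Ioi.1 ht)) hm.le
      linarith
    rw [maxFlow, max_eq_right ((freeX_max_le_iff hg hx0 t).2 this), piA]
  have hearly : ∀ t ∈ uIcc 0 S, g.maxFlow r x t
      = Real.exp (-g.rhoBar * t) * g.piExt (g.freeX x (fun _ => g.etaMax) t) := by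
    intro t ht
    rw [uIcc_of_le hS0] at ht
    rcases ht.2.eq_or_lt with rfl | htS
    · have h1 : g.freeX x (fun _ => g.etaMax) S = g.aExt (r + g.etaMax * S) := by
        refine (tm_strictMonoOn hg).injOn (freeX_max_mem_Dom hg hx0 _)
          (nonneg_mem_Dom hg (hg.aExt_nonneg _)) ?_
        have := bA_hit hg r x
        rw [tm_freeX_max hg hx0, hrS, hS, sub_div]
        linarith
      rw [maxFlow, h1, max_self]
    · have : ¬ g.hit r x ≤ r + g.etaMax * t := by
        rw [← hrS, not_le]
        have := mul_lt_mul_of_pos_left htS hm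
        linarith
      rw [maxFlow, max_eq_left]
      exact (not_le.1 (mt (freeX_max_le_iff hg hx0 t).1 this)).le
  have hc := maxFlow_continuous hg r x
  have hi1 : IntegrableOn (g.maxFlow r x) (Ioc 0 S) := by
    have := hc.intervalIntegrable (μ := volume) 0 S
    exact (intervalIntegrable_iff_integrableOn_Ioc_of_le hS0).1 this
  have hi2 : IntegrableOn (g.maxFlow r x) (Ioi S) :=
    ((integrable_boundary hg hr).mono_set (Ioi_subset_Ioi hS0)).congr_fun
      (fun t ht => (hlate t ht).symm) measurableSet_Ioi
  have hi : IntegrableOn (g.maxFlow r x) (Ioi 0) := by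
    rw [← Ioc_union_Ioi_eq_Ioi hS0]; exact hi1.union hi2
  refine ⟨hi, ?_⟩
  rw [← intervalIntegral.integral_interval_add_Ioi hi hi2,
    setIntegral_congr_fun measurableSet_Ioi hlate,
    integral_boundary hg (by rw [hrS]; exact hr.trans (le_hit hg hr hx)),
    intervalIntegral.integral_congr hearly,
    intervalIntegral.integral_eq_sub_of_hasDerivAt (fun t _ => freeX_flow_hasDerivAt hg hx0 t),
    freeX_zero, hrS, W]
  · have h1 : g.freeX x (fun _ => g.etaMax) S = g.aExt (g.hit r x) := by
      refine (tm_strictMonoOn hg).injOn (freeX_max_mem_Dom hg hx0 _)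
        (nonneg_mem_Dom hg (hg.aExt_nonneg _)) ?_
      have := bA_hit hg r x
      rw [tm_freeX_max hg hx0, hS, sub_div]
      linarith
    rw [h1]; ring
  · refine Continuous.intervalIntegrable ?_ _ _
    have h1 := freeX_const_continuous (g := g) x g.etaMax
    have h3 := hg.piExt_continuous
    fun_prop

lemma W_nonneg (hg : g.ZeroNoiseAssumption) {r x : ℝ} (hr : 0 ≤ r) (hx : g.a r ≤ x) :
    0 ≤ g.W r x := by
  rw [← (maxFlow_integral hg hr hx).2]
  exact integral_nonneg fun t => maxFlow_nonneg hg r x t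

/-- The payoff for permanent maximal abatement is `W`. -/
theorem payoffConst_max (hg : g.ZeroNoiseAssumption) {r x : ℝ} (hr : 0 ≤ r) (hx : g.a r ≤ x) :
    g.payoffConst g.etaMax r x = ENNReal.ofReal (g.W r x) := by
  obtain ⟨hi, hW⟩ := maxFlow_integral hg hr hx
  rw [payoffConst_max_eq hg hr, ← hW, ofReal_integral_eq_lintegral_ofReal hi
    (Eventually.of_forall fun t => maxFlow_nonneg hg r x t)]

lemma freeX_mono (g : AbatementGame) {x y : ℝ} (h : x ≤ y) (eta : ℝ → ℝ) (t : ℝ) :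
    g.freeX x eta t ≤ g.freeX y eta t := by
  rw [freeX, freeX]
  exact mul_le_mul_of_nonneg_left (sub_le_sub_right h _) (Real.exp_pos _).le

/-- Below a(r) the lump sum lifts the capacity to a(r) at once, so the starting point is forgotten.
-/
lemma payoffConst_max_of_le (hg : g.ZeroNoiseAssumption) {r x : ℝ} (hr : 0 ≤ r) (hx : x ≤ g.a r) :
    g.payoffConst g.etaMax r x = ENNReal.ofReal (g.W r (g.a r)) := by
  rw [← payoffConst_max hg hr le_rfl, payoffConst_max_eq hg hr, payoffConst_max_eq hg hr]
  refine setLIntegral_congr_fun measurableSet_Ioi fun t ht => ?_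
  have h1 : g.freeX (g.a r) (fun _ => g.etaMax) t ≤ g.aExt (r + g.etaMax * t) := by
    rw [freeX_max_le_iff hg (hg.a_nonneg hr), hit_a hg hr]
    exact le_add_of_nonneg_right (mul_nonneg hg.etaMax_pos.le (le_of_lt ht))
  simp only [maxFlow]
  rw [max_eq_right h1, max_eq_right ((freeX_mono g hx _ t).trans h1)]

/-- The function of the statement agrees with its closed form. -/
theorem h_eq_hh (hg : g.ZeroNoiseAssumption) {r x : ℝ} (hr : 0 ≤ r) (hx : g.a r < x) :
    g.h r x = g.hh r x := by
  have hx0 : 0 < x := (hg.a_nonneg hr).trans_lt hx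
  have hD := nonneg_mem_Dom hg hx0.le
  have heq : ∀ y, g.a r < y → (g.payoffConst g.etaMax r y).toReal = g.W r y := fun y hy => by
    rw [payoffConst_max hg hr hy.le, ENNReal.toReal_ofReal (W_nonneg hg hr hy.le)]
  have hd : deriv (fun y => (g.payoffConst g.etaMax r y).toReal) x = g.Wx r x := by
    rw [← (W_hasDerivAt hg hD (hit_pos hg hr hx)).deriv]
    refine Filter.EventuallyEq.deriv_eq ?_
    filter_upwards [Ioi_mem_nhds hx] with y hy using heq y hy
  rw [h, hd, heq x hx, hh_eq hg r hD, abs_of_nonpos hg.mu_nonpos, piExt_of_nonneg hx0.le]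
  ring

end Payoff

/-! ### Existence, monotonicity and smoothness of the boundary `b` -/

section FreeBoundary

lemma exists_zero (hg : g.ZeroNoiseAssumption) {r : ℝ} (hr : 0 ≤ r) :
    ∃ x, g.a r < x ∧ g.hh r x = 0 := by
  obtain ⟨y, hy, hy'⟩ := exists_hh_pos hg hr
  have hc : ContinuousOn (fun x => g.hh r x) (Icc (g.a r) y) :=
    (hh_continuousWithinAt_snd hg r).mono fun z hz =>
      nonneg_mem_Dom hg ((hg.a_nonneg hr).trans hz.1)
  obtain ⟨x, hx, hx'⟩ := intermediate_value_Icc hy.le hc ⟨(hh_a_neg hg hr).le, hy'.le⟩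
  refine ⟨x, lt_of_le_of_ne hx.1 ?_, hx'⟩
  rintro rfl
  exact (hh_a_neg hg hr).ne hx'

/-- A boundary of zeros of `h` above `a`. -/
def IsZeroBoundary (g : AbatementGame) (b : ℝ → ℝ) : Prop :=
  ∀ r, 0 ≤ r → g.a r < b r ∧ g.hh r (b r) = 0

variable {b : ℝ → ℝ}

lemma hh_neg_iff (hg : g.ZeroNoiseAssumption) (hb : g.IsZeroBoundary b) {r x : ℝ} (hr : 0 ≤ r)
    (hx : g.a r < x) : g.hh r x < 0 ↔ x < b r := by
  rw [← (hb r hr).2]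
  exact (hh_strictMonoOn hg hr).lt_iff_lt hx (hb r hr).1

lemma hh_pos_iff (hg : g.ZeroNoiseAssumption) (hb : g.IsZeroBoundary b) {r x : ℝ} (hr : 0 ≤ r)
    (hx : g.a r < x) : 0 < g.hh r x ↔ b r < x := by
  rw [← (hb r hr).2]
  exact (hh_strictMonoOn hg hr).lt_iff_lt (hb r hr).1 hx

lemma hh_zero_iff (hg : g.ZeroNoiseAssumption) (hb : g.IsZeroBoundary b) {r x : ℝ} (hr : 0 ≤ r)
    (hx : g.a r < x) : g.hh r x = 0 ↔ x = b r := by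
  rw [← (hb r hr).2]
  exact (hh_strictMonoOn hg hr).injOn.eq_iff hx (hb r hr).1

/-- By `hh_anti`, h(r, b(s)) > h(s, b(s)) = 0 for r < s, and monotonicity in x then places b(s)
above b(r). -/
lemma IsZeroBoundary.strictMonoOn (hg : g.ZeroNoiseAssumption) (hb : g.IsZeroBoundary b) :
    StrictMonoOn b (Ici 0) := by
  intro r hr s hs hrs
  have h1 := hh_anti hg hr hrs (hb s hs).1
  rw [(hb s hs).2, hh_pos_iff hg hb hr ((hg.a_strictMonoOn hr hs hrs).trans (hb s hs).1)] at h1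
  exact h1

/-- The sign of h(s, x) at a fixed test capacity x tells on which side of b(s) it lies, and a strict
sign is stable in s. Only continuity of h in its first variable is needed, and r = 0 is included. -/
lemma IsZeroBoundary.continuousOn (hg : g.ZeroNoiseAssumption) (hb : g.IsZeroBoundary b) :
    ContinuousOn b (Ici 0) := by
  intro r hr
  have ha : Tendsto g.a (𝓝[Ici 0] r) (𝓝 (g.a r)) := hg.a_continuousOn r hr
  have hcont : ∀ x, Tendsto (fun s => g.hh s x) (𝓝[Ici 0] r) (𝓝 (g.hh r x)) := fun x =>
    ((hh_continuous_fst hg x).tendsto r).mono_left nhdsWithin_le_nhds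
  refine tendsto_order.2 ⟨fun c hc => ?_, fun c hc => ?_⟩
  · obtain ⟨x, hx1, hx2⟩ := exists_between (max_lt hc (hb r hr).1)
    have hax : g.a r < x := (le_max_right _ _).trans_lt hx1
    have hneg := (hh_neg_iff hg hb hr hax).2 hx2
    filter_upwards [self_mem_nhdsWithin, ha.eventually_lt_const hax,
      (hcont x).eventually_lt_const hneg] with s hs has hhs
    exact (le_max_left _ _).trans_lt (hx1.trans ((hh_neg_iff hg hb hs has).1 hhs))
  · have hac : g.a r < c := (hb r hr).1.trans hc
    have hpos := (hh_pos_iff hg hb hr hac).2 hc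
    filter_upwards [self_mem_nhdsWithin, ha.eventually_lt_const hac,
      (hcont c).eventually_const_lt hpos] with s hs has hhs
    exact (hh_pos_iff hg hb hs has).1 hhs

/-- The implicit function theorem applies because ∂ₓh > 0; the continuity of `b` already proved
identifies it with the local implicit function. -/
lemma IsZeroBoundary.contDiffAt (hg : g.ZeroNoiseAssumption) (hb : g.IsZeroBoundary b) {r : ℝ}
    (hr : 0 < r) : ContDiffAt ℝ 1 b r := by
  have hx : 0 < b r := (hg.a_pos hr).trans (hb r hr.le).1
  have cdf := hh_contDiffAt hg hx (hit_pos hg hr.le (hb r hr.le).1)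
  obtain ⟨d, hd, hd'⟩ := hh_hasDerivAt hg hr.le (hb r hr.le).1
  have hd'' : fderiv ℝ (fun p : ℝ × ℝ => g.hh p.1 p.2) (r, b r) (0, 1) = d := by
    have h1 := (cdf.differentiableAt one_ne_zero).hasFDerivAt.comp_hasDerivAt (b r)
      ((hasDerivAt_const (b r) r).prodMk (hasDerivAt_id' (b r)))
    exact h1.unique hd'
  have if₂ : (fderiv ℝ (fun p : ℝ × ℝ => g.hh p.1 p.2) (r, b r) ∘L
      .inr ℝ ℝ ℝ).IsInvertible := by
    refine ⟨ContinuousLinearEquiv.unitsEquivAut ℝ (Units.mk0 d hd.ne'), ?_⟩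
    ext
    simp [hd'']
  have h1 := cdf.contDiffAt_implicitFunction one_ne_zero if₂
  refine h1.congr_of_eventuallyEq ?_
  have h2 := cdf.eventually_apply_eq_iff_implicitFunction one_ne_zero if₂
  have hbc : ContinuousAt b r := (hb.continuousOn hg).continuousAt (Ici_mem_nhds hr)
  have ht : Tendsto (fun s => (s, b s)) (𝓝 r) (𝓝 (r, b r)) :=
    (continuousAt_id.prodMk hbc)
  filter_upwards [ht.eventually h2, Ici_mem_nhds hr] with s hs hs0
  refine (hs.1 ?_).symm
  simp only [(hb s hs0).2, (hb r hr.le).2]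

theorem IsZeroBoundary.isBoundary (hg : g.ZeroNoiseAssumption) (hb : g.IsZeroBoundary b) :
    g.IsBoundary b where
  cont := hb.continuousOn hg
  contDiff := fun _ hr => (hb.contDiffAt hg hr).contDiffWithinAt
  strictMono := hb.strictMonoOn hg
  above := fun r hr => (hb r hr).1

lemma exists_isZeroBoundary (hg : g.ZeroNoiseAssumption) : ∃ b, g.IsZeroBoundary b := by
  choose! b hb using fun r (hr : 0 ≤ r) => exists_zero hg hr
  exact ⟨b, hb⟩

end FreeBoundary

end AbatementGame

/-! ### The Hamilton-Jacobi-Bellman inequality along an arbitrary control -/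

namespace AbatementGame

variable {g : AbatementGame}

section Verification

variable {eta : ℝ → ℝ}

/-- Capacity plus technology moves by the natural decline only. -/
lemma FirmControl.freeX_add_R (he : g.FirmControl eta) (r x : ℝ) {t : ℝ} (ht : 0 ≤ t) :
    g.freeX x eta t + R r eta t = Real.exp (g.mu * t) * (x - g.mu *
      ∫ u in (0 : ℝ)..t, Real.exp (-g.mu * u) * (R r eta (max u 0) - r)) + r := by
  have h : ∫ u in (0 : ℝ)..t, Real.exp (-g.mu * u) * (R r eta u - r)
      = ∫ u in (0 : ℝ)..t, Real.exp (-g.mu * u) * (R r eta (max u 0) - r) := by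
    refine intervalIntegral.integral_congr fun u hu => ?_
    rw [uIcc_of_le ht] at hu
    simp only [max_eq_left hu.1]
  have e : Real.exp (g.mu * t) * Real.exp (-g.mu * t) = 1 := by rw [← Real.exp_add]; simp
  rw [freeX, he.integral_exp_mul r g.mu ht, h]
  linear_combination -(R r eta t - r) * e

/-- For a merely measurable η neither Y nor R need be differentiable at a given time, but abatement
cancels in their sum. -/
lemma FirmControl.freeX_add_R_hasDerivWithinAt (he : g.FirmControl eta) (r x : ℝ) {t : ℝ}
    (ht : 0 ≤ t) : HasDerivWithinAt (fun z => g.freeX x eta z + R r eta z)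
      (g.mu * g.freeX x eta t) (Ici t) t := by
  have hc : Continuous fun u => Real.exp (-g.mu * u) * (R r eta (max u 0) - r) := by
    have := he.R_continuous r
    fun_prop
  have h1 := ((intervalIntegral.integral_hasDerivAt_right (hc.intervalIntegrable 0 t)
    (hc.stronglyMeasurableAtFilter volume _) hc.continuousAt).const_mul g.mu).const_sub x
  have h2 := ((((hasDerivAt_id' t).const_mul g.mu).exp.mul h1).add_const r).hasDerivWithinAt
    (s := Ici t)
  have h3 := h2.congr (f₁ := fun z => g.freeX x eta z + R r eta z)
    (fun z hz => he.freeX_add_R r x (ht.trans hz)) (he.freeX_add_R r x ht)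
  refine h3.congr_deriv ?_
  have e : Real.exp (g.mu * t) * Real.exp (-g.mu * t) = 1 := by rw [← Real.exp_add]; simp
  have h4 := he.freeX_add_R r x ht
  rw [max_eq_left ht]
  linear_combination -g.mu * h4 - g.mu * (R r eta t - r) * e

/-- The Hamilton-Jacobi-Bellman inequality along an arbitrary control of the firm. -/
lemma eventually_slope_lt (hg : g.ZeroNoiseAssumption) (he : g.FirmControl eta) {r : ℝ}
    (hr : 0 ≤ r) (x : ℝ) {t : ℝ} (ht : 0 ≤ t) (ha : g.a (R r eta t) < g.freeX x eta t) {G c : ℝ}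
    (hG : 0 ≤ G) (hG' : g.hh (R r eta t) (g.freeX x eta t) ≤ G)
    (hc : Real.exp (-g.rhoBar * t) * (G - g.piExt (g.freeX x eta t)) < c) :
    ∀ᶠ z in 𝓝[>] t, slope (fun z => Real.exp (-g.rhoBar * z)
      * g.W (R r eta z) (g.freeX x eta z)) t z < c := by
  have hm := hg.etaMax_pos
  have hR := R_nonneg hr he ht
  set ρ := R r eta t with hρ
  set y := g.freeX x eta t with hy
  have hD : y ∈ g.Dom := nonneg_mem_Dom hg ((hg.a_nonneg hR).trans ha.le)
  have hW := W_hasFDerivAt hg hD (hit_pos hg hR ha)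
  set E := Real.exp (-g.rhoBar * t) with hE
  have hE0 : 0 < E := Real.exp_pos _
  have hθ0 : ∀ z ∈ Ioi t, 0 ≤ R r eta z - ρ := fun z hz =>
    sub_nonneg.2 (he.R_mono r ht (le_of_lt hz))
  have hθ1 : ∀ z ∈ Ioi t, R r eta z - ρ ≤ g.etaMax * (z - t) := fun z hz =>
    he.R_sub_le r ht (le_of_lt hz)
  have hU := (he.freeX_add_R_hasDerivWithinAt r x ht).mono Ioi_subset_Ici_self
  have hUo := hasDerivWithinAt_iff_isLittleO.1 hU
  have hzO : (fun z => z - t) =O[𝓝[>] t] fun z => z - t := Asymptotics.isBigO_refl _ _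
  have hRO : (fun z => R r eta z - ρ) =O[𝓝[>] t] fun z => z - t := by
    refine Asymptotics.IsBigO.of_bound g.etaMax ?_
    filter_upwards [self_mem_nhdsWithin] with z hz
    rw [Real.norm_of_nonneg (hθ0 z hz), Real.norm_of_nonneg (sub_nonneg.2 (le_of_lt hz))]
    exact hθ1 z hz
  have hYO : (fun z => g.freeX x eta z - y) =O[𝓝[>] t] fun z => z - t :=
    ((hUo.isBigO.add (hzO.const_mul_left (g.mu * y))).sub hRO).congr_left fun z => by
      simp only [smul_eq_mul]; ring
  have hpO : (fun z => ((z, R r eta z, g.freeX x eta z) : ℝ × ℝ × ℝ) - (t, ρ, y)) =O[𝓝[>] t]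
      fun z => z - t := hzO.prod_left (hRO.prod_left hYO)
  have hpt : Tendsto (fun z => ((z, R r eta z, g.freeX x eta z) : ℝ × ℝ × ℝ)) (𝓝[>] t)
      (𝓝 (t, ρ, y)) := by
    have h0 : Tendsto (fun z => z - t) (𝓝[>] t) (𝓝 0) := by
      have : ContinuousAt (fun z => z - t) t := by fun_prop
      simpa [ContinuousAt] using this.mono_left nhdsWithin_le_nhds
    have := hpO.trans_tendsto h0
    simpa using this.add_const ((t, ρ, y) : ℝ × ℝ × ℝ)
  have hF : HasFDerivAt (fun p : ℝ × ℝ × ℝ => Real.exp (-g.rhoBar * p.1) * g.W p.2.1 p.2.2)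
      (E • ((g.Wr ρ y • ContinuousLinearMap.fst ℝ ℝ ℝ + g.Wx ρ y • ContinuousLinearMap.snd ℝ ℝ ℝ)
        ∘L ContinuousLinearMap.snd ℝ ℝ (ℝ × ℝ))
        + g.W ρ y • ((E * (-g.rhoBar)) • ContinuousLinearMap.fst ℝ ℝ (ℝ × ℝ))) (t, ρ, y) := by
    have h1 : HasFDerivAt (fun p : ℝ × ℝ × ℝ => p.1) (ContinuousLinearMap.fst ℝ ℝ (ℝ × ℝ))
        (t, ρ, y) := hasFDerivAt_fst
    have h2 : HasFDerivAt (fun p : ℝ × ℝ × ℝ => p.2) (ContinuousLinearMap.snd ℝ ℝ (ℝ × ℝ))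
        (t, ρ, y) := hasFDerivAt_snd
    have h3 := (((hasDerivAt_id' t).const_mul (-g.rhoBar)).exp).comp_hasFDerivAt
      (f := fun p : ℝ × ℝ × ℝ => p.1) (t, ρ, y) h1
    rw [mul_one] at h3
    exact h3.mul (HasFDerivAt.comp (g := fun p : ℝ × ℝ => g.W p.1 p.2) (t, ρ, y) hW h2)
  -- First-order expansion in which the increment of R is kept as it is: it need not be
  -- differentiable, but it is O(z - t), and the increment of Y is μ y (z - t) minus it, up to o(z -
  -- t).
  have hFo : (fun z => (Real.exp (-g.rhoBar * z) * g.W (R r eta z) (g.freeX x eta z)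
      - E * g.W ρ y) - E * (-g.rhoBar * g.W ρ y * (z - t) + g.Wr ρ y * (R r eta z - ρ)
        + g.Wx ρ y * (g.mu * y * (z - t) - (R r eta z - ρ)))) =o[𝓝[>] t] fun z => z - t := by
    have h1 := (hF.isLittleO.comp_tendsto hpt).trans_isBigO hpO
    refine (h1.add (hUo.const_mul_left (E * g.Wx ρ y))).congr_left fun z => ?_
    simp only [Function.comp_apply, Prod.mk_sub_mk, _root_.add_apply, _root_.smul_apply,
      ContinuousLinearMap.comp_apply, ContinuousLinearMap.coe_fst', ContinuousLinearMap.coe_snd',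
      smul_eq_mul, ← hE, ← hρ, ← hy]
    ring
  set ε := (c - E * (G - g.piExt y)) / 2 with hε
  have hε0 : 0 < ε := by rw [hε]; linarith
  filter_upwards [hFo.def hε0, self_mem_nhdsWithin] with z hz hzt
  have hd : 0 < z - t := sub_pos.2 hzt
  rw [Real.norm_eq_abs, Real.norm_of_nonneg hd.le] at hz
  have hz' := (abs_le.1 hz).2
  rw [slope_def_field, div_lt_iff₀ hd]
  set θ := R r eta z - ρ with hθ
  have e1 := hh_eq hg ρ hD
  have e2 := hh_eq_sub hg ρ hD
  -- This quantity is the time in [t, z] not used for maximal abatement; it lies between 0 and z -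
  -- t, so G ≥ 0 dominates h times it.
  have hw0 : 0 ≤ (z - t) - θ / g.etaMax := by
    rw [sub_nonneg, div_le_iff₀ hm, mul_comm]; exact hθ1 z hzt
  have hw1 : (z - t) - θ / g.etaMax ≤ z - t := sub_le_self _ (div_nonneg (hθ0 z hzt) hm.le)
  have h5 : g.hh ρ y * ((z - t) - θ / g.etaMax) ≤ G * (z - t) :=
    (mul_le_mul_of_nonneg_right hG' hw0).trans (mul_le_mul_of_nonneg_left hw1 hG)
  -- The two expressions for h combine the drift terms with the abatement terms into h times the
  -- unused time.
  have h6 : -g.rhoBar * g.W ρ y * (z - t) + g.Wr ρ y * θ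
        + g.Wx ρ y * (g.mu * y * (z - t) - θ)
      = g.hh ρ y * ((z - t) - θ / g.etaMax) - g.piExt y * (z - t) := by
    have h7 : g.hh ρ y * (θ / g.etaMax) = (g.Wx ρ y - g.Wr ρ y) * θ := by
      rw [e2]; field_simp
    linear_combination -(z - t) * e1 + h7
  rw [h6] at hz'
  have h8 := mul_le_mul_of_nonneg_left (sub_le_sub_right h5 (g.piExt y * (z - t))) hE0.le
  have h9 : ε * (z - t) + E * (G * (z - t) - g.piExt y * (z - t)) < c * (z - t) := by
    have : ε + E * (G - g.piExt y) < c := by rw [hε]; linarith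
    have := mul_lt_mul_of_pos_right this hd
    linarith
  linarith

end Verification

end AbatementGame

/-! ### Verification: an upper bound for the payoff of every control -/

namespace AbatementGame

variable {g : AbatementGame}

section UpperBound

variable {eta : ℝ → ℝ}

lemma Theta_continuous (hg : g.ZeroNoiseAssumption) : Continuous g.Theta := by
  have h1 := (P0_continuous hg).comp (Xi_continuous hg)
  have h2 := (Q0_continuousOn hg).comp_continuous (hg.aExt_continuous.comp (Xi_continuous hg))
    fun _ => nonneg_mem_Dom hg (hg.aExt_nonneg _)
  simp only [Function.comp_def] at h1 h2
  unfold Theta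
  fun_prop

lemma W_continuousOn (hg : g.ZeroNoiseAssumption) :
    ContinuousOn (fun p : ℝ × ℝ => g.W p.1 p.2) (univ ×ˢ g.Dom) := by
  have hs : MapsTo (fun p : ℝ × ℝ => p.2) (univ ×ˢ g.Dom) g.Dom := fun p hp => hp.2
  have h1 := (tm_continuousOn hg).comp continuousOn_snd hs
  have h2 := (Q0_continuousOn hg).comp continuousOn_snd hs
  simp only [Function.comp_def] at h1 h2
  have h3 : ContinuousOn (fun p : ℝ × ℝ => g.tm p.2 + p.1 / g.etaMax) (univ ×ˢ g.Dom) :=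
    h1.add (by fun_prop)
  have h4 := (Theta_continuous hg).comp_continuousOn h3
  simp only [Function.comp_def] at h4
  simp only [W_eq_Theta hg]
  exact (h1.const_mul _).rexp.mul (h2.add h4)

lemma FirmControl.a_R_le_freeX (hg : g.ZeroNoiseAssumption) (he : g.FirmControl eta) {r x T : ℝ}
    (hr : 0 ≤ r) (hx : g.a r ≤ x) (hT : 0 ≤ T)
    (hlt : ∀ t, 0 ≤ t → t < T → g.a (R r eta t) < g.freeX x eta t) :
    g.a (R r eta T) ≤ g.freeX x eta T := by
  rcases hT.eq_or_lt with rfl | hT'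
  · rwa [R_zero, freeX_zero]
  have h1 : Tendsto (fun t => g.aExt (R r eta (max t 0))) (𝓝[<] T) (𝓝 (g.aExt (R r eta T))) := by
    have := ((continuous_aR hg he r).tendsto T).mono_left (nhdsWithin_le_nhds (s := Iio T))
    rwa [max_eq_left hT] at this
  have h2 : Tendsto (fun t => g.freeX x eta (max t 0)) (𝓝[<] T) (𝓝 (g.freeX x eta T)) := by
    have := ((he.freeX_continuous x).tendsto T).mono_left (nhdsWithin_le_nhds (s := Iio T))
    rwa [max_eq_left hT] at this
  rw [← aExt_of_nonneg (R_nonneg hr he hT)]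
  refine le_of_tendsto_of_tendsto h1 h2 ?_
  filter_upwards [Ioo_mem_nhdsLT hT'] with t ht
  rw [max_eq_left ht.1.le, aExt_of_nonneg (R_nonneg hr he ht.1.le)]
  exact (hlt t ht.1.le ht.2).le

/-- The verification inequality before the boundary `a` is hit. -/
lemma discounted_W_le (hg : g.ZeroNoiseAssumption) (he : g.FirmControl eta) {r x T : ℝ}
    (hr : 0 ≤ r) (hx : g.a r ≤ x) (hT : 0 ≤ T)
    (hlt : ∀ t, 0 ≤ t → t < T → g.a (R r eta t) < g.freeX x eta t) {G : ℝ → ℝ}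
    (hGc : Continuous G) (hG : ∀ t, 0 ≤ t → t < T → 0 ≤ G t)
    (hG' : ∀ t, 0 ≤ t → t < T → g.hh (R r eta t) (g.freeX x eta t) ≤ G t) :
    Real.exp (-g.rhoBar * T) * g.W (R r eta T) (g.freeX x eta T)
      + ∫ s in (0 : ℝ)..T, Real.exp (-g.rhoBar * s) * g.piExt (g.freeX x eta (max s 0))
      ≤ g.W r x + ∫ s in (0 : ℝ)..T, Real.exp (-g.rhoBar * s) * G s := by
  have hY := he.freeX_continuous x
  have hπ := hg.piExt_continuous
  have hR := he.R_continuous r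
  have hge : ∀ t ∈ Icc 0 T, g.a (R r eta t) ≤ g.freeX x eta t := fun t ht =>
    he.a_R_le_freeX hg hr hx ht.1 fun s hs hst => hlt s hs (hst.trans_le ht.2)
  have hφ : Continuous fun s => Real.exp (-g.rhoBar * s)
      * (G s - g.piExt (g.freeX x eta (max s 0))) := by fun_prop
  have hint := fun a b => hφ.intervalIntegrable (μ := volume) a b
  have hB : ∀ t, HasDerivAt (fun t => g.W r x + ∫ s in (0 : ℝ)..t, Real.exp (-g.rhoBar * s)
      * (G s - g.piExt (g.freeX x eta (max s 0))))
      (Real.exp (-g.rhoBar * t) * (G t - g.piExt (g.freeX x eta (max t 0)))) t := fun t =>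
    (intervalIntegral.integral_hasDerivAt_right (hint 0 t)
      (hφ.stronglyMeasurableAtFilter volume _) hφ.continuousAt).const_add _
  have hf : ContinuousOn (fun z => Real.exp (-g.rhoBar * z)
      * g.W (R r eta z) (g.freeX x eta z)) (Icc 0 T) := by
    have h1 : ContinuousOn (fun z => (R r eta (max z 0), g.freeX x eta (max z 0))) (Icc 0 T) :=
      (hR.prodMk hY).continuousOn
    have h2 := (W_continuousOn hg).comp h1 fun z hz => by
      rw [max_eq_left hz.1]
      exact ⟨mem_univ _, nonneg_mem_Dom hg
        ((hg.a_nonneg (R_nonneg hr he hz.1)).trans (hge z hz))⟩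
    have h3 : ContinuousOn (fun z => Real.exp (-g.rhoBar * z)) (Icc 0 T) := by fun_prop
    refine (h3.mul h2).congr fun z hz => ?_
    change _ = Real.exp (-g.rhoBar * z) * g.W (R r eta (max z 0)) (g.freeX x eta (max z 0))
    rw [max_eq_left hz.1]
  -- A comparison principle for right slopes replaces the chain rule, so no differentiability of the
  -- controlled path is needed.
  have key := image_le_of_liminf_slope_right_le_deriv_boundary hf
    (B := fun t => g.W r x + ∫ s in (0 : ℝ)..t, Real.exp (-g.rhoBar * s)
      * (G s - g.piExt (g.freeX x eta (max s 0)))) (by simp [R_zero, freeX_zero])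
    (fun t _ => (hB t).continuousAt.continuousWithinAt) (fun t _ => (hB t).hasDerivWithinAt)
    (fun t ht c hc => by
      rw [max_eq_left ht.1] at hc
      exact (eventually_slope_lt hg he hr x ht.1 (hlt t ht.1 ht.2) (hG t ht.1 ht.2)
        (hG' t ht.1 ht.2) hc).frequently) (right_mem_Icc.2 hT)
  have hsplit : ∫ s in (0 : ℝ)..T, Real.exp (-g.rhoBar * s)
        * (G s - g.piExt (g.freeX x eta (max s 0)))
      = (∫ s in (0 : ℝ)..T, Real.exp (-g.rhoBar * s) * G s)
        - ∫ s in (0 : ℝ)..T, Real.exp (-g.rhoBar * s) * g.piExt (g.freeX x eta (max s 0)) := by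
    rw [← intervalIntegral.integral_sub]
    · simp only [mul_sub]
    · exact Continuous.intervalIntegrable (by fun_prop) _ _
    · exact Continuous.intervalIntegrable (by fun_prop) _ _
  simp only [hsplit] at key
  linarith

/-- The free capacity can only shrink relative to its natural decline, while a(R) is nonnegative and
nondecreasing. -/
lemma FirmControl.freeX_le_a_R (hg : g.ZeroNoiseAssumption) (he : g.FirmControl eta) {r x s t : ℝ}
    (hr : 0 ≤ r) (hs : 0 ≤ s) (hst : s ≤ t) (h : g.freeX x eta s ≤ g.a (R r eta s)) :
    g.freeX x eta t ≤ g.a (R r eta t) := by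
  have hRs := R_nonneg hr he hs
  have hRt := R_nonneg hr he (hs.trans hst)
  have h1 := he.discounted_antitone x hs hst
  have h2 : g.freeX x eta t ≤ Real.exp (g.mu * (t - s)) * g.freeX x eta s := by
    have := mul_le_mul_of_nonneg_left h1 (Real.exp_pos (g.mu * t)).le
    rw [← mul_assoc, ← mul_assoc, ← Real.exp_add, ← Real.exp_add] at this
    ring_nf at this ⊢
    simpa using this
  have h3 : Real.exp (g.mu * (t - s)) ≤ 1 :=
    Real.exp_le_one_iff.2 (mul_nonpos_of_nonpos_of_nonneg hg.mu_nonpos (sub_nonneg.2 hst))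
  calc g.freeX x eta t ≤ Real.exp (g.mu * (t - s)) * g.freeX x eta s := h2
    _ ≤ Real.exp (g.mu * (t - s)) * g.a (R r eta s) :=
      mul_le_mul_of_nonneg_left h (Real.exp_pos _).le
    _ ≤ g.a (R r eta s) := mul_le_of_le_one_left (hg.a_nonneg hRs) h3
    _ ≤ g.a (R r eta t) := hg.a_strictMonoOn.monotoneOn hRs hRt (he.R_mono r hs hst)

lemma setLIntegral_Ioi_shift (f : ℝ → ℝ≥0∞) (c : ℝ) :
    ∫⁻ t in Ioi c, f t = ∫⁻ t in Ioi 0, f (t + c) := by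
  rw [← (measurePreserving_add_right volume c).setLIntegral_comp_preimage_emb
    (measurableEmbedding_addRight c)]
  simp

lemma lintegral_maxFlow (hg : g.ZeroNoiseAssumption) {r x : ℝ} (hr : 0 ≤ r) (hx : g.a r ≤ x) :
    ∫⁻ t in Ioi 0, ENNReal.ofReal (g.maxFlow r x t) = ENNReal.ofReal (g.W r x) := by
  rw [← payoffConst_max_eq hg hr, payoffConst_max hg hr hx]

/-- After the boundary `a` is hit, no control beats maximal abatement. -/
lemma lintegral_tail_le (hg : g.ZeroNoiseAssumption) (he : g.FirmControl eta) {r x τ : ℝ}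
    (hr : 0 ≤ r) (hτ : 0 ≤ τ) (h : g.freeX x eta τ ≤ g.a (R r eta τ)) :
    ∫⁻ t in Ioi τ, ENNReal.ofReal (Real.exp (-g.rhoBar * t)
        * g.piExt (max (g.freeX x eta t) (g.a (R r eta t))))
      ≤ ENNReal.ofReal (Real.exp (-g.rhoBar * τ) * g.W (R r eta τ) (g.a (R r eta τ))) := by
  have hRτ := R_nonneg hr he hτ
  rw [setLIntegral_Ioi_shift, ENNReal.ofReal_mul (Real.exp_pos _).le,
    ← lintegral_maxFlow hg hRτ le_rfl, ← lintegral_const_mul' _ _ ENNReal.ofReal_ne_top]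
  refine setLIntegral_mono' measurableSet_Ioi fun t ht => ?_
  have ht0 : 0 ≤ t := le_of_lt ht
  have htτ : τ ≤ t + τ := le_add_of_nonneg_left ht0
  have hle := he.freeX_le_a_R hg hr hτ htτ h
  have hRt := R_nonneg hr he (hτ.trans htτ)
  rw [← ENNReal.ofReal_mul (Real.exp_pos _).le, max_eq_right hle, maxFlow, ← mul_assoc,
    ← Real.exp_add]
  refine ENNReal.ofReal_le_ofReal ?_
  rw [show -g.rhoBar * (t + τ) = -g.rhoBar * τ + -g.rhoBar * t by ring]
  refine mul_le_mul_of_nonneg_left (hg.piExt_mono (le_max_of_le_right ?_)) (Real.exp_pos _).le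
  rw [← aExt_of_nonneg hRt]
  refine hg.aExt_mono ?_
  have := he.R_sub_le r hτ htτ
  rw [add_sub_cancel_right] at this
  linarith

/-- A bound that is uniform over finite horizons supplies the integrability on the half-line
together with the estimate. -/
lemma lintegral_Ioi_le_of_integral_le {f : ℝ → ℝ} {K : ℝ} (hf : Continuous f) (h0 : ∀ t, 0 ≤ f t)
    (h : ∀ T, 0 ≤ T → ∫ t in (0 : ℝ)..T, f t ≤ K) :
    ∫⁻ t in Ioi 0, ENNReal.ofReal (f t) ≤ ENNReal.ofReal K := by
  have hi : IntegrableOn f (Ioi 0) := by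
    refine integrableOn_Ioi_of_intervalIntegral_norm_bounded K 0 (l := atTop) (b := id)
      (fun T => (hf.intervalIntegrable 0 T).1) tendsto_id ?_
    filter_upwards [eventually_ge_atTop 0] with T hT
    simp only [Real.norm_of_nonneg (h0 _)]
    exact h T hT
  rw [← ofReal_integral_eq_lintegral_ofReal hi (Eventually.of_forall h0)]
  refine ENNReal.ofReal_le_ofReal ?_
  refine le_of_tendsto (intervalIntegral_tendsto_integral_Ioi 0 hi tendsto_id) ?_
  filter_upwards [eventually_ge_atTop 0] with T hT using h T hT

/-- The payoff of the firm is bounded through a bound on `h` along its path. -/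
theorem JF_nuA_le (hg : g.ZeroNoiseAssumption) (he : g.FirmControl eta) {r x C : ℝ}
    (hr : 0 ≤ r) (hx : g.a r ≤ x) {G : ℝ → ℝ} (hGc : Continuous G) (hG : ∀ t, 0 ≤ t → 0 ≤ G t)
    (hG' : ∀ t, 0 ≤ t → g.a (R r eta t) < g.freeX x eta t →
      g.hh (R r eta t) (g.freeX x eta t) ≤ G t)
    (hC : ∀ T, 0 ≤ T → ∫ s in (0 : ℝ)..T, Real.exp (-g.rhoBar * s) * G s ≤ C) :
    g.JF x eta (g.nuA r x eta) ≤ ENNReal.ofReal (g.W r x + C) := by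
  have hY := he.freeX_continuous x
  have hπ := hg.piExt_continuous
  rw [JF_nuA hg hr x he]
  set φ : ℝ → ℝ := fun s => Real.exp (-g.rhoBar * s) * g.piExt (g.freeX x eta (max s 0)) with hφ
  have hφc : Continuous φ := by fun_prop
  have hφ0 : ∀ s, 0 ≤ φ s := fun s => mul_nonneg (Real.exp_pos _).le (hg.piExt_nonneg _)
  have heq : ∀ t, 0 ≤ t → g.a (R r eta t) ≤ g.freeX x eta t → Real.exp (-g.rhoBar * t)
      * g.piExt (max (g.freeX x eta t) (g.a (R r eta t))) = φ t := fun t ht h => by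
    rw [max_eq_left h, hφ]; simp only [max_eq_left ht]
  rcases tau_cases hg he hr x with ⟨-, hlt⟩ | ⟨τ, -, hτ, hle, hlt⟩
  · rw [setLIntegral_congr_fun measurableSet_Ioi fun t ht =>
      congrArg ENNReal.ofReal (heq t (le_of_lt ht) (hlt t (le_of_lt ht)).le)]
    refine lintegral_Ioi_le_of_integral_le hφc hφ0 fun T hT => ?_
    have h1 := discounted_W_le hg he hr hx hT (fun t ht _ => hlt t ht) hGc
      (fun t ht _ => hG t ht) (fun t ht _ => hG' t ht (hlt t ht))
    have h2 := hC T hT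
    -- If `a` is never reached, the terminal value is dropped because W ≥ 0.
    have h3 := mul_nonneg (Real.exp_pos (-g.rhoBar * T)).le
      (W_nonneg hg (R_nonneg hr he hT) (hlt T hT).le)
    linarith
  · have h1 := discounted_W_le hg he hr hx hτ hlt hGc
      (fun t ht _ => hG t ht) (fun t ht h => hG' t ht (hlt t ht h))
    have h2 := hC τ hτ
    -- At the first hit the capacity lies exactly on the boundary, so the terminal value in
    -- `discounted_W_le` is the bound for the remaining payoff in `lintegral_tail_le`.
    have h4 : g.freeX x eta τ = g.a (R r eta τ) :=
      le_antisymm hle (he.a_R_le_freeX hg hr hx hτ hlt)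
    have h3 := mul_nonneg (Real.exp_pos (-g.rhoBar * τ)).le
      (W_nonneg hg (R_nonneg hr he hτ) le_rfl)
    rw [h4] at h1
    have h5 : ∫⁻ t in Ioc 0 τ, ENNReal.ofReal (Real.exp (-g.rhoBar * t)
        * g.piExt (max (g.freeX x eta t) (g.a (R r eta t))))
        = ENNReal.ofReal (∫ s in (0 : ℝ)..τ, φ s) := by
      rw [intervalIntegral.integral_of_le hτ, ofReal_integral_eq_lintegral_ofReal
        ((hφc.intervalIntegrable 0 τ).1) (Eventually.of_forall hφ0)]
      refine setLIntegral_congr_fun measurableSet_Ioc fun t ht => ?_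
      exact congrArg ENNReal.ofReal (heq t ht.1.le (he.a_R_le_freeX hg hr hx ht.1.le
        fun s hs hst => hlt s hs (hst.trans_le ht.2)))
    rw [← Ioc_union_Ioi_eq_Ioi hτ, lintegral_union measurableSet_Ioi
      (disjoint_left.2 fun t ht ht' => (not_le.2 ht') ht.2), h5]
    refine (add_le_add_right (lintegral_tail_le hg he hr hτ hle) _).trans ?_
    rw [← ENNReal.ofReal_add (intervalIntegral.integral_nonneg hτ fun s _ => hφ0 s) h3]
    exact ENNReal.ofReal_le_ofReal (by linarith)

end UpperBound

end AbatementGame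

/-! ### Equilibria: maximal abatement below `b`, and idling above `b` when μ = 0 -/

namespace AbatementGame

variable {g : AbatementGame}

section Equilibria

variable {eta : ℝ → ℝ} {b : ℝ → ℝ}

lemma FirmControl.freeX_le (he : g.FirmControl eta) (x : ℝ) {t : ℝ} (ht : 0 ≤ t) :
    g.freeX x eta t ≤ x * Real.exp (g.mu * t) := by
  have h := he.discounted_antitone x le_rfl ht
  rw [mul_zero, Real.exp_zero, one_mul, freeX_zero] at h
  have := mul_le_mul_of_nonneg_left h (Real.exp_pos (g.mu * t)).le
  rwa [← mul_assoc, ← Real.exp_add, neg_mul, add_neg_cancel, Real.exp_zero, one_mul,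
    mul_comm _ x] at this

/-- The function `h` along the free flow of the capacity, cut off at the boundary. -/
noncomputable def gain (g : AbatementGame) (b : ℝ → ℝ) (r x t : ℝ) : ℝ :=
  g.hh r (max (x * Real.exp (g.mu * t)) (b r))

variable {r x : ℝ}

lemma gain_continuous (hg : g.ZeroNoiseAssumption) (hb : g.IsZeroBoundary b) (hr : 0 ≤ r) :
    Continuous (g.gain b r x) :=
  (hh_continuousWithinAt_snd hg r).comp_continuous (by fun_prop) fun _ => nonneg_mem_Dom hg
    ((hg.a_nonneg hr).trans ((hb r hr).1.le.trans (le_max_right _ _)))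

lemma gain_nonneg (hg : g.ZeroNoiseAssumption) (hb : g.IsZeroBoundary b) (hr : 0 ≤ r) (t : ℝ) :
    0 ≤ g.gain b r x t := by
  rw [← (hb r hr).2, gain]
  exact (hh_strictMonoOn hg hr).monotoneOn (hb r hr).1
    ((hb r hr).1.trans_le (le_max_right _ _)) (le_max_right _ _)

lemma gain_eq_zero (hb : g.IsZeroBoundary b) (hr : 0 ≤ r) {t : ℝ}
    (h : x * Real.exp (g.mu * t) ≤ b r) : g.gain b r x t = 0 := by
  rw [gain, max_eq_right h, (hb r hr).2]

/-- No control lowers technology below r or lifts the free capacity above x e^{μt}; since h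
decreases in r and increases in x, the idle path from (r, x) has the largest h. -/
lemma hh_le_gain (hg : g.ZeroNoiseAssumption) (he : g.FirmControl eta) (hr : 0 ≤ r) {t : ℝ}
    (ht : 0 ≤ t) (h : g.a (R r eta t) < g.freeX x eta t) :
    g.hh (R r eta t) (g.freeX x eta t) ≤ g.gain b r x t := by
  have hra := hg.a_strictMonoOn.monotoneOn hr (R_nonneg hr he ht) (he.le_R r ht)
  have hY := (he.freeX_le x ht).trans (le_max_left _ (b r))
  have h1 : g.hh (R r eta t) (g.freeX x eta t) ≤ g.hh r (g.freeX x eta t) := by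
    rcases (he.le_R r ht).eq_or_lt with h' | h'
    · rw [← h']
    · exact (hh_anti hg hr h' h).le
  refine h1.trans ((hh_strictMonoOn hg hr).monotoneOn (hra.trans_lt h) ?_ hY)
  exact hra.trans_lt (h.trans_le hY)

/-- Below the boundary `b`, maximal abatement is optimal for the firm. -/
theorem JF_nuA_le_payoffConst (hg : g.ZeroNoiseAssumption) (hb : g.IsZeroBoundary b) (hr : 0 ≤ r)
    (hx : 0 ≤ x) (hxb : x ≤ b r) (he : g.FirmControl eta) :
    g.JF x eta (g.nuA r x eta) ≤ g.payoffConst g.etaMax r x := by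
  rcases le_or_gt (g.a r) x with hax | hax
  -- As μ ≤ 0, the free flow never rises above b(r), and the bound reduces to W.
  · have hz : ∀ t, 0 ≤ t → g.gain b r x t = 0 := fun t ht => gain_eq_zero hb hr <|
      (mul_le_of_le_one_right hx (Real.exp_le_one_iff.2
        (mul_nonpos_of_nonpos_of_nonneg hg.mu_nonpos ht))).trans hxb
    have := JF_nuA_le hg he hr hax (G := fun _ => 0) (C := 0) continuous_const (fun _ _ => le_rfl)
      (fun t ht h => (hh_le_gain hg he hr ht h).trans_eq (hz t ht)) (by simp)
    rwa [add_zero, ← payoffConst_max hg hr hax] at this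
  -- Below a(r) the boundary is hit at time 0, and the tail estimate covers the whole payoff.
  · have := lintegral_tail_le hg he hr le_rfl
      (by rw [R_zero, freeX_zero]; exact hax.le : g.freeX x eta 0 ≤ g.a (R r eta 0))
    rwa [← JF_nuA hg hr x he, mul_zero, Real.exp_zero, one_mul, R_zero,
      ← payoffConst_max_of_le hg hr hax.le] at this

section Undepreciated

lemma freeX_idle (x t : ℝ) : g.freeX x (fun _ => 0) t = x * Real.exp (g.mu * t) := by
  simp [freeX, mul_comm]

lemma firmControl_idle (hg : g.ZeroNoiseAssumption) : g.FirmControl fun _ => 0 :=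
  ⟨measurable_const, fun _ _ => ⟨le_rfl, hg.etaMax_pos.le⟩⟩

lemma payoffConst_zero (hg : g.ZeroNoiseAssumption) (hmu : g.mu = 0) (hr : 0 ≤ r) (x : ℝ) :
    g.payoffConst 0 r x = ENNReal.ofReal (g.piExt (max x (g.a r)) / g.rhoBar) := by
  have hrb := hg.rhoBar_pos
  rw [payoffConst, JF_nuA hg hr x (firmControl_idle hg)]
  simp only [R_const, freeX_idle, hmu, zero_mul, Real.exp_zero, mul_one, add_zero]
  rw [← ofReal_integral_eq_lintegral_ofReal
    ((integrableOn_exp_mul_Ioi (neg_neg_of_pos hrb) 0).mul_const _)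
    (Eventually.of_forall fun t => mul_nonneg (Real.exp_pos _).le (hg.piExt_nonneg _)),
    integral_mul_const, integral_exp_mul_Ioi (neg_neg_of_pos hrb)]
  congr 1
  rw [mul_zero, Real.exp_zero, neg_div_neg_eq, one_div_mul_eq_div]

/-- For μ = 0, idling above a(r) pays π(x)/ρ̄ and h = π - ρ̄ W, so the comparison of payoffs is the
sign of h. Below a(r) both payoffs equal those at a(r), where h < 0. -/
lemma payoffConst_lt_iff (hg : g.ZeroNoiseAssumption) (hb : g.IsZeroBoundary b) (hmu : g.mu = 0)
    (hr : 0 ≤ r) : g.payoffConst 0 r x < g.payoffConst g.etaMax r x ↔ x < b r := by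
  have hrb := hg.rhoBar_pos
  have key : ∀ y, g.a r ≤ y →
      (g.payoffConst 0 r y < g.payoffConst g.etaMax r y ↔ g.hh r y < 0) := by
    intro y hy
    have h0 : 0 ≤ g.piExt y / g.rhoBar := div_nonneg (hg.piExt_nonneg _) hrb.le
    rw [payoffConst_zero hg hmu hr, max_eq_left hy, payoffConst_max hg hr hy,
      ENNReal.ofReal_lt_ofReal_iff_of_nonneg h0, div_lt_iff₀ hrb,
      hh_eq hg r (nonneg_mem_Dom hg ((hg.a_nonneg hr).trans hy)), hmu]
    constructor <;> intro h <;> linarith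
  rcases lt_or_ge (g.a r) x with hx | hx
  · rw [key x hx.le, hh_neg_iff hg hb hr hx]
  · have h1 := (key (g.a r) le_rfl).2 (hh_a_neg hg hr)
    rw [payoffConst_zero hg hmu hr, max_self, payoffConst_max hg hr le_rfl] at h1
    rw [payoffConst_zero hg hmu hr, max_eq_right hx, payoffConst_max_of_le hg hr hx]
    exact iff_of_true h1 (hx.trans_lt (hb r hr).1)

lemma nuA_idle (hg : g.ZeroNoiseAssumption) (hmu : g.mu = 0) (hr : 0 ≤ r) (hx : g.a r < x)
    (t : ℝ) : g.nuA r x (fun _ => 0) t = 0 := by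
  rcases tau_cases hg (firmControl_idle hg) hr x with ⟨h, -⟩ | ⟨τ, -, -, h, -⟩
  · exact nuA_eq_zero h t
  · simp only [R_const, freeX_idle, hmu, zero_mul, Real.exp_zero, mul_one, add_zero] at h
    exact absurd h (not_le.2 hx)

/-- Above the boundary `b`, inaction is optimal for the firm if capacity does not depreciate. -/
theorem JF_nuA_le_idle (hg : g.ZeroNoiseAssumption) (hb : g.IsZeroBoundary b) (hmu : g.mu = 0)
    (hr : 0 ≤ r) (hx : b r < x) (he : g.FirmControl eta) :
    g.JF x eta (g.nuA r x eta) ≤ g.JF x (fun _ => 0) (g.nuA r x fun _ => 0) := by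
  have hrb := hg.rhoBar_pos
  have hax := (hb r hr).1.trans hx
  have hx0 := (hg.a_nonneg hr).trans hax.le
  have hpos := (hh_pos_iff hg hb hr hax).2 hx
  have hgain : ∀ t, g.gain b r x t = g.hh r x := fun t => by
    rw [gain, hmu, zero_mul, Real.exp_zero, mul_one, max_eq_left hx.le]
  have h1 := JF_nuA_le hg he hr hax.le (gain_continuous hg hb hr (x := x))
    (fun t _ => gain_nonneg hg hb hr t) (fun t ht h => hh_le_gain hg he hr ht h)
    (C := g.hh r x / g.rhoBar) (fun T hT => by
      simp only [hgain]
      rw [intervalIntegral.integral_mul_const, intervalIntegral.integral_of_le hT]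
      have h2 : ∫ s in Ioc 0 T, Real.exp (-g.rhoBar * s) ≤ ∫ s in Ioi 0,
          Real.exp (-g.rhoBar * s) :=
        setIntegral_mono_set (integrableOn_exp_mul_Ioi (neg_neg_of_pos hrb) 0)
          (Eventually.of_forall fun s => (Real.exp_pos _).le) Ioc_subset_Ioi_self.eventuallyLE
      rw [integral_exp_mul_Ioi (neg_neg_of_pos hrb), mul_zero, Real.exp_zero,
        neg_div_neg_eq] at h2
      exact (mul_le_mul_of_nonneg_right h2 hpos.le).trans_eq (one_div_mul_eq_div _ _))
  -- The bound is sharp: W + h/ρ̄ = π(x)/ρ̄, which is what idling pays.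
  refine h1.trans_eq ?_
  have h3 := payoffConst_zero hg hmu hr x
  rw [payoffConst, max_eq_left hax.le] at h3
  rw [h3, hh_eq hg r (nonneg_mem_Dom hg hx0), hmu]
  congr 1
  field_simp
  ring

lemma investorControl_zero (g : AbatementGame) : g.InvestorControl fun _ => 0 where
  mono := monotone_const
  rightCont := fun _ => continuousWithinAt_const
  eq_zero := fun _ _ => rfl
  finite_cost := by simp [dMeasure_zero]

/-- Inaction of both players is an equilibrium in open-loop form, if inaction is optimal against
the reflecting policy. -/
theorem isNash_idle (hg : g.ZeroNoiseAssumption) (hmu : g.mu = 0) (hr : 0 ≤ r) (hx : g.a r < x) :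
    g.IsNash r x (fun _ => 0) (fun _ _ => 0) where
  firm_control := firmControl_idle hg
  investor_control := fun _ _ => investorControl_zero g
  nonanticipative := fun _ _ _ _ _ _ _ => rfl
  nonneg := fun t _ => by
    rw [X_zero, freeX_idle]
    exact mul_nonneg ((hg.a_nonneg hr).trans hx.le) (Real.exp_pos _).le
  firm_opt := fun eta' he' => by
    refine setLIntegral_mono' measurableSet_Ioi fun t ht => ENNReal.ofReal_le_ofReal ?_
    rw [X_zero, X_zero, freeX_idle]
    exact mul_le_mul_of_nonneg_left (hg.piExt_mono (he'.freeX_le x (le_of_lt ht)))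
      (Real.exp_pos _).le
  investor_opt := fun nu hnu => by
    -- The reflecting policy answers idling with no investment, so its optimality is that of the
    -- zero control.
    have := JI_le_JI_nuA hg (firmControl_idle hg) hr ((hg.a_nonneg hr).trans hx.le) hnu
    rwa [show g.nuA r x (fun _ => 0) = fun _ => 0 from funext (nuA_idle hg hmu hr hx)] at this

end Undepreciated

end Equilibria

end AbatementGame

/-! ### Waiting until `τ_b` when μ < 0 -/

namespace AbatementGame

variable {g : AbatementGame}

section Depreciated

variable {b : ℝ → ℝ} {r x τ : ℝ}

lemma tauB_eq (g : AbatementGame) (hτ : 0 ≤ τ) (h : x * Real.exp (g.mu * τ) ≤ b r)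
    (hlt : ∀ t, 0 ≤ t → t < τ → b r < x * Real.exp (g.mu * t)) : g.tauB b r x = τ := by
  refine le_antisymm (sInf_le ⟨τ, ⟨hτ, h⟩, rfl⟩) (le_sInf ?_)
  rintro _ ⟨t, ht, rfl⟩
  exact EReal.coe_le_coe_iff.2 (not_lt.1 fun hlt' => not_le.2 (hlt t ht.1 hlt') ht.2)

/-- The idle capacity x e^{μt} decreases strictly and equals b(r) at the time log(b(r)/x)/μ. -/
lemma exists_tauB_eq (hmu : g.mu < 0) (hb : 0 < b r) (hx : b r < x) :
    ∃ τ, 0 < τ ∧ x * Real.exp (g.mu * τ) = b r ∧ g.tauB b r x = τ := by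
  have hx0 := hb.trans hx
  have h1 : Real.log (b r / x) < 0 := Real.log_neg (div_pos hb hx0) ((div_lt_one hx0).2 hx)
  have h2 : x * Real.exp (g.mu * (Real.log (b r / x) / g.mu)) = b r := by
    rw [mul_div_cancel₀ _ hmu.ne, Real.exp_log (div_pos hb hx0), mul_div_cancel₀ _ hx0.ne']
  have hτ : 0 < Real.log (b r / x) / g.mu := div_pos_of_neg_of_neg h1 hmu
  refine ⟨_, hτ, h2, tauB_eq g hτ.le h2.le fun t ht hlt => ?_⟩
  rw [← h2]
  exact mul_lt_mul_of_pos_left (Real.exp_lt_exp.2 (mul_lt_mul_of_neg_left hlt hmu)) hx0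

lemma etaB_of_lt (h : g.tauB b r x = τ) {t : ℝ} (ht : t < τ) : g.etaB b r x t = 0 := by
  rw [etaB, if_neg]; rw [h, not_le]; exact EReal.coe_lt_coe_iff.2 ht

lemma etaB_of_le (h : g.tauB b r x = τ) {t : ℝ} (ht : τ ≤ t) :
    g.etaB b r x t = g.etaMax := by
  rw [etaB, if_pos]; rw [h]; exact EReal.coe_le_coe_iff.2 ht

lemma firmControl_etaB (hg : g.ZeroNoiseAssumption) (b : ℝ → ℝ) (r x : ℝ) :
    g.FirmControl (g.etaB b r x) := by
  refine ⟨Measurable.ite (measurableSet_le measurable_const measurable_coe_real_ereal)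
    measurable_const measurable_const, fun t _ => ?_⟩
  rw [etaB]
  split_ifs
  · exact ⟨hg.etaMax_pos.le, le_rfl⟩
  · exact ⟨le_rfl, hg.etaMax_pos.le⟩

lemma integral_mul_etaB_of_le (h : g.tauB b r x = τ) {t : ℝ} (ht : 0 ≤ t) (htτ : t ≤ τ)
    (f : ℝ → ℝ) : ∫ s in (0 : ℝ)..t, f s * g.etaB b r x s = 0 := by
  rw [intervalIntegral.integral_of_le ht, integral_Ioc_eq_integral_Ioo,
    setIntegral_congr_fun (g := fun _ => 0) measurableSet_Ioo fun s hs => by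
      simp only [etaB_of_lt h (hs.2.trans_le htτ), mul_zero]]
  simp

lemma integral_mul_etaB (hg : g.ZeroNoiseAssumption) (h : g.tauB b r x = τ) (hτ : 0 ≤ τ) {t : ℝ}
    (ht : 0 ≤ t) {f : ℝ → ℝ} (hf : Continuous f) :
    ∫ s in (0 : ℝ)..(t + τ), f s * g.etaB b r x s
      = ∫ s in (0 : ℝ)..t, f (s + τ) * g.etaMax := by
  have he := firmControl_etaB hg b r x
  rw [← intervalIntegral.integral_add_adjacent_intervals (he.intervalIntegrable_mul hf le_rfl hτ)
    (he.intervalIntegrable_mul hf hτ (add_nonneg ht hτ)), integral_mul_etaB_of_le h hτ le_rfl,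
    zero_add, intervalIntegral.integral_comp_add_right (fun s => f s * g.etaMax), zero_add]
  refine intervalIntegral.integral_congr fun s hs => ?_
  rw [uIcc_of_le (le_add_of_nonneg_left ht)] at hs
  simp only [etaB_of_le h hs.1]

lemma R_etaB_of_le (h : g.tauB b r x = τ) {t : ℝ} (ht : 0 ≤ t) (htτ : t ≤ τ) :
    R r (g.etaB b r x) t = r := by
  have := integral_mul_etaB_of_le h ht htτ fun _ => 1
  simp only [one_mul] at this
  rw [R, this, add_zero]

lemma freeX_etaB_of_le (h : g.tauB b r x = τ) {t : ℝ} (ht : 0 ≤ t) (htτ : t ≤ τ) :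
    g.freeX x (g.etaB b r x) t = x * Real.exp (g.mu * t) := by
  rw [freeX, integral_mul_etaB_of_le h ht htτ, sub_zero, mul_comm]

lemma R_etaB (hg : g.ZeroNoiseAssumption) (h : g.tauB b r x = τ) (hτ : 0 ≤ τ) {t : ℝ}
    (ht : 0 ≤ t) : R r (g.etaB b r x) (t + τ) = r + g.etaMax * t := by
  have := integral_mul_etaB hg h hτ ht (f := fun _ => 1) continuous_const
  simp only [one_mul] at this
  rw [← R_const r g.etaMax t, R, R, this]

/-- After τ the path restarts as maximal abatement from the capacity x e^{μτ} reached by natural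
decline. -/
lemma freeX_etaB (hg : g.ZeroNoiseAssumption) (h : g.tauB b r x = τ) (hτ : 0 ≤ τ) {t : ℝ}
    (ht : 0 ≤ t) : g.freeX x (g.etaB b r x) (t + τ)
      = g.freeX (x * Real.exp (g.mu * τ)) (fun _ => g.etaMax) t := by
  have e : ∀ s, Real.exp (-g.mu * (s + τ)) * g.etaMax
      = Real.exp (-g.mu * τ) * (Real.exp (-g.mu * s) * g.etaMax) := fun s => by
    rw [mul_add, Real.exp_add]; ring
  have e' : Real.exp (g.mu * τ) * Real.exp (-g.mu * τ) = 1 := by rw [← Real.exp_add]; simp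
  rw [freeX, freeX, integral_mul_etaB hg h hτ ht (by fun_prop)]
  simp only [e]
  rw [intervalIntegral.integral_const_mul, mul_add, Real.exp_add]
  linear_combination -Real.exp (g.mu * t) *
    (∫ s in (0 : ℝ)..t, Real.exp (-g.mu * s) * g.etaMax) * e'

lemma lintegral_tail_etaB (hg : g.ZeroNoiseAssumption) (hr : 0 ≤ r) (h : g.tauB b r x = τ)
    (hτ : 0 ≤ τ) :
    ∫⁻ t in Ioi τ, ENNReal.ofReal (Real.exp (-g.rhoBar * t) * g.piExt
        (max (g.freeX x (g.etaB b r x) t) (g.a (R r (g.etaB b r x) t))))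
      = ENNReal.ofReal (Real.exp (-g.rhoBar * τ))
        * g.payoffConst g.etaMax r (x * Real.exp (g.mu * τ)) := by
  rw [setLIntegral_Ioi_shift, payoffConst_max_eq hg hr,
    ← lintegral_const_mul' _ _ ENNReal.ofReal_ne_top]
  refine setLIntegral_congr_fun measurableSet_Ioi fun t ht => ?_
  have ht0 : 0 ≤ t := le_of_lt ht
  have h0 : 0 ≤ r + g.etaMax * t := add_nonneg hr (mul_nonneg hg.etaMax_pos.le ht0)
  simp only [R_etaB hg h hτ ht0, freeX_etaB hg h hτ ht0, maxFlow, aExt_of_nonneg h0]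
  rw [← ENNReal.ofReal_mul (Real.exp_pos _).le, ← mul_assoc, ← Real.exp_add]
  ring_nf

/-- The value of waiting along the free flow of the capacity. -/
lemma integral_hh_flow (hg : g.ZeroNoiseAssumption) (hr : 0 ≤ r) (hx : 0 ≤ x) (hτ : 0 ≤ τ)
    (h : ∀ t ∈ Icc 0 τ, g.a r < x * Real.exp (g.mu * t)) :
    g.W r x + ∫ t in (0 : ℝ)..τ, Real.exp (-g.rhoBar * t) * g.hh r (x * Real.exp (g.mu * t))
      = (∫ t in (0 : ℝ)..τ, Real.exp (-g.rhoBar * t) * g.piExt (x * Real.exp (g.mu * t)))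
        + Real.exp (-g.rhoBar * τ) * g.W r (x * Real.exp (g.mu * τ)) := by
  have hD : ∀ t, x * Real.exp (g.mu * t) ∈ g.Dom := fun t =>
    nonneg_mem_Dom hg (mul_nonneg hx (Real.exp_pos _).le)
  have hhc : Continuous fun t => g.hh r (x * Real.exp (g.mu * t)) :=
    (hh_continuousWithinAt_snd hg r).comp_continuous (by fun_prop) hD
  have hπ := hg.piExt_continuous
  have h1 : Continuous fun t => Real.exp (-g.rhoBar * t) * g.hh r (x * Real.exp (g.mu * t)) := by
    fun_prop
  have h2 : Continuous fun t => Real.exp (-g.rhoBar * t) * g.piExt (x * Real.exp (g.mu * t)) := by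
    fun_prop
  have hd : ∀ t ∈ uIcc 0 τ, HasDerivAt (fun t => Real.exp (-g.rhoBar * t)
      * g.W r (x * Real.exp (g.mu * t)))
      (Real.exp (-g.rhoBar * t) * g.hh r (x * Real.exp (g.mu * t))
        - Real.exp (-g.rhoBar * t) * g.piExt (x * Real.exp (g.mu * t))) t := by
    intro t ht
    rw [uIcc_of_le hτ] at ht
    have h3 : HasDerivAt (fun t => x * Real.exp (g.mu * t))
        (x * (Real.exp (g.mu * t) * (g.mu * 1))) t :=
      (((hasDerivAt_id' t).const_mul g.mu).exp).const_mul x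
    have h4 := ((hasDerivAt_id' t).const_mul (-g.rhoBar)).exp.mul
      ((W_hasDerivAt hg (hD t) (hit_pos hg hr (h t ht))).comp t h3)
    refine h4.congr_deriv ?_
    -- With technology frozen, e^{-ρ̄t} W(r, x e^{μt}) has derivative e^{-ρ̄t} (h - π), by the form
    -- of h without W_r.
    rw [hh_eq hg r (hD t), Function.comp_apply]
    ring
  have h5 := intervalIntegral.integral_eq_sub_of_hasDerivAt hd ((h1.sub h2).intervalIntegrable 0 τ)
  rw [intervalIntegral.integral_sub (h1.intervalIntegrable 0 τ) (h2.intervalIntegrable 0 τ)] at h5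
  simp only [mul_zero, Real.exp_zero, one_mul, mul_one] at h5
  linarith

/-- Waiting until `τ_b` is optimal for the firm. -/
theorem JF_nuA_le_etaB (hg : g.ZeroNoiseAssumption) (hb : g.IsZeroBoundary b) (hmu : g.mu < 0)
    (hr : 0 ≤ r) (hx : 0 ≤ x) {eta : ℝ → ℝ} (he : g.FirmControl eta) :
    g.JF x eta (g.nuA r x eta) ≤ g.JF x (g.etaB b r x) (g.nuA r x (g.etaB b r x)) := by
  rw [JF_nuA hg hr x (firmControl_etaB hg b r x)]
  rcases le_or_gt x (b r) with hxb | hxb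
  · have h0 : g.tauB b r x = (0 : ℝ) := tauB_eq g le_rfl (by simpa using hxb)
      fun t ht ht' => absurd ht' (not_lt.2 ht)
    rw [lintegral_tail_etaB hg hr h0 le_rfl]
    simpa using JF_nuA_le_payoffConst hg hb hr hx hxb he
  have hb0 : 0 < b r := (hg.a_nonneg hr).trans_lt (hb r hr).1
  obtain ⟨τ, hτ, hxτ, h⟩ := exists_tauB_eq hmu hb0 hxb
  have hax := (hb r hr).1.trans hxb
  have hearly : ∀ t ∈ Icc 0 τ, b r ≤ x * Real.exp (g.mu * t) := fun t ht => by
    rw [← hxτ]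
    exact mul_le_mul_of_nonneg_left (Real.exp_le_exp.2 (mul_le_mul_of_nonpos_left ht.2 hmu.le)) hx
  have hlate : ∀ t, τ ≤ t → g.gain b r x t = 0 := fun t ht => by
    refine gain_eq_zero hb hr ?_
    rw [← hxτ]
    exact mul_le_mul_of_nonneg_left (Real.exp_le_exp.2 (mul_le_mul_of_nonpos_left ht hmu.le)) hx
  have hφ : Continuous fun t => Real.exp (-g.rhoBar * t) * g.gain b r x t := by
    have := gain_continuous hg hb hr (x := x)
    fun_prop
  have hφ0 : ∀ t, 0 ≤ Real.exp (-g.rhoBar * t) * g.gain b r x t := fun t =>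
    mul_nonneg (Real.exp_pos _).le (gain_nonneg hg hb hr t)
  -- The discounted gain is nonnegative and vanishes from τ on, so its integral over any horizon is
  -- at most the one up to τ.
  have hC : ∀ T, 0 ≤ T → ∫ s in (0 : ℝ)..T, Real.exp (-g.rhoBar * s) * g.gain b r x s
      ≤ ∫ s in (0 : ℝ)..τ, Real.exp (-g.rhoBar * s) * g.gain b r x s := by
    intro T hT
    rcases le_total T τ with hTτ | hTτ
    · exact intervalIntegral.integral_mono_interval le_rfl hT hTτ
        (Eventually.of_forall hφ0) (hφ.intervalIntegrable _ _)
    · rw [← intervalIntegral.integral_add_adjacent_intervals (hφ.intervalIntegrable 0 τ)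
        (hφ.intervalIntegrable τ T), intervalIntegral.integral_congr (a := τ) (g := fun _ => 0)
          fun s hs => ?_]
      · simp
      · rw [uIcc_of_le hTτ] at hs
        simp only [hlate s hs.1, mul_zero]
  refine (JF_nuA_le hg he hr hax.le (gain_continuous hg hb hr (x := x))
    (fun t _ => gain_nonneg hg hb hr t) (fun t ht h => hh_le_gain hg he hr ht h) hC).trans_eq ?_
  have hgain : ∫ s in (0 : ℝ)..τ, Real.exp (-g.rhoBar * s) * g.gain b r x s
      = ∫ s in (0 : ℝ)..τ, Real.exp (-g.rhoBar * s) * g.hh r (x * Real.exp (g.mu * s)) := by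
    refine intervalIntegral.integral_congr fun s hs => ?_
    rw [uIcc_of_le hτ.le] at hs
    simp only [gain, max_eq_left (hearly s hs)]
  -- The bound is sharp: W plus the gain up to τ equals the profit of idling until τ plus the
  -- discounted value of maximal abatement from b(r).
  rw [hgain, integral_hh_flow hg hr hx hτ.le fun t ht => (hb r hr).1.trans_le (hearly t ht),
    hxτ, ← Ioc_union_Ioi_eq_Ioi hτ.le, lintegral_union measurableSet_Ioi
      (disjoint_left.2 fun t ht ht' => (not_le.2 ht') ht.2), lintegral_tail_etaB hg hr h hτ.le,
    hxτ, payoffConst_max hg hr (hb r hr).1.le, ← ENNReal.ofReal_mul (Real.exp_pos _).le]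
  have hπ := hg.piExt_continuous
  have hψ : Continuous fun t => Real.exp (-g.rhoBar * t) * g.piExt (x * Real.exp (g.mu * t)) := by
    fun_prop
  have hψ0 : ∀ t, 0 ≤ Real.exp (-g.rhoBar * t) * g.piExt (x * Real.exp (g.mu * t)) := fun t =>
    mul_nonneg (Real.exp_pos _).le (hg.piExt_nonneg _)
  rw [ENNReal.ofReal_add (intervalIntegral.integral_nonneg hτ.le fun s _ => hψ0 s)
    (mul_nonneg (Real.exp_pos _).le (W_nonneg hg hr (hb r hr).1.le)),
    intervalIntegral.integral_of_le hτ.le, ofReal_integral_eq_lintegral_ofReal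
      ((hψ.intervalIntegrable 0 τ).1) (Eventually.of_forall hψ0)]
  congr 1
  refine setLIntegral_congr_fun measurableSet_Ioc fun t ht => ?_
  simp only [R_etaB_of_le h ht.1.le ht.2, freeX_etaB_of_le h ht.1.le ht.2,
    max_eq_left ((hb r hr).1.le.trans (hearly t ⟨ht.1.le, ht.2⟩))]

end Depreciated

end AbatementGame

/-! ### Assembly of the equilibria from one zero boundary of h -/

theorem theorem2p1 (g : AbatementGame) (hg : g.ZeroNoiseAssumption) :
    -- the reflecting policy keeps the capacity at or above the boundary `a`
    (∀ r x : ℝ, 0 ≤ r → 0 < x → ∀ eta : ℝ → ℝ, g.FirmControl eta →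
      ∀ t : ℝ, 0 ≤ t →
        g.a (AbatementGame.R r eta t) ≤ g.X x eta (g.nuA r x eta) t) ∧
    -- (i)
    (g.mu = 0 → ∃ b : ℝ → ℝ, g.IsBoundary b ∧
      -- this determines `b` uniquely on `[0, ∞)`
      (∀ r x : ℝ, 0 ≤ r → 0 < x →
        (g.payoffConst 0 r x < g.payoffConst g.etaMax r x ↔ x < b r)) ∧
      (∀ r x : ℝ, 0 ≤ r → b r < x →
        (∀ t : ℝ, g.nuA r x (fun _ => 0) t = 0) ∧
        g.IsNash r x (fun _ => 0) (g.nuA r x) ∧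
        g.IsNash r x (fun _ => 0) (fun _ _ => 0)) ∧
      (∀ r x : ℝ, 0 ≤ r → 0 < x → x ≤ b r →
        g.IsNash r x (fun _ => g.etaMax) (g.nuA r x))) ∧
    -- (ii)
    (g.mu < 0 → ∃ b : ℝ → ℝ, g.IsBoundary b ∧
      -- this determines `b` uniquely on `[0, ∞)`
      (∀ r x : ℝ, 0 ≤ r → g.a r < x → (g.h r x = 0 ↔ x = b r)) ∧
      (∀ r x : ℝ, 0 ≤ r → 0 < x →
        g.IsNash r x (g.etaB b r x) (g.nuA r x))) := by
  refine ⟨fun r x hr _ eta he t ht => AbatementGame.le_X_nuA hg he hr x ht, fun hmu => ?_,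
    fun hmu => ?_⟩
  · obtain ⟨b, hb⟩ := AbatementGame.exists_isZeroBoundary hg
    refine ⟨b, hb.isBoundary hg,
      fun r x hr _ => AbatementGame.payoffConst_lt_iff hg hb hmu hr, fun r x hr hx => ?_,
      fun r x hr hx hxb => ?_⟩
    · have hax := (hb r hr).1.trans hx
      exact ⟨AbatementGame.nuA_idle hg hmu hr hax,
        AbatementGame.isNash_nuA hg hr ((hg.a_nonneg hr).trans hax.le)
          (AbatementGame.firmControl_idle hg)
          fun _ he => AbatementGame.JF_nuA_le_idle hg hb hmu hr hx he,
        AbatementGame.isNash_idle hg hmu hr hax⟩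
    · exact AbatementGame.isNash_nuA hg hr hx.le (AbatementGame.firmControl_const hg)
        fun _ he => AbatementGame.JF_nuA_le_payoffConst hg hb hr hx.le hxb he
  · obtain ⟨b, hb⟩ := AbatementGame.exists_isZeroBoundary hg
    refine ⟨b, hb.isBoundary hg, fun r x hr hx => ?_, fun r x hr hx => ?_⟩
    · rw [AbatementGame.h_eq_hh hg hr hx, AbatementGame.hh_zero_iff hg hb hr hx]
    · exact AbatementGame.isNash_nuA hg hr hx.le (AbatementGame.firmControl_etaB hg b r x)
        fun _ he => AbatementGame.JF_nuA_le_etaB hg hb hmu hr hx.le he
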